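/- **Conventions.** $m$ is Lebesgue measure on $\mathbb R^n$; "tile" and "measurable partition" are understood modulo null sets. For a countable group $G$ of transformations of $\mathbb R^n$, a measurable set $W$ is a *$G$-tile* if $\{gW\}_{g\in G}$ is a measurable partition of $\mathbb R^n$. Measurable sets $\Omega,\Psi$ are *$G$-congruent* if they have measurable partitions $\{\Omega_g\}_{g\in G}$, $\{\Psi_g\}_{g\in G}$ (empty pieces allowed) with $g\Omega_g=\Psi_g$. A real matrix is *expansive* if all its complex eigenvalues have absolute value $>1$. A *bounding hyperplane* of a set $F$ is an affine hyperplane $H$ such that $F$ lies on one side of $H$ and $F\cap H$ affinely spans $H$. A *foldable figure* is a compact connected set $C\subset\mathbb R^n$ with nonempty interior for which there is a finite set $\mathcal S$ of affine hyperplanes cutting $C$ into finitely many, at least two, subfigures $C_1,\dots,C_k$ (the intersections of $C$ with the closures of those open cells of the arrangement $\mathcal S$ that meet $C$), which are congruent to each other and similar to $C$, such that reflection in any $H\in\mathcal S$ bounding $C_i$ takes $C_i$ into some $C_j$. Its affine Weyl group $\widetilde{\mathcal W}$ is the group generated by the reflections about the bounding hyperplanes of $C$. **Wavelet sets.** For a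 full rank lattice $\Lambda$ and an expansive matrix $B$, a measurable set $W$ of finite measure is a *wavelet set* for $(B,\Lambda)$ if, with $\psi=\mathcal F^{-1}\big(m(W)^{-1/2}\chi_W\big)$ and $\mathcal F^{-1}g(t)=\int e^{2\pi i\langle s,t\rangle}g(s)\,ds$, the functions $|\det B|^{j/2}\,\psi(B^jt-\lambda)$, $j\in\mathbb Z$, $\lambda\in\Lambda$, form an orthonormal basis of $L^2(\mathbb R^n)$. For $\mathcal D=\{A^j\mid j\in\mathbb Z\}$ and a full rank lattice $\widetilde\Gamma$, both acting on the frequency side, $W$ is a *$(\mathcal D,\widetilde\Gamma)$-dilation-translation wavelet set* if it is a wavelet set for $(A^{T},\widetilde\Gamma^*)$, where $\widetilde\Gamma^*=\{\gamma\mid\langle\gamma,\sigma\rangle\in\mathbb Z\ \ \forall\sigma\in\widetilde\Gamma\}$. A measurable set $W$ is a *$(\mathcal D,\widetilde{\mathcal W})$-dilation-reflection wavelet set* if it is $\widetilde{\mathcal W}$-congruent to $C$ and is a $\mathcal D$-tile. The triple $(\widetilde{\mathcal W},\widetilde\Gamma,\mathcal D)$ is *allowable* if some measurable set is $\widetilde{\mathcal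 W}$-congruent to $C$, is a $\mathcal D$-tile, and is $\widetilde\Gamma$-congruent to a fundamental parallelepiped $\{\sum_i t_ib_i\mid 0\le t_i<1\}$ of a basis $(b_i)$ of $\widetilde\Gamma$. **Theorem.** Let $C\subset\mathbb R^2$ be a foldable figure and $\widetilde{\mathcal W}$ its affine Weyl group. Then there is a full rank lattice $\widetilde\Gamma\subset\mathbb R^2$ such that for every expansive real $2\times2$ matrix $A$, with $\mathcal D=\{A^j\mid j\in\mathbb Z\}$, there is a measurable set $W\subset\mathbb R^2$ that is simultaneously a tile for $\widetilde\Gamma$ (acting by translations), for $\widetilde{\mathcal W}$, and for $\mathcal D$; moreover $W$ is a $(\mathcal D,\widetilde\Gamma)$-dilation-translation wavelet set and a $(\mathcal D,\widetilde{\mathcal W})$-dilation-reflection wavelet set. In particular $(\widetilde{\mathcal W},\widetilde\Gamma,\mathcal D)$ is an allowable triple. -/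

import Mathlib

open MeasureTheory
open scoped RealInnerProductSpace FourierTransform

noncomputable section

/-- Euclidean space `ℝⁿ`. -/
abbrev Euc (n : ℕ) : Type := EuclideanSpace ℝ (Fin n)

/-! ### Affine hyperplanes and reflections -/

/-- The affine hyperplane `H_{r,k} = {x | ⟨x, r⟩ = k}` (a hyperplane when `r ≠ 0`). -/
def affHyperplane {n : ℕ} (r : Euc n) (k : ℝ) : Set (Euc n) := {x | ⟪x, r⟫ = k}

/-- The formula `x ↦ x - (2 (⟨x, r⟩ - k) / ⟨r, r⟩) r` for the reflection about `H_{r,k}`. -/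
def affReflectionFun {n : ℕ} (r : Euc n) (k : ℝ) (x : Euc n) : Euc n :=
  x - (2 * (⟪x, r⟫ - k) / ⟪r, r⟫) • r

lemma affReflectionFun_involutive {n : ℕ} (r : Euc n) (k : ℝ) :
    Function.Involutive (affReflectionFun r k) := by
  intro x
  by_cases hr : r = 0
  · simp [affReflectionFun, hr]
  have h : (⟪r, r⟫ : ℝ) ≠ 0 := inner_self_ne_zero.mpr hr
  have h2 : 2 * (⟪x, r⟫ - 2 * (⟪x, r⟫ - k) / ⟪r, r⟫ * ⟪r, r⟫ - k) / ⟪r, r⟫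
      = -(2 * (⟪x, r⟫ - k) / ⟪r, r⟫) := by
    field_simp
    ring
  simp only [affReflectionFun, inner_sub_left, real_inner_smul_left]
  rw [h2]
  module

lemma affReflectionFun_isometry {n : ℕ} (r : Euc n) (k : ℝ) :
    Isometry (affReflectionFun r k) := by
  refine Isometry.of_dist_eq fun x y => ?_
  by_cases hr : r = 0
  · simp [affReflectionFun, hr]
  have h : (⟪r, r⟫ : ℝ) ≠ 0 := inner_self_ne_zero.mpr hr
  have h1 : affReflectionFun r k x - affReflectionFun r k y
      = (x - y) - (2 * ⟪x - y, r⟫ / ⟪r, r⟫) • r := by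
    have h0 : 2 * ⟪x - y, r⟫ / ⟪r, r⟫
        = 2 * (⟪x, r⟫ - k) / ⟪r, r⟫ - 2 * (⟪y, r⟫ - k) / ⟪r, r⟫ := by
      rw [inner_sub_left]
      ring
    rw [h0]
    simp only [affReflectionFun]
    module
  rw [dist_eq_norm, dist_eq_norm, h1]
  rw [← sq_eq_sq₀ (norm_nonneg _) (norm_nonneg _), ← real_inner_self_eq_norm_sq,
    ← real_inner_self_eq_norm_sq]
  generalize x - y = z
  simp only [inner_sub_left, inner_sub_right, real_inner_smul_left, real_inner_smul_right,
    real_inner_comm z r]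
  field_simp
  ring

/-- The reflection about the affine hyperplane `H_{r,k}`, as an isometry of `ℝⁿ`. -/
def affReflection {n : ℕ} (r : Euc n) (k : ℝ) : Euc n ≃ᵢ Euc n :=
  ⟨(affReflectionFun_involutive r k).toPerm, affReflectionFun_isometry r k⟩

/-- `H_{r,k}` is a bounding hyperplane of `F`: the set `F` lies on one side of `H_{r,k}`, and
the part of `F` in `H_{r,k}` spans `H_{r,k}` (so that it is a facet, not a lower-dimensional
face). -/
def IsBoundingHyperplane {n : ℕ} (r : Euc n) (k : ℝ) (F : Set (Euc n)) : Prop :=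
  r ≠ 0 ∧ ((∀ x ∈ F, ⟪x, r⟫ ≤ k) ∨ (∀ x ∈ F, k ≤ ⟪x, r⟫)) ∧
    (affineSpan ℝ (F ∩ affHyperplane r k) : Set (Euc n)) = affHyperplane r k

/-! ### Foldable figures and their groups -/

/-- The part of `F` that lies in the closed cell, containing `x`, of the arrangement of
hyperplanes `H_{r,k}`, `(r, k) ∈ S`. (For `x` on none of the hyperplanes.) -/
def cutPiece {n : ℕ} (S : Finset (Euc n × ℝ)) (F : Set (Euc n)) (x : Euc n) : Set (Euc n) :=
  {y ∈ F | ∀ p ∈ S, 0 ≤ (⟪x, p.1⟫ - p.2) * (⟪y, p.1⟫ - p.2)}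

/-- The subfigures into which the hyperplanes in `S` cut `F`: one for every open cell of the
arrangement that meets `F`. -/
def cutPieces {n : ℕ} (S : Finset (Euc n × ℝ)) (F : Set (Euc n)) : Set (Set (Euc n)) :=
  {P | ∃ x ∈ F, (∀ p ∈ S, ⟪x, p.1⟫ ≠ p.2) ∧ P = cutPiece S F x}

/-- Foldable figures: compact connected bodies (nonempty interior) that some finite set of affine
hyperplanes cuts (into at least two pieces), such that the pieces are congruent to each other and
similar to `F`, and such that reflection in any cutting hyperplane bounding a piece takes that
piece into a piece. -/
structure IsFoldableFigure {n : ℕ} (F : Set (Euc n)) : Prop where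
  isCompact : IsCompact F
  isConnected : IsConnected F
  nonempty_interior : (interior F).Nonempty
  exists_cut : ∃ S : Finset (Euc n × ℝ),
    (∀ p ∈ S, p.1 ≠ 0) ∧
    (cutPieces S F).Nontrivial ∧
    (∀ P ∈ cutPieces S F, ∀ Q ∈ cutPieces S F, ∃ g : Euc n ≃ᵢ Euc n, g '' P = Q) ∧
    (∀ P ∈ cutPieces S F, ∃ d : Euc n ≃ᵈ Euc n, d '' F = P) ∧
    (∀ P ∈ cutPieces S F, ∀ p ∈ S, IsBoundingHyperplane p.1 p.2 P →
      ∃ Q ∈ cutPieces S F, affReflection p.1 p.2 '' P ⊆ Q)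

/-- The affine Weyl group of a foldable figure `C`: the group generated by the reflections about
the bounding hyperplanes of `C`. -/
def affineWeylGroup {n : ℕ} (C : Set (Euc n)) : Subgroup (Euc n ≃ᵢ Euc n) :=
  Subgroup.closure {g | ∃ r k, IsBoundingHyperplane r k C ∧ g = affReflection r k}

/-! ### Group actions, tilings and congruence -/

/-- The action of the affine Weyl group of `C` on `ℝⁿ`. -/
def weylAct {n : ℕ} (C : Set (Euc n)) (g : affineWeylGroup C) (x : Euc n) : Euc n :=
  (g : Euc n ≃ᵢ Euc n) x

/-- The action of a lattice on `ℝⁿ` by translations. -/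
def translationAct {n : ℕ} (Γ : Submodule ℤ (Euc n)) (γ : Γ) (x : Euc n) : Euc n :=
  x + (γ : Euc n)

/-- The action of `ℤ` on `ℝⁿ` by the powers `Dᵐ(x) = Aᵐ(x - θ) + θ` of the affine dilation
`D(x) = A(x - θ) + θ`. For `θ = 0` these are the dilations `Aᵐ`. -/
def dilationAct {n : ℕ} (A : Matrix (Fin n) (Fin n) ℝ) (θ : Euc n) (m : ℤ) (x : Euc n) : Euc n :=
  Matrix.toEuclideanLin (A ^ m) (x - θ) + θ

/-- `P` is a measurable partition of `Ω`, modulo Lebesgue null sets. -/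
def IsMeasurablePartition {n : ℕ} {ι : Type*} (P : ι → Set (Euc n)) (Ω : Set (Euc n)) : Prop :=
  (∀ i, MeasurableSet (P i)) ∧ Pairwise (fun i j => AEDisjoint volume (P i) (P j)) ∧
    (⋃ i, P i) =ᵐ[volume] Ω

/-- `W` is a measurable tile for the (countable) group of transformations `φ i`: its images under
the group form a measurable partition of `ℝⁿ`. -/
def IsTile {n : ℕ} {ι : Type*} (φ : ι → Euc n → Euc n) (W : Set (Euc n)) : Prop :=
  MeasurableSet W ∧ IsMeasurablePartition (fun i => φ i '' W) Set.univ

/-- `Ω` and `Ψ` are congruent under the (countable) group of transformations `φ i`: they have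
measurable partitions with `φ i` taking the `i`-th piece of `Ω` to that of `Ψ`. Pieces
may be empty, so this covers partitions indexed by a subset of the group. -/
def IsCongruentUnder {n : ℕ} {ι : Type*} (φ : ι → Euc n → Euc n) (Ω Ψ : Set (Euc n)) : Prop :=
  ∃ P Q : ι → Set (Euc n), IsMeasurablePartition P Ω ∧ IsMeasurablePartition Q Ψ ∧
    ∀ i, φ i '' P i = Q i

/-! ### Expansive matrices, wavelets and wavelet sets -/

/-- All (complex) eigenvalues of `A` have absolute value greater than `1`. -/
def IsExpansive {n : ℕ} (A : Matrix (Fin n) (Fin n) ℝ) : Prop :=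
  ∀ z ∈ spectrum ℂ (A.map (algebraMap ℝ ℂ)), 1 < ‖z‖

/-- Full rank lattices in `ℝⁿ`. -/
def IsFullRankLattice {n : ℕ} (Γ : Submodule ℤ (Euc n)) : Prop :=
  DiscreteTopology Γ ∧ Submodule.span ℝ (Γ : Set (Euc n)) = ⊤

/-- The dual lattice `{γ | ∀ σ ∈ Γ, ⟨γ, σ⟩ ∈ ℤ}`. -/
def dualLattice {n : ℕ} (Γ : Submodule ℤ (Euc n)) : Submodule ℤ (Euc n) where
  carrier := {γ | ∀ σ ∈ Γ, ∃ m : ℤ, ⟪γ, σ⟫ = (m : ℝ)}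
  zero_mem' := fun _ _ => ⟨0, by simp⟩
  add_mem' := by
    intro a b ha hb σ hσ
    obtain ⟨i, hi⟩ := ha σ hσ
    obtain ⟨j, hj⟩ := hb σ hσ
    exact ⟨i + j, by rw [inner_add_left, hi, hj]; push_cast; ring⟩
  smul_mem' := by
    intro c a ha σ hσ
    obtain ⟨i, hi⟩ := ha σ hσ
    refine ⟨c * i, ?_⟩
    rw [← Int.cast_smul_eq_zsmul ℝ c a, real_inner_smul_left, hi]
    push_cast
    ring

/-- `ψ ∈ L²(ℝⁿ)` is an orthonormal (single) wavelet for the dilation matrix `A` and the translation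
lattice `Γ`: the functions `t ↦ |det A|^{m/2} ψ(Aᵐ t - γ)`, `m ∈ ℤ`, `γ ∈ Γ`, form an
orthonormal basis of `L²(ℝⁿ)`. -/
def IsOrthonormalWavelet {n : ℕ} (A : Matrix (Fin n) (Fin n) ℝ) (Γ : Submodule ℤ (Euc n))
    (ψ : Lp ℂ 2 (volume : Measure (Euc n))) : Prop :=
  ∃ b : HilbertBasis (ℤ × Γ) ℂ (Lp ℂ 2 (volume : Measure (Euc n))),
    ∀ (m : ℤ) (γ : Γ), (b (m, γ) : Euc n → ℂ) =ᵐ[volume]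
      fun t => ((|A.det| ^ ((m : ℝ) / 2) : ℝ) : ℂ) *
        ψ (Matrix.toEuclideanLin (A ^ m) t - (γ : Euc n))

/-- `W` is a wavelet set for the dilation matrix `A` and the translation lattice `Γ`: the inverse
Fourier transform (with kernel `e^{2πi⟨s,t⟩}`) of `m(W)^{-1/2} χ_W` is an orthonormal wavelet. -/
def IsWaveletSet {n : ℕ} (A : Matrix (Fin n) (Fin n) ℝ) (Γ : Submodule ℤ (Euc n))
    (W : Set (Euc n)) : Prop :=
  ∃ (hW : MeasurableSet W) (hfin : volume W ≠ ⊤),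
    IsOrthonormalWavelet A Γ
      (𝓕⁻ (indicatorConstLp 2 hW hfin (((Real.sqrt (volume.real W))⁻¹ : ℝ) : ℂ)))

/-- `W` is a `(𝒟, Γ)`-dilation-translation wavelet set, where `𝒟 = {Aᵐ}` and `Γ` are the
dilations and translations on the frequency side, on which `W` lives. On the time side
they correspond to the dilation matrix `Aᵀ` and to the dual lattice of `Γ`. -/
def IsDilationTranslationWaveletSet {n : ℕ} (A : Matrix (Fin n) (Fin n) ℝ)
    (Γ : Submodule ℤ (Euc n)) (W : Set (Euc n)) : Prop :=
  IsWaveletSet A.transpose (dualLattice Γ) W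

/-- `W` is a dilation-reflection wavelet set for the affine Weyl group of the foldable figure `C`,
the fixed point `θ` and the matrix `A`. -/
def IsDilationReflectionWaveletSet {n : ℕ} (C : Set (Euc n)) (θ : Euc n)
    (A : Matrix (Fin n) (Fin n) ℝ) (W : Set (Euc n)) : Prop :=
  MeasurableSet W ∧ IsCongruentUnder (weylAct C) W C ∧ IsTile (dilationAct A θ) W

/-- The triple of the affine Weyl group of `C`, the lattice `Γ` and the dilations `{Aᵐ}` is
allowable: some measurable set is congruent to `C` under the affine Weyl group, tiles `ℝⁿ` under
the dilations, and is congruent under `Γ` to a fundamental cell `{∑ tᵢ bᵢ | 0 ≤ tᵢ < 1}` of `Γ`. -/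
def IsAllowableTriple {n : ℕ} (C : Set (Euc n)) (Γ : Submodule ℤ (Euc n))
    (A : Matrix (Fin n) (Fin n) ℝ) : Prop :=
  ∃ W : Set (Euc n), MeasurableSet W ∧
    IsCongruentUnder (weylAct C) W C ∧
    IsTile (dilationAct A 0) W ∧
    ∃ b : Module.Basis (Fin n) ℝ (Euc n), Submodule.span ℤ (Set.range b) = Γ ∧
      IsCongruentUnder (translationAct Γ) W (ZSpan.fundamentalDomain b)

end

open scoped Pointwise

noncomputable section

/-! ### Essential tiles -/

/-! Three facts combine. The affine Weyl group V of C is crystallographic with C as a fundamental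
domain. Such a group and a suitable lattice Γ have, for every expansive A, a bounded common tile W
that is also a tile for the powers of A. A bounded set that tiles under Γ and under the powers of A
is a wavelet set.

Geometry. Repeated cutting gives a tiny similar copy of C inside the interior of C; near it only
half-planes do the cutting, so C is a convex polygon (`IsFoldableFigure.exists_polyhedron`). All its
corner angles are of the form π/m (`IsFolding.exists_corner_angle`). Otherwise let θ be the largest
that is not. If a piece had a corner θ with a side on a cutting line, reflecting it round the corner
in both directions would reach two sides of C enclosing a larger multiple of θ, and this would be
bad as well, or else θ would be good. So the θ-corners of each piece are θ-corners of C, and by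
finiteness each piece has all of them; but two pieces are separated by a line. Angles π/m leave the
rectangle and three triangles (`IsPolygon.classification`). In suitable affine coordinates the
reflections of these polygons are integral, and a finite check shows that the group has a lattice of
translations of finite index and the polygon as fundamental domain (`IsPolygon.exists_isCrystal`).

Common tiles. Let Λ be the lattice of translations in V and q its index. Dividing one basis vector
of Λ by q gives Γ, which contains Λ with the same index q. Both V and Γ lie in the group H generated
by V and (1/q)Λ, where Λ still has finite index. Subgroups of equal finite index have a common
transversal by Hall's theorem (`exists_common_transversal`), and the translates of a tile of H along
it form a common tile of V and Γ. Such tiles can be chosen differently on different shells around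
the orbit of 0, so some common tile E contains copies, scaled by powers of A, of pieces exhausting a
dilation tile F (`IsCrystal.exists_tile_containing`). Conversely a translate of E by a vector of Λ
shrinks into F. The Schröder–Bernstein argument turns these two injections into W
(`exists_tile_of_pieces`). The lattice Γ depends on V only, not on A.

Wavelets. As W is a tile of Γ, the characters given by the dual lattice are orthogonal and total on
W; the dilates of W partition the plane, so the frequency-side wavelets form an orthonormal basis,
which the unitary Fourier transform carries to the time side
(`isDilationTranslationWaveletSet_of_essTile`). -/

/-- Almost every orbit of the action `φ` meets `W` for exactly one group element. -/
def EssTile {X G : Type*} [MeasureSpace X] [Group G] (φ : G →* Equiv.Perm X) (W : Set X) : Prop :=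
  ∀ᵐ x, ∃! g, φ g x ∈ W

/-- The maps of the action are quasi-measure-preserving. -/
def QuasiInvariant {X G : Type*} [MeasureSpace X] [Group G] (φ : G →* Equiv.Perm X) : Prop :=
  ∀ g, Measure.QuasiMeasurePreserving (φ g) (volume : Measure X) volume

lemma image_perm_eq_preimage {X G : Type*} [Group G] (φ : G →* Equiv.Perm X) (g : G)
    (W : Set X) :
    φ g '' W = φ g⁻¹ ⁻¹' W := by
  rw [map_inv, Equiv.image_eq_preimage_symm]; rfl

section EssTile

variable {X G : Type*} [MeasureSpace X] [Group G] {φ : G →* Equiv.Perm X}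

lemma QuasiInvariant.measurableSet_image (hφ : QuasiInvariant φ) (g : G) {W : Set X}
    (hW : MeasurableSet W) : MeasurableSet (φ g '' W) := by
  rw [image_perm_eq_preimage]
  exact (hφ g⁻¹).measurable hW

lemma QuasiInvariant.ae_forall [Countable G] (hφ : QuasiInvariant φ) {p : X → Prop}
    (h : ∀ᵐ x, p x) : ∀ᵐ x, ∀ g, p (φ g x) :=
  ae_all_iff.mpr fun g => (hφ g).ae h

/-- Moving the pieces of an essential tile by group elements gives an essential tile. -/
lemma EssTile.glue {ι : Type*} {E : Set X} (hE : EssTile φ E)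
    {P : ι → Set X} (hP : ∀ x ∈ E, ∃! i, x ∈ P i) (hPE : ∀ i, P i ⊆ E) (g : ι → G) :
    EssTile φ (⋃ i, φ (g i) '' P i) := by
  filter_upwards [hE] with x hx
  obtain ⟨a, ha, hau⟩ := hx
  obtain ⟨i, hi, hiu⟩ := hP _ ha
  refine ⟨g i * a, ?_, ?_⟩
  · refine Set.mem_iUnion.mpr ⟨i, φ a x, hi, ?_⟩
    simp
  · intro b hb
    obtain ⟨j, y, hy, hyb⟩ := Set.mem_iUnion.mp hb
    have h1 : y = φ ((g j)⁻¹ * b) x := by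
      rw [map_mul, Equiv.Perm.mul_apply, ← hyb, map_inv]
      exact ((φ (g j)).symm_apply_apply y).symm
    have h0 : φ ((g j)⁻¹ * b) x ∈ E := h1 ▸ hPE j hy
    have h2' : (g j)⁻¹ * b = a := hau _ h0
    have h3 : j = i := hiu j (by rw [← h2', ← h1]; exact hy)
    subst h3
    rw [← h2']; group

/-- Choosing among essential tiles on the members of an invariant partition. -/
lemma EssTile.piecewise {κ : Type*} {E : κ → Set X} (hE : ∀ k, EssTile φ (E k)) [Countable κ]
    {c : X → κ} (hc : ∀ g x, c (φ g x) = c x) : EssTile φ {x | x ∈ E (c x)} := by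
  filter_upwards [ae_all_iff.mpr hE] with x hx
  simpa [hc] using hx (c x)

/-- An orbit may meet the exceptional null set at any of its points; countably many
quasi-measure-preserving maps pull that set back to a null set. -/
lemma EssTile.congr_ae [Countable G] (hφ : QuasiInvariant φ) {E F : Set X} (hE : EssTile φ E)
    (h : ∀ᵐ x, x ∈ E ↔ x ∈ F) : EssTile φ F := by
  filter_upwards [hE, hφ.ae_forall h] with x hx hx'
  simpa [hx'] using hx

/-- Existence in the orbit condition is covering and uniqueness is disjointness of the images;
countability moves "almost every" past the quantifiers over the group. -/
lemma essTile_iff [Countable G] (hφ : QuasiInvariant φ) {W : Set X} (hW : MeasurableSet W) :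
    EssTile φ W ↔ (∀ g, MeasurableSet (φ g '' W)) ∧
      Pairwise (fun g h => AEDisjoint volume (φ g '' W) (φ h '' W)) ∧
      (⋃ g, φ g '' W) =ᵐ[volume] Set.univ := by
  have key : (∀ᵐ x, ∀ g h, g ≠ h → ¬ (φ g⁻¹ x ∈ W ∧ φ h⁻¹ x ∈ W)) ↔
      Pairwise (fun g h => AEDisjoint volume (φ g '' W) (φ h '' W)) := by
    simp only [ae_all_iff, Pairwise, AEDisjoint, image_perm_eq_preimage]
    refine forall_congr' fun g => forall_congr' fun h => forall_congr' fun _ => ?_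
    rw [ae_iff]
    simp only [not_not]
    rfl
  have key2 : (∀ᵐ x, ∃ g, φ g⁻¹ x ∈ W) ↔ (⋃ g, φ g '' W) =ᵐ[volume] Set.univ := by
    rw [ae_eq_univ, ae_iff]
    simp only [image_perm_eq_preimage, Set.compl_def, Set.mem_iUnion, Set.mem_preimage]
  rw [← key, ← key2]
  constructor
  · intro h
    refine ⟨fun g => hφ.measurableSet_image g hW, ?_, ?_⟩
    · filter_upwards [h] with x hx g g' hne ⟨h1, h2⟩
      exact hne (inv_injective (hx.unique h1 h2))
    · filter_upwards [h] with x hx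
      obtain ⟨g, hg, -⟩ := hx
      exact ⟨g⁻¹, by simpa using hg⟩
  · rintro ⟨-, h1, h2⟩
    filter_upwards [h1, h2] with x h1 ⟨g, hg⟩
    refine ⟨g⁻¹, hg, fun b hb => ?_⟩
    by_contra hne
    exact h1 g b⁻¹ (fun h => hne (by rw [h, inv_inv])) ⟨hg, by simpa using hb⟩

end EssTile

/-- `IsTile` for the maps of a group action, reindexed, is `EssTile`. -/
lemma isTile_iff_essTile {n : ℕ} {ι G : Type*} [Group G] [Countable G]
    {φ : G →* Equiv.Perm (Euc n)} (hφ : QuasiInvariant φ) (e : ι ≃ G) {ψ : ι → Euc n → Euc n}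
    (hψ : ∀ i x, ψ i x = φ (e i) x) {W : Set (Euc n)} :
    IsTile ψ W ↔ MeasurableSet W ∧ EssTile φ W := by
  have hψ' : ∀ i, ψ i = φ (e i) := fun i => funext (hψ i)
  refine and_congr_right fun hW => ?_
  rw [essTile_iff hφ hW, IsMeasurablePartition]
  simp only [hψ']
  refine and_congr ?_ (and_congr ?_ ?_)
  · exact e.forall_congr_left.trans (by simp)
  · constructor
    · intro h a b hab
      simpa using h (i := e.symm a) (j := e.symm b) (by simpa using hab)
    · intro h i j hij
      exact h (by simpa using hij)
  · rw [e.surjective.iUnion_comp fun g => φ g '' W]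

/-- Two tiles for the same group are congruent under that group. -/
lemma isCongruentUnder_of_essTile {n : ℕ} {ι G : Type*} [Group G] [Countable G]
    {φ : G →* Equiv.Perm (Euc n)} (hφ : QuasiInvariant φ) (e : ι ≃ G) {ψ : ι → Euc n → Euc n}
    (hψ : ∀ i x, ψ i x = φ (e i) x) {V W : Set (Euc n)} (hVm : MeasurableSet V)
    (hWm : MeasurableSet W) (hV : EssTile φ V) (hW : EssTile φ W) : IsCongruentUnder ψ V W := by
  have hψ' : ∀ i, ψ i = φ (e i) := fun i => funext (hψ i)
  -- A point of V is put into the piece of the one group element that carries it into W.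
  have part : ∀ {V W : Set (Euc n)}, MeasurableSet V → MeasurableSet W → EssTile φ W →
      ∀ f : ι ≃ G, IsMeasurablePartition (fun i => V ∩ φ (f i) ⁻¹' W) V := by
    intro V W hVm hWm hW f
    refine ⟨fun i => hVm.inter ((hφ _).measurable hWm), fun i j hij => ?_, ?_⟩
    · refine measure_mono_null ?_ (ae_iff.mp hW)
      rintro x ⟨⟨-, h1⟩, ⟨-, h2⟩⟩
      exact fun h => hij (f.injective (h.unique h1 h2))
    · filter_upwards [hW] with x hx
      obtain ⟨g, hg, -⟩ := hx
      refine propext ⟨fun h => ?_, fun h => ?_⟩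
      · obtain ⟨i, hi⟩ := Set.mem_iUnion.mp h
        exact hi.1
      · exact Set.mem_iUnion.mpr ⟨f.symm g, h, by simpa using hg⟩
  -- The partition of W is indexed through inverses, so that each group element maps its piece of V
  -- onto its piece of W.
  refine ⟨_, fun i => W ∩ φ (e i)⁻¹ ⁻¹' V, part hVm hWm hW e,
    part hWm hVm hV (e.trans (Equiv.inv G)), fun i => ?_⟩
  rw [hψ', image_perm_eq_preimage, Set.preimage_inter, ← Set.preimage_comp, Set.inter_comm]
  congr 1
  ext x
  simp

/-! ### Powers of expansive matrices -/

/-- The linear map given by an integral power of a matrix. -/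
def dil {n : ℕ} (A : Matrix (Fin n) (Fin n) ℝ) (m : ℤ) : Euc n →ₗ[ℝ] Euc n :=
  Matrix.toEuclideanLin (A ^ m)

section Dil

variable {n : ℕ} {A : Matrix (Fin n) (Fin n) ℝ}

lemma dil_zero (x : Euc n) : dil A 0 x = x := by simp [dil]

lemma dil_add (hA : IsUnit A.det) (k m : ℤ) (x : Euc n) :
    dil A (k + m) x = dil A k (dil A m x) := by
  simp only [dil, Matrix.zpow_add hA, Matrix.toLpLin_mul_same]
  rfl

lemma dil_neg_dil (hA : IsUnit A.det) (m : ℤ) (x : Euc n) : dil A (-m) (dil A m x) = x := by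
  rw [← dil_add hA, neg_add_cancel, dil_zero]

lemma dil_dil_neg (hA : IsUnit A.det) (m : ℤ) (x : Euc n) : dil A m (dil A (-m) x) = x := by
  rw [← dil_add hA, add_neg_cancel, dil_zero]

lemma det_dil (m : ℤ) : LinearMap.det (dil A m) = (A ^ m).det := by
  simp [dil]

lemma det_dil_ne_zero (hA : IsUnit A.det) (m : ℤ) : LinearMap.det (dil A m) ≠ 0 := by
  rw [det_dil]
  exact (hA.det_zpow m).ne_zero

lemma continuous_dil (m : ℤ) : Continuous (dil A m) := (dil A m).continuous_of_finiteDimensional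

/-- The powers of an invertible matrix, as a group of permutations. -/
def dilHom (hA : IsUnit A.det) : Multiplicative ℤ →* Equiv.Perm (Euc n) where
  toFun m := ⟨dil A m.toAdd, dil A (-m.toAdd), dil_neg_dil hA _, dil_dil_neg hA _⟩
  map_one' := Equiv.ext fun x => dil_zero x
  map_mul' k m := Equiv.ext fun x => dil_add hA k.toAdd m.toAdd x

lemma dilHom_apply (hA : IsUnit A.det) (m : ℤ) (x : Euc n) :
    dilHom hA (Multiplicative.ofAdd m) x = dil A m x := rfl

lemma quasiInvariant_dilHom (hA : IsUnit A.det) : QuasiInvariant (dilHom hA) := by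
  intro g
  refine ⟨(continuous_dil g.toAdd).measurable, ?_⟩
  change Measure.map (dil A g.toAdd) volume ≪ volume
  rw [Measure.map_linearMap_addHaar_eq_smul_addHaar volume (det_dil_ne_zero hA _)]
  exact Measure.AbsolutelyContinuous.rfl.smul_left _

end Dil

section Expansive

variable {n : ℕ} [NeZero n] {A : Matrix (Fin n) (Fin n) ℝ}

omit [NeZero n] in
lemma IsExpansive.isUnit_det (hA : IsExpansive A) : IsUnit A.det := by
  rw [isUnit_iff_ne_zero]
  intro h0
  have h1 : (0 : ℂ) ∈ spectrum ℂ (A.map (algebraMap ℝ ℂ)) := by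
    rw [spectrum.zero_mem_iff, Matrix.isUnit_iff_isUnit_det]
    have := (RingHom.map_det (algebraMap ℝ ℂ) A).symm
    rw [RingHom.mapMatrix_apply] at this
    rw [this, h0]
    simp
  have := hA 0 h1
  norm_num at this

-- Gelfand's formula: the k-th roots of the norms of the powers tend to the spectral radius, so the
-- norms are eventually below r ^ k with r < 1.
attribute [local instance] Matrix.linftyOpNormedRing Matrix.linftyOpNormedAlgebra in
lemma tendsto_pow_of_spectrum_lt_one (B : Matrix (Fin n) (Fin n) ℂ)
    (hB : ∀ z ∈ spectrum ℂ B, ‖z‖ < 1) :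
    ∀ i j, Filter.Tendsto (fun k : ℕ => (B ^ k) i j) Filter.atTop (nhds 0) := by
  have h1 : spectralRadius ℂ B < 1 := by
    have := spectrum.spectralRadius_lt_of_forall_lt B (r := 1) (fun z hz => by
      rw [← NNReal.coe_lt_coe]; simpa using hB z hz)
    simpa using this
  obtain ⟨r, hr1, hr2⟩ := ENNReal.lt_iff_exists_nnreal_btwn.mp h1
  have h2 := spectrum.pow_nnnorm_pow_one_div_tendsto_nhds_spectralRadius B
  have h3 : Filter.Tendsto (fun k : ℕ => B ^ k) Filter.atTop (nhds 0) := by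
    refine tendsto_zero_iff_norm_tendsto_zero.mpr ?_
    refine squeeze_zero' (g := fun k : ℕ => (r : ℝ) ^ k)
      (Filter.Eventually.of_forall fun k => norm_nonneg _) ?_
      (tendsto_pow_atTop_nhds_zero_of_lt_one r.2 (by exact_mod_cast hr2))
    filter_upwards [h2.eventually (gt_mem_nhds hr1), Filter.eventually_gt_atTop 0] with k hk hk0
    have hk' : (0 : ℝ) < k := by exact_mod_cast hk0
    have h4 := ENNReal.rpow_le_rpow hk.le hk'.le
    rw [← ENNReal.rpow_mul, one_div, inv_mul_cancel₀ hk'.ne', ENNReal.rpow_one,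
      ENNReal.rpow_natCast] at h4
    exact_mod_cast h4
  intro i j
  have h4 : Continuous fun M : Matrix (Fin n) (Fin n) ℂ => M i j :=
    (Matrix.entryLinearMap ℂ ℂ i j).continuous_of_finiteDimensional
  exact (h4.tendsto 0).comp h3

/-- The eigenvalues of the inverse matrix are the inverses of those of A, hence lie in the open unit
disc, and the powers of the inverse tend to 0. -/
lemma IsExpansive.exists_norm_dil_neg_le (hA : IsExpansive A) {ε : ℝ} (hε : 0 < ε) :
    ∃ J : ℕ, ∀ j ≥ J, ∀ x, ‖dil A (-(j : ℤ)) x‖ ≤ ε * ‖x‖ := by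
  have hu := hA.isUnit_det
  have huc : IsUnit (A.map (algebraMap ℝ ℂ)) := by
    rw [← spectrum.zero_notMem_iff ℂ]
    intro h
    have := hA 0 h
    norm_num at this
  obtain ⟨U, hU⟩ := huc
  have hB : ∀ z ∈ spectrum ℂ ((↑U⁻¹ : Matrix (Fin n) (Fin n) ℂ)), ‖z‖ < 1 := by
    intro z hz
    have hz0 : z ≠ 0 := by
      rintro rfl
      rw [spectrum.zero_mem_iff] at hz
      exact hz U⁻¹.isUnit
    have h1 := (spectrum.inv_mem_iff (r := Units.mk0 z hz0) (a := U⁻¹)).mp hz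
    rw [inv_inv, hU] at h1
    have h2 := hA _ h1
    simp only [Units.val_inv_eq_inv_val, Units.val_mk0, norm_inv] at h2
    exact (one_lt_inv_iff₀.mp h2).2
  have hinv : (↑U⁻¹ : Matrix (Fin n) (Fin n) ℂ) = (A⁻¹).map (algebraMap ℝ ℂ) := by
    rw [← Units.inv_eq_val_inv, ← one_mul U.inv, Units.inv_eq_val_inv, Units.mul_inv_eq_iff_eq_mul,
      hU, ← Matrix.map_mul, Matrix.nonsing_inv_mul _ hu]
    simp
  have h1 : Filter.Tendsto (fun k : ℕ => (A⁻¹) ^ k) Filter.atTop (nhds 0) := by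
    refine tendsto_pi_nhds.mpr fun i => tendsto_pi_nhds.mpr fun j => ?_
    have h2 := tendsto_pow_of_spectrum_lt_one _ hB i j
    rw [hinv] at h2
    have h3 : ∀ k : ℕ, (((A⁻¹).map (algebraMap ℝ ℂ)) ^ k) i j = (((A⁻¹ ^ k) i j : ℝ) : ℂ) := by
      intro k
      rw [← Matrix.map_pow]
      rfl
    simp only [h3] at h2
    exact_mod_cast (Complex.continuous_re.tendsto _).comp h2
  let T : Matrix (Fin n) (Fin n) ℝ →ₗ[ℝ] (Euc n →L[ℝ] Euc n) :=
    (Matrix.toEuclideanLin.trans LinearMap.toContinuousLinearMap).toLinearMap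
  have h2 : Filter.Tendsto (fun k : ℕ => ‖T ((A⁻¹) ^ k)‖) Filter.atTop (nhds 0) := by
    have h3 : Continuous T := T.continuous_of_finiteDimensional
    have h4 := ((h3.tendsto 0).comp h1).norm
    simpa using h4
  obtain ⟨J, hJ⟩ := Filter.eventually_atTop.mp (h2.eventually (gt_mem_nhds hε))
  refine ⟨J, fun j hj x => ?_⟩
  have h3 : dil A (-(j : ℤ)) x = T ((A⁻¹) ^ j) x := by
    rw [dil, Matrix.zpow_neg_natCast, Matrix.inv_pow']
    rfl
  rw [h3]
  exact (ContinuousLinearMap.le_opNorm _ _).trans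
    (mul_le_mul_of_nonneg_right (hJ j hj).le (norm_nonneg _))

omit [NeZero n] in
lemma exists_norm_dil_le (A : Matrix (Fin n) (Fin n) ℝ) (m : ℤ) :
    ∃ K, 0 < K ∧ ∀ x, ‖dil A m x‖ ≤ K * ‖x‖ := by
  obtain ⟨K, hK, h⟩ := ((dil A m).toContinuousLinearMap).bound
  exact ⟨K, hK, h⟩

/-- A norm-like function that the powers of an expansive matrix scale monotonically. -/
lemma IsExpansive.exists_adapted (hA : IsExpansive A) :
    ∃ (N : Euc n → ℝ) (K ρ : ℝ), Continuous N ∧ (∀ (t : ℝ) x, 0 ≤ t → N (t • x) = t * N x) ∧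
      (∀ x, ‖x‖ ≤ N x) ∧ (∀ x, N x ≤ K * ‖x‖) ∧ 0 < ρ ∧ ρ < 1 ∧
      ∀ x, N (dil A (-1) x) ≤ ρ * N x := by
  have hu := hA.isUnit_det
  obtain ⟨J, hJ⟩ := hA.exists_norm_dil_neg_le (ε := 1 / 2) (by norm_num)
  -- Applying the inverse of A shifts this sum: the first term ‖x‖ is lost and the new last term is
  -- at most half of it.
  let N : Euc n → ℝ := fun x => ∑ j ∈ Finset.range (J + 1), ‖dil A (-(j : ℤ)) x‖
  have hNge : ∀ x, ‖x‖ ≤ N x := fun x => by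
    have := Finset.single_le_sum (f := fun j : ℕ => ‖dil A (-(j : ℤ)) x‖)
      (fun j _ => norm_nonneg _) (Finset.mem_range.mpr (Nat.succ_pos J))
    simpa [dil_zero] using this
  obtain ⟨K, hK1, hK⟩ : ∃ K, 1 ≤ K ∧ ∀ x, N x ≤ K * ‖x‖ := by
    choose k hk0 hk using fun j : ℕ => exists_norm_dil_le A (-(j : ℤ))
    refine ⟨1 + ∑ j ∈ Finset.range (J + 1), k j,
      le_add_of_nonneg_right (Finset.sum_nonneg fun j _ => (hk0 j).le), fun x => ?_⟩
    rw [add_mul, Finset.sum_mul]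
    have : N x ≤ ∑ j ∈ Finset.range (J + 1), k j * ‖x‖ := Finset.sum_le_sum fun j _ => hk j x
    nlinarith [norm_nonneg x]
  -- The loss of at least ‖x‖/2 is at least N x / (2K); K ≥ 1 keeps the factor positive.
  refine ⟨N, K, 1 - 1 / (2 * K), ?_, ?_, hNge, hK, ?_, ?_, ?_⟩
  · exact continuous_finsetSum _ fun j _ => (continuous_dil _).norm
  · intro t x ht
    simp only [N, map_smul, norm_smul, Finset.mul_sum, Real.norm_of_nonneg ht]
  · rw [sub_pos, div_lt_one (by positivity)]
    linarith
  · have : 0 < 1 / (2 * K) := by positivity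
    linarith
  · intro x
    have h1 : N (dil A (-1) x) = N x - ‖x‖ + ‖dil A (-((J + 1 : ℕ) : ℤ)) x‖ := by
      have h2 : ∀ j : ℕ, dil A (-(j : ℤ)) (dil A (-1) x) = dil A (-((j + 1 : ℕ) : ℤ)) x := by
        intro j
        rw [← dil_add hu]
        congr 2
        push_cast
        ring
      have h3 := Finset.sum_range_succ' (fun j : ℕ => ‖dil A (-(j : ℤ)) x‖) (J + 1)
      rw [Finset.sum_range_succ] at h3
      simp only [N, h2]
      simp only [Nat.cast_zero, neg_zero, dil_zero] at h3
      linarith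
    have h2 := hJ (J + 1) (Nat.le_succ J) x
    have h3 : 1 / (2 * K) * N x ≤ 1 / 2 * ‖x‖ := by
      have := mul_le_mul_of_nonneg_left (hK x) (show (0 : ℝ) ≤ 1 / (2 * K) by positivity)
      refine this.trans (le_of_eq ?_)
      field_simp
    rw [h1, sub_mul, one_mul]
    linarith

/-- A bounded measurable tile for the powers of an expansive matrix, bounded away from `0` and
with interior points. -/
lemma IsExpansive.exists_tile (hA : IsExpansive A) :
    ∃ F : Set (Euc n), MeasurableSet F ∧ (∀ x ≠ 0, ∃! m : ℤ, dil A m x ∈ F) ∧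
      (∃ c > 0, ∀ x ∈ F, c ≤ ‖x‖) ∧ (∀ x ∈ F, ‖x‖ ≤ 1) ∧ (interior F).Nonempty := by
  have hu := hA.isUnit_det
  obtain ⟨N, K, ρ, hNc, hNs, hNge, hNle, hρ0, hρ1, hN⟩ := hA.exists_adapted
  have hNup : ∀ x, N x ≤ ρ * N (dil A 1 x) := fun x => by
    have := hN (dil A 1 x)
    rwa [dil_neg_dil hu] at this
  have hN0 : ∀ x, 0 ≤ N x := fun x => (norm_nonneg x).trans (hNge x)
  have hmono1 : ∀ x, N x ≤ N (dil A 1 x) := fun x =>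
    (hNup x).trans (mul_le_of_le_one_left (hN0 _) hρ1.le)
  have hpow : ∀ (k : ℕ) x, N (dil A (-(k : ℤ)) x) ≤ ρ ^ k * N x := by
    intro k
    induction k with
    | zero => intro x; simp [dil_zero]
    | succ k ih =>
      intro x
      have : (-((k + 1 : ℕ) : ℤ)) = -1 + -(k : ℤ) := by push_cast; ring
      rw [this, dil_add hu]
      refine (hN _).trans ?_
      rw [pow_succ']
      nlinarith [ih x]
  have hmono : ∀ x, Monotone fun m : ℤ => N (dil A m x) := fun x =>
    monotone_int_of_le_succ fun m => by
      rw [add_comm, dil_add hu]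
      exact hmono1 _
  -- N is monotone along each nonzero orbit, with limits 0 and ∞, so exactly one power lands at the
  -- last place below 1.
  refine ⟨{x | N x < 1 ∧ 1 ≤ N (dil A 1 x)}, ?_, ?_, ?_, ?_, ?_⟩
  · exact (measurableSet_lt hNc.measurable measurable_const).inter
      (measurableSet_le measurable_const (hNc.comp (continuous_dil 1)).measurable)
  · intro x hx
    have hNx : 0 < N x := (norm_pos_iff.mpr hx).trans_le (hNge x)
    have hlim : ∀ c > 0, ∃ k : ℕ, ρ ^ k < c := fun c hc => exists_pow_lt_of_lt_one hc hρ1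
    have hne : ∃ m : ℤ, N (dil A m x) < 1 := by
      obtain ⟨k, hk⟩ := hlim (1 / N x) (by positivity)
      refine ⟨-(k : ℤ), (hpow k x).trans_lt ?_⟩
      rwa [lt_div_iff₀ hNx] at hk
    obtain ⟨b, hb⟩ : ∃ b : ℤ, 1 ≤ N (dil A b x) := by
      obtain ⟨k, hk⟩ := hlim (N x) hNx
      refine ⟨k, ?_⟩
      have h1 := hpow k (dil A k x)
      rw [dil_neg_dil hu] at h1
      by_contra! h2
      nlinarith [pow_pos hρ0 k]
    obtain ⟨m, hm1, hm2⟩ := Int.exists_greatest_of_bdd (P := fun m : ℤ => N (dil A m x) < 1)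
      ⟨b, fun z hz => by
        by_contra! h
        exact absurd (hb.trans (hmono x h.le)) (not_le.mpr hz)⟩ hne
    refine ⟨m, ⟨hm1, ?_⟩, ?_⟩
    · rw [← dil_add hu]
      by_contra! h
      have := hm2 _ h
      omega
    · rintro m' ⟨h1, h2⟩
      have h3 := hm2 _ h1
      rcases h3.lt_or_eq with h4 | h4
      · rw [← dil_add hu] at h2
        have := h2.trans (hmono x (show (1 : ℤ) + m' ≤ m by omega))
        exact absurd this (not_le.mpr hm1)
      · exact h4
  · obtain ⟨k, hk0, hk⟩ := exists_norm_dil_le A 1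
    refine ⟨1 / (|K| * k + 1), by positivity, ?_⟩
    rintro x ⟨-, hx⟩
    rw [div_le_iff₀ (by positivity)]
    have h1 : N (dil A 1 x) ≤ |K| * (k * ‖x‖) := (hNle _).trans
      ((mul_le_mul_of_nonneg_right (le_abs_self K) (norm_nonneg _)).trans
        (mul_le_mul_of_nonneg_left (hk x) (abs_nonneg K)))
    nlinarith [norm_nonneg x]
  · rintro x ⟨hx, -⟩
    exact (hNge x).trans hx.le
  -- Since N x ≤ ρ N (A x), a value above ρ jumps past 1 at the next step; the midpoint of ρ and 1
  -- serves as the value at an interior point.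
  · have hsub : {x | ρ < N x ∧ N x < 1} ⊆ {x | N x < 1 ∧ 1 ≤ N (dil A 1 x)} := by
      rintro x ⟨h1, h2⟩
      refine ⟨h2, ?_⟩
      by_contra! h3
      nlinarith [hNup x]
    have hopen : IsOpen {x | ρ < N x ∧ N x < 1} :=
      (isOpen_lt continuous_const hNc).inter (isOpen_lt hNc continuous_const)
    obtain ⟨x0, hx0⟩ := exists_ne (0 : Euc n)
    have hNx : 0 < N x0 := (norm_pos_iff.mpr hx0).trans_le (hNge x0)
    refine ⟨((ρ + 1) / 2 / N x0) • x0, interior_maximal hsub hopen ⟨?_, ?_⟩⟩ <;>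
    · rw [hNs _ _ (by positivity), div_mul_cancel₀ _ hNx.ne']
      linarith

end Expansive

/-! ### Isometries of Euclidean space -/

section Isometries

variable {n : ℕ}

/-- The linear part of an isometry. -/
def linPart (g : Euc n ≃ᵢ Euc n) : Euc n ≃ₗᵢ[ℝ] Euc n := g.toRealLinearIsometryEquiv

lemma linPart_apply (g : Euc n ≃ᵢ Euc n) (x : Euc n) : linPart g x = g x - g 0 :=
  g.toRealLinearIsometryEquiv_apply x

lemma isometryEquiv_apply_add (g : Euc n ≃ᵢ Euc n) (x v : Euc n) :
    g (x + v) = g x + linPart g v := by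
  have h := (linPart g).map_add x v
  rw [linPart_apply, linPart_apply g x] at h
  have : g (x + v) = (g x - g 0 + linPart g v) + g 0 := by rw [← h]; abel
  rw [this]; abel

lemma measurePreserving_isometryEquiv (g : Euc n ≃ᵢ Euc n) :
    MeasurePreserving g (volume : Measure (Euc n)) volume := by
  have h : (g : Euc n → Euc n) = (fun x => x + g 0) ∘ linPart g := by
    funext x
    simp [linPart_apply]
  rw [h]
  exact (measurePreserving_add_right volume (g 0)).comp (linPart g).measurePreserving

/-- The action of a group of isometries. -/
def isoHom (H : Subgroup (Euc n ≃ᵢ Euc n)) : H →* Equiv.Perm (Euc n) where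
  toFun g := (g : Euc n ≃ᵢ Euc n).toEquiv
  map_one' := rfl
  map_mul' _ _ := rfl

@[simp]
lemma isoHom_apply (H : Subgroup (Euc n ≃ᵢ Euc n)) (g : H) (x : Euc n) :
    isoHom H g x = (g : Euc n ≃ᵢ Euc n) x := rfl

lemma quasiInvariant_isoHom (H : Subgroup (Euc n ≃ᵢ Euc n)) : QuasiInvariant (isoHom H) :=
  fun g => (measurePreserving_isometryEquiv (g : Euc n ≃ᵢ Euc n)).quasiMeasurePreserving

/-- Translations as isometries. -/
def transl (v : Euc n) : Euc n ≃ᵢ Euc n := IsometryEquiv.addRight v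

@[simp]
lemma transl_apply (v x : Euc n) : transl v x = x + v := rfl

lemma transl_injective : Function.Injective (transl : Euc n → _) := fun v w h => by
  simpa using congrArg (fun g : Euc n ≃ᵢ Euc n => g 0) h

lemma transl_mul (v w : Euc n) : transl v * transl w = transl (v + w) :=
  IsometryEquiv.ext fun x => by
    change x + w + v = x + (v + w)
    abel

lemma transl_zero : transl (0 : Euc n) = 1 := IsometryEquiv.ext fun x => add_zero x

lemma transl_inv (v : Euc n) : (transl v)⁻¹ = transl (-v) := by
  rw [inv_eq_iff_mul_eq_one, transl_mul, add_neg_cancel, transl_zero]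

lemma mul_transl (g : Euc n ≃ᵢ Euc n) (v : Euc n) :
    g * transl v = transl (linPart g v) * g :=
  IsometryEquiv.ext fun x => isometryEquiv_apply_add g x v

/-- The group of translations by the vectors of a lattice. -/
def transSub (Λ : Submodule ℤ (Euc n)) : Subgroup (Euc n ≃ᵢ Euc n) where
  carrier := {g | ∃ v ∈ Λ, g = transl v}
  one_mem' := ⟨0, Λ.zero_mem, transl_zero.symm⟩
  mul_mem' := by
    rintro _ _ ⟨v, hv, rfl⟩ ⟨w, hw, rfl⟩
    exact ⟨v + w, Λ.add_mem hv hw, transl_mul v w⟩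
  inv_mem' := by
    rintro _ ⟨v, hv, rfl⟩
    exact ⟨-v, Λ.neg_mem hv, transl_inv v⟩

lemma mem_transSub {Λ : Submodule ℤ (Euc n)} {g : Euc n ≃ᵢ Euc n} :
    g ∈ transSub Λ ↔ ∃ v ∈ Λ, g = transl v := Iff.rfl

lemma transl_mem_transSub {Λ : Submodule ℤ (Euc n)} {v : Euc n} :
    transl v ∈ transSub Λ ↔ v ∈ Λ :=
  ⟨fun ⟨_, hw, h⟩ => transl_injective h ▸ hw, fun h => ⟨v, h, rfl⟩⟩

/-- The lattice vectors correspond to the translations. -/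
def transEquiv (Λ : Submodule ℤ (Euc n)) : Λ ≃ transSub Λ :=
  Equiv.ofBijective (fun v => ⟨transl v, transl_mem_transSub.mpr v.2⟩)
    ⟨fun _ _ h => Subtype.ext (transl_injective (congrArg Subtype.val h)),
      fun ⟨_, v, hv, h⟩ => ⟨⟨v, hv⟩, Subtype.ext h.symm⟩⟩

lemma translationAct_eq (Λ : Submodule ℤ (Euc n)) (v : Λ) (x : Euc n) :
    translationAct Λ v x = isoHom (transSub Λ) (transEquiv Λ v) x := rfl

lemma transSub_mono {Λ Λ' : Submodule ℤ (Euc n)} (h : Λ ≤ Λ') : transSub Λ ≤ transSub Λ' := by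
  rintro _ ⟨v, hv, rfl⟩
  exact ⟨v, h hv, rfl⟩

/-- The hyperplane lies in the bisector of c - r and c + r, where c is its point on the line ℝr;
this is a proper affine subspace. -/
lemma volume_setOf_inner_eq {r : Euc n} (hr : r ≠ 0) (k : ℝ) :
    volume {x : Euc n | ⟪x, r⟫ = k} = 0 := by
  set c : Euc n := (k / ⟪r, r⟫) • r with hc
  have hrr : ⟪r, r⟫ ≠ 0 := inner_self_ne_zero.mpr hr
  have h : {x : Euc n | ⟪x, r⟫ = k} ⊆ AffineSubspace.perpBisector (c - r) (c + r) := by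
    intro x hx
    have hx' : ⟪x, r⟫ = k := hx
    have hcr : ⟪c, r⟫ = k := by
      rw [hc, real_inner_smul_left]
      field_simp
    have h0 : ⟪r, x - c⟫ = 0 := by
      rw [real_inner_comm, inner_sub_left, hx', hcr, sub_self]
    rw [SetLike.mem_coe, AffineSubspace.mem_perpBisector_iff_dist_eq, dist_eq_norm, dist_eq_norm,
      ← sub_sub, norm_sub_eq_norm_add h0]
    congr 1
    abel
  refine measure_mono_null h (Measure.addHaar_affineSubspace _ _ ?_)
  rw [Ne, AffineSubspace.perpBisector_eq_top]
  intro h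
  have h2 : (2 : ℝ) • r = 0 := by
    rw [two_smul]
    calc r + r = (c + r) - (c - r) := by abel
      _ = 0 := by rw [← h, sub_self]
  exact hr ((smul_eq_zero.mp h2).resolve_left two_ne_zero)

lemma volume_setOf_dist_eq {p q : Euc n} (hpq : p ≠ q) :
    volume {x : Euc n | dist x p = dist x q} = 0 := by
  have h : {x : Euc n | dist x p = dist x q} = AffineSubspace.perpBisector p q := by
    ext x
    exact AffineSubspace.mem_perpBisector_iff_dist_eq.symm
  rw [h]
  exact Measure.addHaar_affineSubspace _ _ (by rwa [Ne, AffineSubspace.perpBisector_eq_top])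

end Isometries

/-! ### Groups of isometries containing a lattice of translations with finite index -/

section Crystal

variable {n : ℕ}

/-- The group `H` contains the translations by `Λ` as a subgroup of finite index. -/
structure IsCrystal (Λ : Submodule ℤ (Euc n)) (H : Subgroup (Euc n ≃ᵢ Euc n)) : Prop where
  le : transSub Λ ≤ H
  relIndex_ne_zero : (transSub Λ).relIndex H ≠ 0

variable {b : Module.Basis (Fin n) ℝ (Euc n)} {H : Subgroup (Euc n ≃ᵢ Euc n)}

lemma finite_span_inter_closedBall (b : Module.Basis (Fin n) ℝ (Euc n)) (R : ℝ) :
    {v : Euc n | v ∈ Submodule.span ℤ (Set.range b) ∧ ‖v‖ ≤ R}.Finite := by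
  refine (ZSpan.setFinite_inter b (s := Metric.closedBall 0 R) Metric.isBounded_closedBall).subset ?_
  rintro v ⟨h1, h2⟩
  exact ⟨by simpa using h2, h1⟩

/-- Only finitely many elements move some point of a ball into that ball. -/
lemma IsCrystal.finite_near (hH : IsCrystal (Submodule.span ℤ (Set.range b)) H) (R : ℝ) :
    {h | h ∈ H ∧ ∃ x : Euc n, ‖x‖ ≤ R ∧ ‖h x‖ ≤ R}.Finite := by
  set T := transSub (Submodule.span ℤ (Set.range b)) with hT
  have hfin : Finite (H ⧸ T.subgroupOf H) :=
    Nat.finite_of_card_ne_zero hH.relIndex_ne_zero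
  let r : H ⧸ T.subgroupOf H → Euc n ≃ᵢ Euc n := fun q => (Quotient.out q : H)
  refine (Set.finite_iUnion fun q => ((finite_span_inter_closedBall b (2 * R + ‖r q 0‖)).image
    fun v => r q * transl v)).subset ?_
  rintro h ⟨hh, x, hx, hhx⟩
  -- The element h differs from the chosen representative of its coset by a translation v. Moving a
  -- point of the ball into the ball bounds ‖v‖, so v ranges over a finite set.
  let q : H ⧸ T.subgroupOf H := QuotientGroup.mk ⟨h, hh⟩
  have h1 : (r q)⁻¹ * h ∈ T := by
    have : QuotientGroup.mk (Quotient.out q) = (QuotientGroup.mk ⟨h, hh⟩ : H ⧸ T.subgroupOf H) :=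
      Quotient.out_eq q
    rw [QuotientGroup.eq] at this
    exact this
  obtain ⟨v, hv, hv2⟩ := h1
  have h2 : h = r q * transl v := by rw [← hv2]; group
  refine Set.mem_iUnion.mpr ⟨q, v, ⟨hv, ?_⟩, h2.symm⟩
  have h3 : h x = linPart (r q) (x + v) + r q 0 := by
    rw [h2, linPart_apply]
    simp
  have h4 : ‖x + v‖ ≤ ‖h x‖ + ‖r q 0‖ := by
    rw [← (linPart (r q)).norm_map (x + v)]
    have : linPart (r q) (x + v) = h x - r q 0 := by rw [h3]; abel
    rw [this]
    exact norm_sub_le _ _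
  have h5 : ‖v‖ ≤ ‖x + v‖ + ‖x‖ := by
    have : v = (x + v) - x := by abel
    rw [this]
    simpa using norm_sub_le (x + v) x
  linarith

lemma IsCrystal.countable (hH : IsCrystal (Submodule.span ℤ (Set.range b)) H) : Countable H := by
  have : (H : Set (Euc n ≃ᵢ Euc n)).Countable := by
    refine (Set.countable_iUnion fun k : ℕ => (hH.finite_near (k : ℝ)).countable).mono ?_
    intro h hh
    obtain ⟨k, hk⟩ := exists_nat_ge ‖h 0‖
    exact Set.mem_iUnion.mpr ⟨k, hh, 0, by simp, hk⟩
  exact this.to_subtype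

/-- Only finitely many group elements put p within distance dist x p of x, so a minimum is attained.
-/
lemma IsCrystal.exists_nearest (hH : IsCrystal (Submodule.span ℤ (Set.range b)) H) (p x : Euc n) :
    ∃ g ∈ H, ∀ h ∈ H, dist x (g p) ≤ dist x (h p) := by
  have hfin : {h | h ∈ H ∧ dist x (h p) ≤ dist x p}.Finite := by
    refine (hH.finite_near (‖x‖ + ‖p‖ + dist x p)).subset ?_
    rintro h ⟨hh, hd⟩
    refine ⟨hh, p, by linarith [norm_nonneg x, dist_nonneg (x := x) (y := p)], ?_⟩
    have h1 : ‖h p‖ ≤ ‖x‖ + dist x (h p) := by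
      rw [dist_comm, dist_eq_norm]
      calc ‖h p‖ = ‖x + (h p - x)‖ := by congr 1; abel
        _ ≤ _ := norm_add_le _ _
    linarith [norm_nonneg p]
  obtain ⟨g, ⟨hg, hgd⟩, hmin⟩ := Set.exists_min_image _ (fun h => dist x (h p)) hfin
    ⟨1, H.one_mem, le_rfl⟩
  refine ⟨g, hg, fun h hh => ?_⟩
  by_cases hd : dist x (h p) ≤ dist x p
  · exact hmin h ⟨hh, hd⟩
  · exact hgd.trans (not_le.mp hd).le

/-- An isometry that moves q fixes only points equidistant from q and its image, a null set; the
group is countable, so almost every point has trivial stabilizer. -/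
lemma IsCrystal.exists_free_point (hH : IsCrystal (Submodule.span ℤ (Set.range b)) H) :
    ∃ p : Euc n, ∀ g ∈ H, ∀ h ∈ H, g p = h p → g = h := by
  have := hH.countable
  have h1 : ∀ᵐ p : Euc n, ∀ h : H, (h : Euc n ≃ᵢ Euc n) ≠ 1 → (h : Euc n ≃ᵢ Euc n) p ≠ p := by
    rw [ae_all_iff]
    intro h
    by_cases h1 : (h : Euc n ≃ᵢ Euc n) = 1
    · simp [h1]
    obtain ⟨q, hq⟩ : ∃ q, (h : Euc n ≃ᵢ Euc n) q ≠ q := by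
      by_contra! hcon
      exact h1 (IsometryEquiv.ext hcon)
    have hnull := volume_setOf_dist_eq hq
    filter_upwards [measure_eq_zero_iff_ae_notMem.mp hnull] with x hx _ hfix
    refine hx ?_
    nth_rewrite 1 [← hfix]
    exact (h : Euc n ≃ᵢ Euc n).isometry.dist_eq x q
  obtain ⟨p, hp⟩ := h1.exists
  refine ⟨p, fun g hg h hh hgh => ?_⟩
  by_contra hne
  refine hp ⟨h⁻¹ * g, H.mul_mem (H.inv_mem hh) hg⟩ (fun h1 => hne ?_) ?_
  · exact (inv_mul_eq_one.mp h1).symm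
  · change h.symm (g p) = p
    rw [hgh, IsometryEquiv.symm_apply_apply]

lemma exists_span_near (b : Module.Basis (Fin n) ℝ (Euc n)) :
    ∃ D, ∀ x : Euc n, ∃ v ∈ Submodule.span ℤ (Set.range b), ‖x + v‖ ≤ D := by
  refine ⟨∑ i, ‖b i‖, fun x => ⟨-(ZSpan.floor b x : Euc n),
    Submodule.neg_mem _ (ZSpan.floor b x).2, ?_⟩⟩
  rw [← sub_eq_add_neg]
  exact ZSpan.norm_fract_le b x

/-- A crystallographic group has a bounded measurable tile. -/
lemma IsCrystal.exists_tile (hH : IsCrystal (Submodule.span ℤ (Set.range b)) H) :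
    ∃ P : Set (Euc n), MeasurableSet P ∧ Bornology.IsBounded P ∧ EssTile (isoHom H) P := by
  have := hH.countable
  obtain ⟨p, hp⟩ := hH.exists_free_point
  -- The tile is the Dirichlet cell of the free point p; g carries x into it exactly when the image
  -- of p under the inverse of g is an orbit point nearest to x.
  have hmem : ∀ (g : H) x, isoHom H g x ∈ {x | ∀ h : H, dist x p ≤ dist x ((h : Euc n ≃ᵢ Euc n) p)}
      ↔ ∀ h ∈ H, dist x ((g : Euc n ≃ᵢ Euc n).symm p) ≤ dist x (h p) := by
    intro g x
    have h1 : ∀ y, dist (isoHom H g x) y = dist x ((g : Euc n ≃ᵢ Euc n).symm y) := by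
      intro y
      conv_lhs => rw [← (g : Euc n ≃ᵢ Euc n).apply_symm_apply y]
      exact (g : Euc n ≃ᵢ Euc n).isometry.dist_eq _ _
    simp only [Set.mem_ofPred_eq, h1]
    constructor
    · intro h2 h hh
      have := h2 (g * ⟨h, hh⟩)
      simpa using this
    · intro h2 h
      exact h2 ((g : Euc n ≃ᵢ Euc n)⁻¹ * h) (H.mul_mem (H.inv_mem g.2) h.2)
  refine ⟨{x | ∀ h : H, dist x p ≤ dist x ((h : Euc n ≃ᵢ Euc n) p)}, ?_, ?_, ?_⟩
  · simp only [Set.ofPred_forall]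
    exact MeasurableSet.iInter fun h =>
      (isClosed_le (continuous_id.dist continuous_const)
        (continuous_id.dist continuous_const)).measurableSet
  · obtain ⟨D, hD⟩ := exists_span_near b
    refine (Metric.isBounded_closedBall (x := p) (r := D)).subset fun x hx => ?_
    obtain ⟨v, hv, hvD⟩ := hD (p - x)
    refine (hx ⟨transl v, hH.le (transl_mem_transSub.mpr hv)⟩).trans ?_
    rw [dist_comm, dist_eq_norm]
    refine le_trans (le_of_eq ?_) hvD
    congr 1
    simp only [transl_apply]
    abel
  -- Off countably many bisectors the nearest orbit point is unique, and p being free, so is the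
  -- group element.
  · have h1 : ∀ᵐ x : Euc n, ∀ g h : H, g ≠ h →
        dist x ((g : Euc n ≃ᵢ Euc n) p) ≠ dist x ((h : Euc n ≃ᵢ Euc n) p) := by
      simp only [ae_all_iff]
      intro g h hgh
      exact measure_eq_zero_iff_ae_notMem.mp (volume_setOf_dist_eq
        fun h1 => hgh (Subtype.ext (hp _ g.2 _ h.2 h1)))
    filter_upwards [h1] with x hx
    obtain ⟨g, hg, hmin⟩ := hH.exists_nearest p x
    refine ⟨⟨g, hg⟩⁻¹, (hmem _ _).mpr ?_, ?_⟩
    · exact hmin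
    · intro k hk
      have hk' := (hmem _ _).mp hk
      by_contra hne
      refine hx k⁻¹ ⟨g, hg⟩ (fun h => hne (by rw [← h, inv_inv])) (le_antisymm ?_ ?_)
      · exact hk' g hg
      · exact hmin _ (H.inv_mem k.2)

end Crystal

/-! ### Common transversals -/

/-- Two subgroups of the same finite index have a common transversal for the right cosets. -/
lemma exists_common_transversal {G : Type*} [Group G] {N A B : Subgroup G} (hNA : N ≤ A)
    (hNB : N ≤ B) (hN : N.index ≠ 0) (hAB : N.relIndex A = N.relIndex B) :
    ∃ E : Set G, E.Finite ∧ (∀ g, ∃! e, e ∈ E ∧ g * e⁻¹ ∈ A) ∧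
      (∀ g, ∃! e, e ∈ E ∧ g * e⁻¹ ∈ B) := by
  classical
  have hfN : Finite (G ⧸ N) := Nat.finite_of_card_ne_zero hN
  have hiA := Subgroup.relIndex_mul_index hNA
  have hiB := Subgroup.relIndex_mul_index hNB
  have hrel : N.relIndex A ≠ 0 := fun h => hN (by rw [← hiA, h, zero_mul])
  have hidx : A.index = B.index := by
    rw [← hAB, ← hiA] at hiB
    exact (Nat.eq_of_mul_eq_mul_left (Nat.pos_of_ne_zero hrel) hiB).symm
  have hfA : Finite (G ⧸ A) := Nat.finite_of_card_ne_zero fun h => hN (by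
    rw [← hiA, Subgroup.index, h, mul_zero])
  have hfB : Finite (G ⧸ B) := Nat.finite_of_card_ne_zero fun h => hN (by
    rw [← hiB, Subgroup.index, h, mul_zero])
  have := Fintype.ofFinite (G ⧸ N)
  have := Fintype.ofFinite (G ⧸ A)
  have := Fintype.ofFinite (G ⧸ B)
  -- the fibres of the projections all have the same number of elements
  have fib : ∀ {A : Subgroup G} (hNA : N ≤ A) [Fintype (G ⧸ A)] (a : G ⧸ A),
      (Finset.univ.filter fun x : G ⧸ N => Subgroup.quotientMapOfLE hNA x = a).card
        = N.relIndex A := by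
    intro A hNA _ a
    obtain ⟨f, hf⟩ := (QuotientGroup.mk_surjective a : ∃ f, QuotientGroup.mk f = a)
    let p : A ⧸ N.subgroupOf A → G ⧸ N := Quotient.map' (Subtype.val : A → G) fun x y h => by
      rw [QuotientGroup.leftRel_apply] at h ⊢
      exact h
    let φ : A ⧸ N.subgroupOf A → G ⧸ N := fun x => f • p x
    have hφ : Function.Injective φ := by
      intro x y
      induction x using QuotientGroup.induction_on with | H x => ?_
      induction y using QuotientGroup.induction_on with | H y => ?_
      intro h
      have h1 := smul_left_cancel f h
      have h2 : (QuotientGroup.mk (x : G) : G ⧸ N) = QuotientGroup.mk (y : G) := h1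
      rw [QuotientGroup.eq] at h2
      exact QuotientGroup.eq.mpr h2
    have hrange : (Finset.univ.filter fun x : G ⧸ N => Subgroup.quotientMapOfLE hNA x = a)
        = (Set.range φ).toFinset := by
      ext x
      induction x using QuotientGroup.induction_on with | H x => ?_
      simp only [Finset.mem_filter, Finset.mem_univ, true_and, Set.mem_toFinset, Set.mem_range,
        ← hf]
      constructor
      · intro h
        have h2 : f⁻¹ * x ∈ A := by
          have : (QuotientGroup.mk x : G ⧸ A) = QuotientGroup.mk f := h
          exact QuotientGroup.eq.mp this.symm
        refine ⟨QuotientGroup.mk ⟨f⁻¹ * x, h2⟩, ?_⟩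
        change (QuotientGroup.mk (f * (f⁻¹ * x)) : G ⧸ N) = _
        rw [mul_inv_cancel_left]
      · rintro ⟨y, hy⟩
        induction y using QuotientGroup.induction_on with | H y => ?_
        have h2 : (QuotientGroup.mk (f * (y : G)) : G ⧸ N) = QuotientGroup.mk x := hy
        have h3 := QuotientGroup.eq.mp h2
        change (QuotientGroup.mk x : G ⧸ A) = QuotientGroup.mk f
        refine (QuotientGroup.eq.mpr ?_).symm
        have h4 := A.mul_mem y.2 (hNA h3)
        simpa [mul_assoc] using h4
    rw [hrange, Set.toFinset_card, ← Nat.card_eq_fintype_card,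
      Nat.card_range_of_injective hφ]
    rfl
  -- A bipartite graph: a coset of A is joined to the cosets of B with which it shares a coset of N.
  -- Hall's theorem gives a matching.
  let r : G ⧸ A → Finset (G ⧸ B) := fun a =>
    (Finset.univ.filter fun x : G ⧸ N => Subgroup.quotientMapOfLE hNA x = a).image
      (Subgroup.quotientMapOfLE hNB)
  -- Hall's condition by counting cosets of N: those over s number |s| times the common index, and
  -- all of them lie over the neighbours of s, each of which carries that index many.
  obtain ⟨f, hfinj, hfr⟩ := (Finset.all_card_le_biUnion_card_iff_exists_injective r).mp (by
    intro s
    let X := Finset.univ.filter fun x : G ⧸ N => Subgroup.quotientMapOfLE hNA x ∈ s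
    have h1 : X.card = s.card * N.relIndex A := by
      have h0 := Finset.card_eq_sum_card_fiberwise (s := X) (f := Subgroup.quotientMapOfLE hNA)
        (t := s) (fun x hx => (Finset.mem_filter.mp hx).2)
      rw [h0, Finset.sum_congr rfl (fun a ha => ?_), Finset.sum_const, smul_eq_mul]
      rw [← fib hNA a]
      congr 1
      ext x
      simp only [X, Finset.mem_filter, Finset.mem_univ, true_and]
      exact ⟨fun h => h.2, fun h => ⟨h ▸ ha, h⟩⟩
    have h2 : X.card ≤ (s.biUnion r).card * N.relIndex B := by
      have h0 := Finset.card_eq_sum_card_fiberwise (s := X) (f := Subgroup.quotientMapOfLE hNB)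
        (t := s.biUnion r) (fun x hx => Finset.mem_biUnion.mpr ⟨_, (Finset.mem_filter.mp hx).2,
          Finset.mem_image.mpr ⟨x, by simp, rfl⟩⟩)
      rw [h0, ← smul_eq_mul]
      refine Finset.sum_le_card_nsmul _ _ _ fun c _ => ?_
      rw [← fib hNB c]
      exact Finset.card_le_card (Finset.filter_subset_filter _ (Finset.subset_univ _))
    rw [h1, hAB] at h2
    exact Nat.le_of_mul_le_mul_right h2 (Nat.pos_of_ne_zero (hAB ▸ hrel)))
  have hfbij : Function.Bijective f := by
    rw [Fintype.bijective_iff_injective_and_card]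
    refine ⟨hfinj, ?_⟩
    rw [← Nat.card_eq_fintype_card, ← Nat.card_eq_fintype_card]
    exact hidx
  have hex : ∀ a, ∃ e : G, (QuotientGroup.mk e : G ⧸ A) = a ∧ (QuotientGroup.mk e : G ⧸ B) = f a := by
    intro a
    obtain ⟨x, hx, hx2⟩ := Finset.mem_image.mp (hfr a)
    induction x using QuotientGroup.induction_on with | H x => ?_
    exact ⟨x, (Finset.mem_filter.mp hx).2, hx2⟩
  choose e he1 he2 using hex
  -- Inversion turns representatives of left cosets into representatives of right cosets.
  refine ⟨Set.range fun a => (e a)⁻¹, Set.finite_range _, fun g => ?_, fun g => ?_⟩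
  · refine ⟨(e (QuotientGroup.mk g⁻¹))⁻¹, ⟨⟨_, rfl⟩, ?_⟩, ?_⟩
    · have := QuotientGroup.eq.mp (he1 (QuotientGroup.mk g⁻¹)).symm
      simpa using this
    · rintro _ ⟨⟨a, rfl⟩, ha⟩
      have : (QuotientGroup.mk g⁻¹ : G ⧸ A) = QuotientGroup.mk (e a) :=
        QuotientGroup.eq.mpr (by simpa using ha)
      simp only [this, he1]
  · obtain ⟨a0, ha0⟩ := hfbij.2 (QuotientGroup.mk g⁻¹)
    refine ⟨(e a0)⁻¹, ⟨⟨_, rfl⟩, ?_⟩, ?_⟩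
    · have := QuotientGroup.eq.mp ((he2 a0).trans ha0).symm
      simpa using this
    · rintro _ ⟨⟨a, rfl⟩, ha⟩
      have h1 : (QuotientGroup.mk g⁻¹ : G ⧸ B) = QuotientGroup.mk (e a) :=
        QuotientGroup.eq.mpr (by simpa using ha)
      have h2 : a = a0 := hfinj (by rw [ha0, h1, he2])
      simp only [h2]

/-! ### A lattice commensurable with a crystallographic group -/

lemma relIndex_ne_zero_of_finite {G : Type*} [Group G] {T H : Subgroup G} {S : Set G}
    (hS : S.Finite) (h : ∀ x ∈ H, ∃ s ∈ S, s⁻¹ * x ∈ T) : T.relIndex H ≠ 0 := by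
  choose! f hf hf2 using h
  have := hS.to_subtype
  have hfin : Finite (H ⧸ T.subgroupOf H) := by
    refine Finite.of_injective (fun q : H ⧸ T.subgroupOf H =>
      (⟨f (Quotient.out q : H), hf _ (Quotient.out q : H).2⟩ : S)) ?_
    intro p q hpq
    have hpq' : f (Quotient.out p : H) = f (Quotient.out q : H) := congrArg Subtype.val hpq
    rw [← Quotient.out_eq p, ← Quotient.out_eq q]
    refine QuotientGroup.eq.mpr ?_
    have h1 := hf2 _ (Quotient.out p : H).2
    have h2 := hf2 _ (Quotient.out q : H).2
    rw [← hpq'] at h2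
    have h3 := T.mul_mem (T.inv_mem h1) h2
    rw [Subgroup.mem_subgroupOf]
    convert h3 using 1
    simp [mul_assoc]
  exact Nat.card_pos.ne'

lemma exists_finite_coset_reps {G : Type*} [Group G] {T H : Subgroup G} (h : T.relIndex H ≠ 0) :
    ∃ S : Set G, S.Finite ∧ S ⊆ H ∧ ∀ x ∈ H, ∃ s ∈ S, s⁻¹ * x ∈ T := by
  have hfin : Finite (H ⧸ T.subgroupOf H) := Nat.finite_of_card_ne_zero h
  refine ⟨Set.range fun q : H ⧸ T.subgroupOf H => ((Quotient.out q : H) : G), Set.finite_range _,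
    ?_, fun x hx => ⟨_, ⟨QuotientGroup.mk ⟨x, hx⟩, rfl⟩, ?_⟩⟩
  · rintro _ ⟨q, rfl⟩
    exact (Quotient.out q : H).2
  · have : QuotientGroup.mk (Quotient.out (QuotientGroup.mk ⟨x, hx⟩ : H ⧸ T.subgroupOf H))
        = (QuotientGroup.mk ⟨x, hx⟩ : H ⧸ T.subgroupOf H) := Quotient.out_eq _
    rw [QuotientGroup.eq] at this
    exact this

section Commensurable

variable {n : ℕ}

lemma mem_span_int_iff {b : Module.Basis (Fin n) ℝ (Euc n)} {v : Euc n} :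
    v ∈ Submodule.span ℤ (Set.range b) ↔ ∀ i, ∃ z : ℤ, b.repr v i = z := by
  rw [Module.Basis.mem_span_iff_repr_mem ℤ b v]
  refine forall_congr' fun i => ⟨fun ⟨z, hz⟩ => ⟨z, hz.symm⟩, fun ⟨z, hz⟩ => ⟨z, hz.symm⟩⟩

/-- The basis with one vector divided by `q`. -/
def divBasis (b : Module.Basis (Fin n) ℝ (Euc n)) (i₀ : Fin n) (q : ℕ) (hq : q ≠ 0) :
    Module.Basis (Fin n) ℝ (Euc n) :=
  b.isUnitSMul (w := fun i => if i = i₀ then (q : ℝ)⁻¹ else 1) fun i => by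
    rw [isUnit_iff_ne_zero]
    split_ifs
    · exact inv_ne_zero (Nat.cast_ne_zero.mpr hq)
    · exact one_ne_zero

lemma divBasis_repr (b : Module.Basis (Fin n) ℝ (Euc n)) (i₀ : Fin n) (q : ℕ) (hq : q ≠ 0)
    (v : Euc n) (i : Fin n) :
    (divBasis b i₀ q hq).repr v i = (if i = i₀ then (q : ℝ) else 1) * b.repr v i := by
  have h : v = ∑ j, ((if j = i₀ then (q : ℝ) else 1) * b.repr v j) • divBasis b i₀ q hq j := by
    conv_lhs => rw [← b.sum_repr v]
    refine Finset.sum_congr rfl fun j _ => ?_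
    rw [divBasis, Module.Basis.isUnitSMul_apply, smul_smul]
    congr 1
    have : (q : ℝ) ≠ 0 := Nat.cast_ne_zero.mpr hq
    split_ifs <;> field_simp
  conv_lhs => rw [h]
  rw [Module.Basis.repr_sum_self]

/-- The quotient is cyclic, represented by the multiples 0, …, q - 1 of the divided basis vector. -/
lemma relIndex_divBasis (b : Module.Basis (Fin n) ℝ (Euc n)) (i₀ : Fin n) (q : ℕ) (hq : q ≠ 0) :
    (transSub (Submodule.span ℤ (Set.range b))).relIndex
      (transSub (Submodule.span ℤ (Set.range (divBasis b i₀ q hq)))) = q := by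
  set Λ := Submodule.span ℤ (Set.range b) with hΛ
  set Γ := Submodule.span ℤ (Set.range (divBasis b i₀ q hq)) with hΓ
  have hq' : (q : ℝ) ≠ 0 := Nat.cast_ne_zero.mpr hq
  let u : Euc n := (q : ℝ)⁻¹ • b i₀
  have hu : ∀ (z : ℤ) i, b.repr ((z : ℝ) • u) i = if i = i₀ then z / (q : ℝ) else 0 := by
    intro z i
    simp only [u, map_smul, Module.Basis.repr_self, Finsupp.smul_apply, Finsupp.single_apply,
      smul_eq_mul, eq_comm (a := i₀)]
    split_ifs
    · ring
    · ring
  have huΓ : ∀ z : ℤ, (z : ℝ) • u ∈ Γ := by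
    intro z
    rw [hΓ, mem_span_int_iff]
    intro i
    rw [divBasis_repr, hu]
    by_cases hi : i = i₀
    · exact ⟨z, by simp only [hi, if_true]; field_simp⟩
    · exact ⟨0, by simp [hi]⟩
  let φ : Fin q → transSub Γ ⧸ (transSub Λ).subgroupOf (transSub Γ) := fun j =>
    QuotientGroup.mk ⟨transl ((((j : ℕ) : ℤ) : ℝ) • u), transl_mem_transSub.mpr (huΓ _)⟩
  have hφ : Function.Bijective φ := by
    constructor
    · intro j k hjk
      have h1 : (transl ((((j : ℕ) : ℤ) : ℝ) • u))⁻¹ * transl ((((k : ℕ) : ℤ) : ℝ) • u)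
          ∈ transSub Λ := by
        have h0 := hjk
        simp only [φ] at h0
        rw [QuotientGroup.eq] at h0
        exact h0
      rw [transl_inv, transl_mul, transl_mem_transSub, hΛ, mem_span_int_iff] at h1
      obtain ⟨z, hz⟩ := h1 i₀
      rw [map_add, map_neg, Finsupp.add_apply, Finsupp.neg_apply, hu, hu, if_pos rfl,
        if_pos rfl] at hz
      field_simp at hz
      have hz' : -((j : ℕ) : ℤ) + ((k : ℕ) : ℤ) = q * z := by exact_mod_cast hz
      have hj := j.2
      have hk := k.2
      have h0 : z = 0 := by
        by_contra hne
        rcases lt_or_gt_of_ne hne with h | h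
        · nlinarith
        · nlinarith
      subst h0
      ext
      omega
    · intro y
      induction y using QuotientGroup.induction_on with | H y => ?_
      obtain ⟨_, v, hv, rfl⟩ := y
      rw [hΓ, mem_span_int_iff] at hv
      obtain ⟨m, hm⟩ := hv i₀
      rw [divBasis_repr, if_pos rfl] at hm
      have hq0 : (0 : ℤ) < q := by exact_mod_cast Nat.pos_of_ne_zero hq
      have hmod := Int.emod_nonneg m hq0.ne'
      have hmod2 := Int.emod_lt_of_pos m hq0
      refine ⟨⟨(m % q).toNat, by omega⟩, QuotientGroup.eq.mpr ?_⟩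
      change (transl ((((m % q).toNat : ℤ) : ℝ) • u))⁻¹ * transl v ∈ transSub Λ
      rw [transl_inv, transl_mul, transl_mem_transSub, hΛ, mem_span_int_iff]
      intro i
      rw [map_add, map_neg, Finsupp.add_apply, Finsupp.neg_apply, hu, Int.toNat_of_nonneg hmod]
      by_cases hi : i = i₀
      · refine ⟨m / q, ?_⟩
        subst hi
        have h1 : (m : ℝ) = (m % q : ℤ) + q * (m / q : ℤ) := by
          exact_mod_cast (Int.emod_add_mul_ediv m q).symm
        have h2 : b.repr v i = m / q := by
          rw [← hm]
          field_simp
        rw [if_pos rfl, h2, h1]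
        field_simp
        ring
      · obtain ⟨z, hz⟩ := hv i
        rw [divBasis_repr, if_neg hi, one_mul] at hz
        exact ⟨z, by rw [if_neg hi, hz]; simp⟩
  have := Nat.card_eq_of_bijective φ hφ
  rw [Nat.card_eq_fintype_card, Fintype.card_fin] at this
  exact this.symm

/-- The lattice `(1/q) Λ`. -/
def divLattice (Λ : Submodule ℤ (Euc n)) (q : ℕ) : Submodule ℤ (Euc n) where
  carrier := {v | (q : ℤ) • v ∈ Λ}
  zero_mem' := by simp
  add_mem' := fun {v w} hv hw => by
    change (q : ℤ) • (v + w) ∈ Λ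
    rw [smul_add]
    exact Λ.add_mem hv hw
  smul_mem' := fun c v hv => by
    change (q : ℤ) • (c • v) ∈ Λ
    rw [smul_comm]
    exact Λ.smul_mem c hv

/-- A crystallographic group and a lattice of translations which contain its lattice with the same
index, inside a common crystallographic group. -/
lemma IsCrystal.exists_commensurable {b : Module.Basis (Fin n) ℝ (Euc n)}
    {V : Subgroup (Euc n ≃ᵢ Euc n)} (hV : IsCrystal (Submodule.span ℤ (Set.range b)) V)
    (hnorm : ∀ g ∈ V, ∀ v ∈ Submodule.span ℤ (Set.range b),
      linPart g v ∈ Submodule.span ℤ (Set.range b)) (i₀ : Fin n) :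
    ∃ (b' : Module.Basis (Fin n) ℝ (Euc n)) (H : Subgroup (Euc n ≃ᵢ Euc n)),
      IsCrystal (Submodule.span ℤ (Set.range b)) H ∧ V ≤ H ∧
      transSub (Submodule.span ℤ (Set.range b')) ≤ H ∧
      Submodule.span ℤ (Set.range b) ≤ Submodule.span ℤ (Set.range b') ∧
      (transSub (Submodule.span ℤ (Set.range b))).relIndex V =
        (transSub (Submodule.span ℤ (Set.range b))).relIndex
          (transSub (Submodule.span ℤ (Set.range b'))) := by
  set Λ := Submodule.span ℤ (Set.range b) with hΛ
  set q := (transSub Λ).relIndex V with hqdef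
  have hq : q ≠ 0 := hV.relIndex_ne_zero
  have hq' : (q : ℝ) ≠ 0 := Nat.cast_ne_zero.mpr hq
  have hdiv : ∀ {v}, v ∈ divLattice Λ q ↔ (q : ℤ) • v ∈ Λ := Iff.rfl
  have hlin : ∀ g ∈ V, ∀ v ∈ divLattice Λ q, linPart g v ∈ divLattice Λ q := by
    intro g hg v hv
    rw [hdiv] at hv ⊢
    rw [← map_zsmul]
    exact hnorm g hg _ hv
  have hΛdiv : Λ ≤ divLattice Λ q := fun v hv => Λ.smul_mem (q : ℤ) hv
  -- The product of the translations by (1/q)Λ with V; it is a group because the linear parts of V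
  -- preserve Λ, hence (1/q)Λ.
  let H : Subgroup (Euc n ≃ᵢ Euc n) :=
    { carrier := {g | ∃ v ∈ divLattice Λ q, ∃ w ∈ V, g = transl v * w}
      one_mem' := ⟨0, Submodule.zero_mem _, 1, V.one_mem, by rw [transl_zero, mul_one]⟩
      mul_mem' := by
        rintro _ _ ⟨v, hv, w, hw, rfl⟩ ⟨v', hv', w', hw', rfl⟩
        refine ⟨v + linPart w v', Submodule.add_mem _ hv (hlin w hw v' hv'), w * w',
          V.mul_mem hw hw', ?_⟩
        rw [← transl_mul, mul_assoc, ← mul_assoc w, mul_transl]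
        simp only [mul_assoc]
      inv_mem' := by
        rintro _ ⟨v, hv, w, hw, rfl⟩
        refine ⟨linPart w⁻¹ (-v), hlin _ (V.inv_mem hw) _ (Submodule.neg_mem _ hv), w⁻¹,
          V.inv_mem hw, ?_⟩
        rw [mul_inv_rev, transl_inv, mul_transl] }
  have hVH : V ≤ H := fun w hw => ⟨0, Submodule.zero_mem _, w, hw, by rw [transl_zero, one_mul]⟩
  -- Dividing a single basis vector by the index q of Λ in V makes the new lattice contain Λ with
  -- that same index.
  refine ⟨divBasis b i₀ q hq, H, ⟨hV.le.trans hVH, ?_⟩, hVH, ?_, ?_, ?_⟩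
  · obtain ⟨S, hS, hSV, hSr⟩ := exists_finite_coset_reps hV.relIndex_ne_zero
    have hfin : {v : Euc n | v ∈ divLattice Λ q ∧ ‖v‖ ≤ ∑ i, ‖b i‖}.Finite := by
      refine ((finite_span_inter_closedBall b (q * ∑ i, ‖b i‖)).preimage
        (f := fun v => (q : ℤ) • v) (fun v _ w _ h => ?_)).subset ?_
      · have h' : (q : ℤ) • v = (q : ℤ) • w := h
        rw [← Int.cast_smul_eq_zsmul ℝ, ← Int.cast_smul_eq_zsmul ℝ] at h'
        exact smul_right_injective _ (by exact_mod_cast hq') h'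
      · rintro v ⟨h1, h2⟩
        refine ⟨h1, ?_⟩
        change ‖(q : ℤ) • v‖ ≤ _
        rw [← Int.cast_smul_eq_zsmul ℝ, norm_smul]
        simpa using mul_le_mul_of_nonneg_left h2 (Nat.cast_nonneg q)
    -- Modulo Λ the translation part reduces to its fractional part, which lies in a bounded piece
    -- of (1/q)Λ, and the factor in V reduces to one of its coset representatives.
    refine relIndex_ne_zero_of_finite ((hfin.image transl).mul hS) ?_
    rintro _ ⟨v, hv, w, hw, rfl⟩
    obtain ⟨s, hs, u, hu, hsu⟩ := hSr w hw
    refine ⟨_, Set.mul_mem_mul ⟨ZSpan.fract b v, ⟨?_, ZSpan.norm_fract_le b v⟩, rfl⟩ hs, ?_⟩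
    · exact Submodule.sub_mem _ hv (hΛdiv (ZSpan.floor b v).2)
    · refine ⟨linPart s⁻¹ (ZSpan.floor b v) + u,
        Λ.add_mem (hnorm _ (V.inv_mem (hSV hs)) _ (ZSpan.floor b v).2) hu, ?_⟩
      have h1 : -ZSpan.fract b v + v = (ZSpan.floor b v : Euc n) := by
        rw [ZSpan.fract_apply]
        abel
      rw [mul_inv_rev, transl_inv, ← transl_mul, ← hsu, mul_assoc, ← mul_assoc (transl _) (transl v),
        transl_mul, h1, ← mul_assoc, mul_transl, mul_assoc]
  · rintro _ ⟨v, hv, rfl⟩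
    refine ⟨v, ?_, 1, V.one_mem, by rw [mul_one]⟩
    rw [hdiv, hΛ, mem_span_int_iff]
    rw [mem_span_int_iff] at hv
    intro i
    obtain ⟨z, hz⟩ := hv i
    rw [divBasis_repr] at hz
    rw [← Int.cast_smul_eq_zsmul ℝ, map_smul, Finsupp.smul_apply, smul_eq_mul]
    by_cases hi : i = i₀
    · exact ⟨z, by rw [← hz, if_pos hi]; simp⟩
    · exact ⟨q * z, by rw [if_neg hi, one_mul] at hz; rw [hz]; simp⟩
  · intro v hv
    rw [hΛ, mem_span_int_iff] at hv
    rw [mem_span_int_iff]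
    intro i
    obtain ⟨z, hz⟩ := hv i
    rw [divBasis_repr, hz]
    split_ifs
    · exact ⟨q * z, by simp⟩
    · exact ⟨z, by simp⟩
  · rw [relIndex_divBasis]

/-- Unions of translates of a tile of a larger group, over a common transversal, are tiles. -/
lemma EssTile.of_transversal {H V : Subgroup (Euc n ≃ᵢ Euc n)} (hVH : V ≤ H)
    {P : Set (Euc n)} (hP : EssTile (isoHom H) P) {E : Set H}
    (hE : ∀ g : H, ∃! e, e ∈ E ∧ g * e⁻¹ ∈ V.subgroupOf H) (h : H) :
    EssTile (isoHom V) (⋃ e ∈ E, isoHom H (e * h) '' P) := by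
  filter_upwards [hP] with x hx
  obtain ⟨k, hk, hku⟩ := hx
  have hmem : ∀ (g : H) (e : H), isoHom H g x ∈ isoHom H (e * h) '' P ↔ g = e * h * k := by
    intro g e
    rw [image_perm_eq_preimage, Set.mem_preimage, ← Equiv.Perm.mul_apply, ← map_mul]
    refine ⟨fun h1 => ?_, fun h1 => ?_⟩
    · rw [← hku _ h1]; group
    · rw [h1]
      have : (e * h)⁻¹ * (e * h * k) = k := by group
      rw [this]
      exact hk
  -- With k the unique element bringing x into P, the elements bringing x into the union are the e *
  -- h * k with e in E; just one of them lies in V, by the transversal property at the inverse of h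
  -- * k.
  obtain ⟨e, ⟨heE, heV⟩, heu⟩ := hE (h * k)⁻¹
  have hVinv : ∀ e : H, (h * k)⁻¹ * e⁻¹ ∈ V.subgroupOf H ↔ e * h * k ∈ V.subgroupOf H := by
    intro e
    rw [← inv_mem_iff]
    have : ((h * k)⁻¹ * e⁻¹)⁻¹ = e * h * k := by group
    rw [this]
  rw [hVinv] at heV
  refine ⟨⟨_, heV⟩, ?_, ?_⟩
  · exact Set.mem_iUnion₂.mpr ⟨e, heE, (hmem _ _).mpr rfl⟩
  · rintro ⟨g, hg⟩ hgx
    obtain ⟨e', he', hge⟩ := Set.mem_iUnion₂.mp hgx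
    have h1 : (⟨g, hVH hg⟩ : H) = e' * h * k := (hmem ⟨g, hVH hg⟩ e').mp hge
    have h2 : e' = e := heu e' ⟨he', (hVinv e').mpr (by rw [← h1]; exact hg)⟩
    refine Subtype.ext ?_
    subst h2
    exact congrArg (fun y : H => (y : Euc n ≃ᵢ Euc n)) h1

/-- Common tiles of two subgroups of the same index in a crystallographic group: one can be
chosen to contain any given translate of a tile of the large group. -/
lemma IsCrystal.exists_common_tiles {b : Module.Basis (Fin n) ℝ (Euc n)}
    {H V U : Subgroup (Euc n ≃ᵢ Euc n)} (hH : IsCrystal (Submodule.span ℤ (Set.range b)) H)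
    (hV : V ≤ H) (hU : U ≤ H) (hTV : transSub (Submodule.span ℤ (Set.range b)) ≤ V)
    (hTU : transSub (Submodule.span ℤ (Set.range b)) ≤ U)
    (hidx : (transSub (Submodule.span ℤ (Set.range b))).relIndex V =
      (transSub (Submodule.span ℤ (Set.range b))).relIndex U) :
    ∃ (P : Set (Euc n)) (D : H → Set (Euc n)), MeasurableSet P ∧ Bornology.IsBounded P ∧
      EssTile (isoHom H) P ∧ ∀ h, MeasurableSet (D h) ∧ Bornology.IsBounded (D h) ∧
        isoHom H h '' P ⊆ D h ∧ EssTile (isoHom V) (D h) ∧ EssTile (isoHom U) (D h) := by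
  obtain ⟨P, hPm, hPb, hP⟩ := hH.exists_tile
  set T := transSub (Submodule.span ℤ (Set.range b)) with hT
  obtain ⟨E, hEf, hEV, hEU⟩ := exists_common_transversal (G := H) (N := T.subgroupOf H)
    (A := V.subgroupOf H) (B := U.subgroupOf H)
    (fun x hx => hTV hx) (fun x hx => hTU hx) hH.relIndex_ne_zero (by
      rw [Subgroup.relIndex_subgroupOf hV, Subgroup.relIndex_subgroupOf hU, hidx])
  obtain ⟨e₀, ⟨he₀, -⟩, -⟩ := hEV 1
  -- Right multiplication by e₀⁻¹ * h normalizes the transversal so that the translate with e = e₀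
  -- is the prescribed one.
  refine ⟨P, fun h => ⋃ e ∈ E, isoHom H (e * (e₀⁻¹ * h)) '' P, hPm, hPb, hP, fun h =>
    ⟨?_, ?_, ?_, hP.of_transversal hV hEV _, hP.of_transversal hU hEU _⟩⟩
  · exact hEf.measurableSet_biUnion fun e _ => (quasiInvariant_isoHom H).measurableSet_image _ hPm
  · refine (Bornology.isBounded_biUnion hEf).mpr fun e _ => ?_
    exact ((e * (e₀⁻¹ * h) : H) : Euc n ≃ᵢ Euc n).isometry.lipschitz.isBounded_image hPb
  · have : e₀ * (e₀⁻¹ * h) = h := by group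
    intro x hx
    refine Set.mem_iUnion₂.mpr ⟨e₀, he₀, ?_⟩
    rwa [this]

end Commensurable

/-! ### Common tiles for a crystallographic group, a lattice and dilations -/

section CommonTile

variable {n : ℕ} {A : Matrix (Fin n) (Fin n) ℝ}

/-- The orbit of 0 is discrete: if its other points have norm at least 2ε, then 0 is a nearest orbit
point for every x with ‖x‖ ≤ ε. -/
lemma IsCrystal.exists_orbit_gap {b : Module.Basis (Fin n) ℝ (Euc n)}
    {H : Subgroup (Euc n ≃ᵢ Euc n)} (hH : IsCrystal (Submodule.span ℤ (Set.range b)) H) :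
    ∃ ε > 0, ∀ x : Euc n, ‖x‖ ≤ ε → Metric.infDist x ((fun h : H => (h : Euc n ≃ᵢ Euc n) 0) ''
      Set.univ) = ‖x‖ := by
  obtain ⟨ε, hε, hmin⟩ : ∃ ε > 0, ∀ h ∈ H, h 0 ≠ 0 → 2 * ε ≤ ‖h 0‖ := by
    have hfin : {h | h ∈ H ∧ h 0 ≠ 0 ∧ ‖h 0‖ ≤ 1}.Finite := (hH.finite_near 1).subset
      fun h hh => ⟨hh.1, 0, by simp, hh.2.2⟩
    rcases Set.eq_empty_or_nonempty {h | h ∈ H ∧ h 0 ≠ 0 ∧ ‖h 0‖ ≤ 1} with he | hne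
    · refine ⟨1 / 2, by norm_num, fun h hh h0 => ?_⟩
      by_contra! hlt
      have : h ∈ {h | h ∈ H ∧ h 0 ≠ 0 ∧ ‖h 0‖ ≤ 1} := ⟨hh, h0, by linarith⟩
      rw [he] at this
      exact this
    · obtain ⟨g, hg, hgm⟩ := Set.exists_min_image _ (fun h : Euc n ≃ᵢ Euc n => ‖h 0‖) hfin hne
      have hg0 : 0 < ‖g 0‖ := norm_pos_iff.mpr hg.2.1
      refine ⟨‖g 0‖ / 2, by positivity, fun h hh h0 => ?_⟩
      by_cases hle : ‖h 0‖ ≤ 1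
      · have := hgm h ⟨hh, h0, hle⟩
        linarith
      · have := hg.2.2
        linarith
  refine ⟨ε, hε, fun x hx => le_antisymm ?_ ?_⟩
  · have := Metric.infDist_le_dist_of_mem (x := x)
      (show (0 : Euc n) ∈ (fun h : H => (h : Euc n ≃ᵢ Euc n) 0) '' Set.univ from ⟨1, trivial, rfl⟩)
    simpa using this
  · refine (Metric.le_infDist (Set.univ_nonempty.image _)).mpr ?_
    rintro _ ⟨h, -, rfl⟩
    by_cases h0 : (h : Euc n ≃ᵢ Euc n) 0 = 0
    · simp [h0]
    · have h1 := hmin _ h.2 h0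
      have h2 : ‖(h : Euc n ≃ᵢ Euc n) 0‖ ≤ ‖x‖ + dist x ((h : Euc n ≃ᵢ Euc n) 0) := by
        rw [dist_comm, dist_eq_norm]
        calc ‖(h : Euc n ≃ᵢ Euc n) 0‖ = ‖x + ((h : Euc n ≃ᵢ Euc n) 0 - x)‖ := by congr 1; abel
          _ ≤ _ := norm_add_le _ _
      linarith

lemma infDist_orbit_invariant (H : Subgroup (Euc n ≃ᵢ Euc n)) (g : H) (x : Euc n) :
    Metric.infDist (isoHom H g x) ((fun h : H => (h : Euc n ≃ᵢ Euc n) 0) '' Set.univ) =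
      Metric.infDist x ((fun h : H => (h : Euc n ≃ᵢ Euc n) 0) '' Set.univ) := by
  have h1 : (g : Euc n ≃ᵢ Euc n) '' ((fun h : H => (h : Euc n ≃ᵢ Euc n) 0) '' Set.univ) =
      (fun h : H => (h : Euc n ≃ᵢ Euc n) 0) '' Set.univ := by
    rw [← Set.image_comp, Set.image_univ, Set.image_univ]
    ext y
    constructor
    · rintro ⟨h, rfl⟩
      exact ⟨g * h, rfl⟩
    · rintro ⟨h, rfl⟩
      refine ⟨g⁻¹ * h, ?_⟩
      exact (g : Euc n ≃ᵢ Euc n).apply_symm_apply _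
  conv_lhs => rw [← h1]
  exact Metric.infDist_image (g : Euc n ≃ᵢ Euc n).isometry

/-- A continuous invariant function which is the distance to `0` near `0`. -/
lemma IsCrystal.exists_invariant_radius {b : Module.Basis (Fin n) ℝ (Euc n)}
    {H : Subgroup (Euc n ≃ᵢ Euc n)} (hH : IsCrystal (Submodule.span ℤ (Set.range b)) H) :
    ∃ ρ : Euc n → ℝ, Continuous ρ ∧ (∀ (g : H) x, ρ (isoHom H g x) = ρ x) ∧
      ∃ ε > 0, ∀ x : Euc n, ‖x‖ ≤ ε → ρ x = ‖x‖ :=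
  ⟨_, Metric.continuous_infDist_pt _, infDist_orbit_invariant H, hH.exists_orbit_gap⟩

/-- Exponents and radii for which the scaled copies of a bounded set lie in disjoint shells. -/
lemma IsExpansive.exists_shells [NeZero n] (hA : IsExpansive A) {F : Set (Euc n)} {c : ℝ}
    (hc : 0 < c) (hFc : ∀ x ∈ F, c ≤ ‖x‖) (hF1 : ∀ x ∈ F, ‖x‖ ≤ 1) {ε : ℝ} (hε : 0 < ε) :
    ∃ (m : ℕ → ℤ) (t : ℕ → ℝ), Antitone t ∧ t 0 ≤ ε ∧
      ∀ k, ∀ x ∈ F, t (k + 1) ≤ ‖dil A (m k) x‖ ∧ ‖dil A (m k) x‖ < t k := by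
  have hu := hA.isUnit_det
  -- F lies in the unit ball, so a negative power of A puts it below the outer radius t; a bound K
  -- for the opposite power keeps it at distance at least c / K from 0, which gives the next radius.
  have h1 : ∀ t : {t : ℝ // 0 < t}, ∃ (m : ℤ) (s : {t : ℝ // 0 < t}), s.1 ≤ t.1 ∧
      ∀ x ∈ F, s.1 ≤ ‖dil A m x‖ ∧ ‖dil A m x‖ < t.1 := by
    rintro ⟨t, ht⟩
    obtain ⟨J, hJ⟩ := hA.exists_norm_dil_neg_le (half_pos ht)
    obtain ⟨K, hK, hKx⟩ := exists_norm_dil_le A (J : ℤ)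
    refine ⟨-(J : ℤ), ⟨min t (c / K), lt_min ht (by positivity)⟩, min_le_left _ _,
      fun x hx => ⟨?_, ?_⟩⟩
    · refine (min_le_right _ _).trans ?_
      rw [div_le_iff₀ hK]
      have := hKx (dil A (-(J : ℤ)) x)
      rw [dil_dil_neg hu] at this
      linarith [hFc x hx]
    · have := hJ J le_rfl x
      have h2 := hF1 x hx
      change _ < t
      nlinarith
  choose m s hst hs using h1
  let t : ℕ → {t : ℝ // 0 < t} := fun k => Nat.rec ⟨ε, hε⟩ (fun _ r => s r) k
  refine ⟨fun k => m (t k), fun k => (t k).1, antitone_nat_of_succ_le fun k => hst (t k), le_rfl,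
    fun k x hx => hs (t k) x hx⟩

/-- A finite cover lets one greedily exhaust a set of finite measure. -/
lemma exists_greedy_exhaustion {X ι : Type*} [MeasurableSpace X] {μ : Measure X} {F : Set X}
    (hF : MeasurableSet F) (hFfin : μ F ≠ ⊤) {s : Set ι} (hs : s.Finite) {B : ℕ → ι → Set X}
    (hB : ∀ k i, MeasurableSet (B k i)) (hcov : ∀ k, ∀ᵐ x ∂μ, x ∈ F → ∃ i ∈ s, x ∈ B k i)
    (hne : s.Nonempty) :
    ∃ (c : ℕ → ι) (D : ℕ → Set X), (∀ k, c k ∈ s) ∧ (∀ k, MeasurableSet (D k)) ∧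
      (∀ k, D k ⊆ F) ∧ Pairwise (fun i j => Disjoint (D i) (D j)) ∧ μ (F \ ⋃ k, D k) = 0 ∧
      ∀ k, D k ⊆ B k (c k) := by
  classical
  -- Pigeonhole: some candidate covers at least the fraction 1/|s| of what remains.
  have h1 : ∀ (k : ℕ) (R : {R : Set X // MeasurableSet R ∧ R ⊆ F}), ∃ i ∈ s,
      μ R.1 ≤ hs.toFinset.card * μ (R.1 ∩ B k i) := by
    rintro k ⟨R, hRm, hRF⟩
    by_contra! hcon
    have h2 : μ R ≤ ∑ i ∈ hs.toFinset, μ (R ∩ B k i) := by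
      refine le_trans (measure_mono_ae ?_) (measure_biUnion_finset_le hs.toFinset _)
      filter_upwards [hcov k] with x hx hxR
      obtain ⟨i, hi, hxi⟩ := hx (hRF hxR)
      exact Set.mem_biUnion (hs.mem_toFinset.mpr hi) ⟨hxR, hxi⟩
    obtain ⟨i₀, hi₀⟩ := hne
    have hcard : hs.toFinset.card ≠ 0 := Finset.card_ne_zero.mpr ⟨i₀, hs.mem_toFinset.mpr hi₀⟩
    have h3 : ∀ i ∈ hs.toFinset, μ (R ∩ B k i) < μ R / hs.toFinset.card := by
      intro i hi
      rw [ENNReal.lt_div_iff_mul_lt (Or.inl (by exact_mod_cast hcard)) (Or.inl (by simp)), mul_comm]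
      exact hcon i (hs.mem_toFinset.mp hi)
    have h4 := ENNReal.sum_lt_sum_of_nonempty ⟨i₀, hs.mem_toFinset.mpr hi₀⟩ h3
    rw [Finset.sum_const, nsmul_eq_mul, ENNReal.mul_div_cancel (by exact_mod_cast hcard)
      (by simp)] at h4
    exact absurd h2 (not_le.mpr h4)
  choose c hcs hc using h1
  let R : ℕ → {R : Set X // MeasurableSet R ∧ R ⊆ F} := fun k => Nat.rec ⟨F, hF, subset_rfl⟩
    (fun k S => ⟨S.1 \ B k (c k S), S.2.1.diff (hB _ _), Set.sdiff_subset.trans S.2.2⟩) k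
  have hR : ∀ k, (R (k + 1)).1 = (R k).1 \ B k (c k (R k)) := fun k => rfl
  let D : ℕ → Set X := fun k => (R k).1 ∩ B k (c k (R k))
  have hanti : Antitone fun k => (R k).1 := antitone_nat_of_succ_le fun k => by
    rw [hR]
    exact Set.sdiff_subset
  have hdisj : Pairwise (fun i j => Disjoint (D i) (D j)) := by
    have : ∀ i j, i < j → Disjoint (D i) (D j) := fun i j hij => by
      refine Set.disjoint_left.mpr fun x hx hx' => ?_
      have := hanti (Nat.succ_le_of_lt hij) hx'.1
      simp only [Nat.succ_eq_add_one, hR] at this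
      exact this.2 hx.2
    intro i j hij
    rcases lt_or_gt_of_ne hij with h | h
    · exact this i j h
    · exact (this j i h).symm
  have hDm : ∀ k, MeasurableSet (D k) := fun k => (R k).2.1.inter (hB _ _)
  refine ⟨fun k => c k (R k), D, fun k => hcs _ _, hDm,
    fun k => Set.inter_subset_left.trans (R k).2.2, hdisj, ?_, fun k => Set.inter_subset_right⟩
  have hsub : ∀ k, F \ ⋃ k, D k ⊆ (R k).1 := by
    intro k
    induction k with
    | zero => exact Set.sdiff_subset
    | succ k ih =>
      intro x hx
      rw [hR]
      exact ⟨ih hx, fun h => hx.2 (Set.mem_iUnion.mpr ⟨k, ih hx, h⟩)⟩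
  -- The chosen pieces are disjoint in a set of finite measure, so their measures tend to 0, and the
  -- remainder is at most |s| times the k-th of them.
  have hsum : ∑' k, μ (D k) ≠ ⊤ := by
    rw [← measure_iUnion hdisj hDm]
    exact ne_top_of_le_ne_top hFfin (measure_mono (Set.iUnion_subset fun k =>
      Set.inter_subset_left.trans (R k).2.2))
  have hlim := ENNReal.Tendsto.const_mul (a := (hs.toFinset.card : ENNReal))
    (ENNReal.tendsto_atTop_zero_of_tsum_ne_top hsum) (Or.inr (by simp))
  rw [mul_zero] at hlim
  refine le_antisymm (ge_of_tendsto' hlim fun k => ?_) zero_le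
  exact (measure_mono (hsub k)).trans (hc k (R k))

/-- The index of the interval `[t (k + 1), t k)` containing a number. -/
lemma exists_measurable_index {t : ℕ → ℝ} (htanti : Antitone t) :
    ∃ col : ℝ → ℕ, Measurable col ∧ ∀ k r, t (k + 1) ≤ r → r < t k → col r = k := by
  classical
  -- The second alternative only supplies a default index 0 for numbers below all t (j + 1).
  have hex : ∀ r : ℝ, ∃ k, t (k + 1) ≤ r ∨ ∀ j, r < t (j + 1) := by
    intro r
    by_cases h : ∀ j, r < t (j + 1)
    · exact ⟨0, Or.inr h⟩
    · push Not at h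
      exact h.imp fun _ h => Or.inl h
  refine ⟨fun r => Nat.find (hex r), ?_, ?_⟩
  · refine measurable_find _ fun k => ?_
    simp only [Set.ofPred_or, Set.ofPred_forall]
    exact measurableSet_Ici.union (MeasurableSet.iInter fun j => measurableSet_Iio)
  · intro k r h1 h2
    refine (Nat.find_eq_iff _).mpr ⟨Or.inl h1, fun j hj => ?_⟩
    push Not
    exact ⟨h2.trans_le (htanti hj), k, h1⟩

/-- A common tile of two subgroups containing scaled copies, near `0`, of the pieces of a set. -/
lemma IsCrystal.exists_tile_containing [NeZero n] {b : Module.Basis (Fin n) ℝ (Euc n)}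
    {H V U : Subgroup (Euc n ≃ᵢ Euc n)} (hH : IsCrystal (Submodule.span ℤ (Set.range b)) H)
    (hV : V ≤ H) (hU : U ≤ H) (hTV : transSub (Submodule.span ℤ (Set.range b)) ≤ V)
    (hTU : transSub (Submodule.span ℤ (Set.range b)) ≤ U)
    (hidx : (transSub (Submodule.span ℤ (Set.range b))).relIndex V =
      (transSub (Submodule.span ℤ (Set.range b))).relIndex U)
    (hA : IsExpansive A) {F : Set (Euc n)} (hFm : MeasurableSet F) {c : ℝ}
    (hc : 0 < c) (hFc : ∀ x ∈ F, c ≤ ‖x‖) (hF1 : ∀ x ∈ F, ‖x‖ ≤ 1) :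
    ∃ (E : Set (Euc n)) (D : ℕ → Set (Euc n)) (m : ℕ → ℤ), MeasurableSet E ∧
      Bornology.IsBounded E ∧ EssTile (isoHom V) E ∧ EssTile (isoHom U) E ∧
      (∀ k, MeasurableSet (D k)) ∧ (∀ k, D k ⊆ F) ∧ Pairwise (fun i j => Disjoint (D i) (D j)) ∧
      volume (F \ ⋃ k, D k) = 0 ∧ (∀ k, dil A (m k) '' D k ⊆ E) ∧
      Pairwise (fun i j => Disjoint (dil A (m i) '' D i) (dil A (m j) '' D j)) := by
  classical
  have hu := hA.isUnit_det
  obtain ⟨P, T, hPm, hPb, hP, hT⟩ := hH.exists_common_tiles hV hU hTV hTU hidx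
  obtain ⟨ρ, hρc, hρinv, ε, hε, hρ⟩ := hH.exists_invariant_radius
  obtain ⟨m, t, htanti, ht0, hmt⟩ := hA.exists_shells hc hFc hF1 hε
  have := hH.countable
  -- finitely many translates of `P` cover a neighbourhood of `0`
  obtain ⟨R, hR⟩ := hPb.exists_norm_le
  -- The identity is admitted only to make the set of candidates nonempty.
  have hfin : {h : H | h = 1 ∨ ∃ x, ‖x‖ ≤ ε ∧ x ∈ isoHom H h '' P}.Finite := by
    refine Set.Finite.union (Set.finite_singleton 1) (((hH.finite_near (max R ε)).preimage
      (Subtype.val_injective.injOn)).subset ?_)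
    rintro h ⟨_, hx, y, hy, rfl⟩
    exact ⟨h.2, y, (hR y hy).trans (le_max_left _ _), hx.trans (le_max_right _ _)⟩
  -- Finitely many translates of P cover the ball containing all the scaled copies of F; on the k-th
  -- shell one translate is chosen, and D k is the still unused part of F that the k-th power maps
  -- into it.
  obtain ⟨h, D, hh, hDm, hDF, hDd, hDnull, hDB⟩ := exists_greedy_exhaustion (μ := volume) hFm
    (ne_top_of_le_ne_top (measure_closedBall_lt_top (x := (0 : Euc n)) (r := 1)).ne
      (measure_mono fun x hx => by simpa using hF1 x hx)) hfin
    (B := fun k h => dil A (m k) ⁻¹' (isoHom H h '' P))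
    (fun k h => (continuous_dil _).measurable
      ((quasiInvariant_isoHom H).measurableSet_image h hPm)) (fun k => by
      filter_upwards [(quasiInvariant_dilHom hu (Multiplicative.ofAdd (m k))).ae hP] with x hx hxF
      obtain ⟨g, hg, -⟩ := hx
      have h1 : dil A (m k) x ∈ isoHom H g⁻¹ '' P := by
        rw [image_perm_eq_preimage, inv_inv]
        exact hg
      refine ⟨g⁻¹, Or.inr ⟨_, ?_, h1⟩, h1⟩
      exact (hmt k x hxF).2.le.trans ((htanti (Nat.zero_le k)).trans ht0)) ⟨1, Or.inl rfl⟩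
  obtain ⟨col, hcolm, hcol⟩ := exists_measurable_index htanti
  -- On the k-th shell of the invariant radius ρ, E agrees with the common tile containing the k-th
  -- chosen translate of P. As the shells are invariant under H, E is a tile for V and for U.
  obtain ⟨E, hE⟩ : ∃ E : Set (Euc n), E = {x | x ∈ T (h (col (ρ x)))} := ⟨_, rfl⟩
  have hmemE : ∀ x, x ∈ E ↔ x ∈ T (h (col (ρ x))) := fun x => by rw [hE]; rfl
  have hEsub : ∀ k, dil A (m k) '' D k ⊆ E := by
    rintro k _ ⟨x, hx, rfl⟩
    have h1 := hmt k x (hDF k hx)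
    have h2 : ρ (dil A (m k) x) = ‖dil A (m k) x‖ :=
      hρ _ (h1.2.le.trans ((htanti (Nat.zero_le k)).trans ht0))
    rw [hmemE, h2, hcol k _ h1.1 h1.2]
    exact (hT (h k)).2.2.1 (hDB k hx)
  refine ⟨E, D, m, ?_, ?_, ?_, ?_, hDm, hDF, hDd, hDnull, hEsub, ?_⟩
  · have : E = ⋃ k, ((fun x => col (ρ x)) ⁻¹' {k} ∩ T (h k)) := by
      ext x
      simp [hmemE]
    rw [this]
    exact MeasurableSet.iUnion fun k => ((hcolm.comp (hρc).measurable)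
      (measurableSet_singleton k)).inter (hT _).1
  · refine ((Bornology.isBounded_biUnion hfin).mpr fun g _ => (hT g).2.1).subset fun x hx => ?_
    exact Set.mem_biUnion (hh _) ((hmemE x).mp hx)
  · rw [hE]
    exact EssTile.piecewise (fun k => (hT (h k)).2.2.2.1) fun g x =>
      congrArg col (hρinv ⟨g, hV g.2⟩ x)
  · rw [hE]
    exact EssTile.piecewise (fun k => (hT (h k)).2.2.2.2) fun g x =>
      congrArg col (hρinv ⟨g, hU g.2⟩ x)
  · intro i j hij
    refine Set.disjoint_left.mpr ?_
    rintro _ ⟨x, hx, rfl⟩ ⟨y, hy, hxy⟩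
    have h1 := hmt i x (hDF i hx)
    have h2 := hmt j y (hDF j hy)
    rw [hxy] at h2
    exact hij ((hcol i _ h1.1 h1.2).symm.trans (hcol j _ h2.1 h2.2))

/-- The Schröder–Bernstein construction of a set that is a tile for two groups of isometries and
for the powers of an expansive matrix. -/
lemma exists_tile_of_pieces {V U : Subgroup (Euc n ≃ᵢ Euc n)} (hu : IsUnit A.det)
    {E F : Set (Euc n)} {D : ℕ → Set (Euc n)} {m : ℕ → ℤ} (hEm : MeasurableSet E)
    (hEb : Bornology.IsBounded E) (hEV : EssTile (isoHom V) E) (hEU : EssTile (isoHom U) E)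
    (hF : EssTile (dilHom hu) F)
    (hDm : ∀ k, MeasurableSet (D k)) (hDF : ∀ k, D k ⊆ F)
    (hDd : Pairwise (fun i j => Disjoint (D i) (D j))) (hDnull : volume (F \ ⋃ k, D k) = 0)
    (hDE : ∀ k, dil A (m k) '' D k ⊆ E)
    (hDd' : Pairwise (fun i j => Disjoint (dil A (m i) '' D i) (dil A (m j) '' D j)))
    {γ : Euc n} (hγV : transl γ ∈ V) (hγU : transl γ ∈ U) {j : ℤ}
    (hj : ∀ x ∈ E, dil A (-j) (x + γ) ∈ F) :
    ∃ W : Set (Euc n), MeasurableSet W ∧ Bornology.IsBounded W ∧ EssTile (isoHom V) W ∧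
      EssTile (isoHom U) W ∧ EssTile (dilHom hu) W := by
  have himg : ∀ (k : ℤ) (S : Set (Euc n)), MeasurableSet S → MeasurableSet (dil A k '' S) :=
    fun k S hS => (quasiInvariant_dilHom hu).measurableSet_image (Multiplicative.ofAdd k) hS
  have hinj : ∀ k : ℤ, Function.Injective (dil A k) := fun k =>
    (dilHom hu (Multiplicative.ofAdd k)).injective
  -- One injection, from E into F: translate by γ, then apply the power -j. The other goes from
  -- almost all of F into E and is the power m i on D i.
  let α : Set (Euc n) → Set (Euc n) := fun S => dil A (-j) '' (transl γ '' S)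
  have hα : ∀ S, MeasurableSet S → MeasurableSet (α S) := fun S hS =>
    himg _ _ ((transl γ).toHomeomorph.measurableEmbedding.measurableSet_image.mpr hS)
  have hαF : ∀ S ⊆ E, α S ⊆ F := by
    rintro S hS _ ⟨_, ⟨x, hx, rfl⟩, rfl⟩
    exact hj x (hS hx)
  -- Schröder–Bernstein: start with the part of E missed by the injection from F and iterate the
  -- composite of the two injections.
  let X : ℕ → Set (Euc n) := fun k => Nat.rec (E \ ⋃ i, dil A (m i) '' D i)
    (fun _ S => ⋃ i, dil A (m i) '' (D i ∩ α S)) k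
  have hX0 : X 0 = E \ ⋃ i, dil A (m i) '' D i := rfl
  have hXs : ∀ k, X (k + 1) = ⋃ i, dil A (m i) '' (D i ∩ α (X k)) := fun k => rfl
  have hXm : ∀ k, MeasurableSet (X k) := by
    intro k
    induction k with
    | zero => exact hEm.diff (MeasurableSet.iUnion fun i => himg _ _ (hDm i))
    | succ k ih =>
      rw [hXs]
      exact MeasurableSet.iUnion fun i => himg _ _ ((hDm i).inter (hα _ ih))
  have hXE : ∀ k, X k ⊆ E := by
    intro k
    cases k with
    | zero => exact Set.sdiff_subset
    | succ k =>
      rw [hXs]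
      exact Set.iUnion_subset fun i => (Set.image_mono Set.inter_subset_left).trans (hDE i)
  set Y := ⋃ k, X k with hY
  have hYm : MeasurableSet Y := MeasurableSet.iUnion hXm
  have hYE : Y ⊆ E := Set.iUnion_subset hXE
  -- What is left of E is exactly the image of the part of F outside α Y.
  have hcompl : E \ Y = ⋃ i, dil A (m i) '' (D i \ α Y) := by
    ext x
    constructor
    · rintro ⟨hxE, hxY⟩
      have h0 : x ∈ ⋃ i, dil A (m i) '' D i := by
        by_contra h
        exact hxY (Set.mem_iUnion.mpr ⟨0, hxE, h⟩)
      obtain ⟨i, f, hf, rfl⟩ := Set.mem_iUnion.mp h0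
      refine Set.mem_iUnion.mpr ⟨i, f, ⟨hf, ?_⟩, rfl⟩
      rintro ⟨_, ⟨y, hy, rfl⟩, hyf⟩
      obtain ⟨k, hk⟩ := Set.mem_iUnion.mp hy
      refine hxY (Set.mem_iUnion.mpr ⟨k + 1, ?_⟩)
      rw [hXs]
      exact Set.mem_iUnion.mpr ⟨i, f, ⟨hf, _, ⟨y, hk, rfl⟩, hyf⟩, rfl⟩
    · intro hx
      obtain ⟨i, f, ⟨hf, hfα⟩, rfl⟩ := Set.mem_iUnion.mp hx
      refine ⟨hDE i ⟨f, hf, rfl⟩, fun h => ?_⟩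
      obtain ⟨k, hk⟩ := Set.mem_iUnion.mp h
      cases k with
      | zero => exact hk.2 (Set.mem_iUnion.mpr ⟨i, f, hf, rfl⟩)
      | succ k =>
        rw [hXs] at hk
        obtain ⟨l, f', ⟨hf', hf'α⟩, hff'⟩ := Set.mem_iUnion.mp hk
        have hli : l = i := by
          by_contra hne
          exact Set.disjoint_left.mp (hDd' hne) ⟨f', hf', rfl⟩ ⟨f, hf, hff'.symm⟩
        subst hli
        have := hinj _ hff'
        subst this
        exact hfα (Set.image_mono (Set.image_mono (Set.subset_iUnion X k)) hf'α)
  -- W consists of pieces of E moved by elements of V and of U, and also of pieces of F moved by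
  -- dilations: α Y by the power j, the rest by the powers m i.
  let W := transl γ '' Y ∪ E \ Y
  have hglue : ∀ {G : Subgroup (Euc n ≃ᵢ Euc n)}, transl γ ∈ G → EssTile (isoHom G) E →
      EssTile (isoHom G) W := by
    intro G hG hE
    have := hE.glue (P := fun i : Bool => if i then Y else E \ Y) (fun x hx => ?_) (fun i => ?_)
      (fun i => if i then ⟨transl γ, hG⟩ else 1)
    · convert this using 1
      change transl γ '' Y ∪ E \ Y = _
      rw [Set.union_eq_iUnion]
      refine Set.iUnion_congr fun i => ?_
      cases i
      · simp
      · rfl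
    · by_cases hxY : x ∈ Y
      · refine ⟨true, hxY, fun i hi => ?_⟩
        cases i
        · exact absurd hxY hi.2
        · rfl
      · refine ⟨false, ⟨hx, hxY⟩, fun i hi => ?_⟩
        cases i
        · rfl
        · exact absurd hi hxY
    · cases i
      · exact Set.sdiff_subset
      · exact hYE
  refine ⟨W, ?_, ?_, hglue hγV hEV, hglue hγU hEU, ?_⟩
  · exact ((transl γ).toHomeomorph.measurableEmbedding.measurableSet_image.mpr hYm).union
      (hEm.diff hYm)
  · exact ((transl γ).isometry.lipschitz.isBounded_image (hEb.subset hYE)).union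
      (hEb.subset Set.sdiff_subset)
  · have hF' : EssTile (dilHom hu) (α Y ∪ ⋃ i, (D i \ α Y)) := by
      refine hF.congr_ae (quasiInvariant_dilHom hu) ?_
      filter_upwards [measure_eq_zero_iff_ae_notMem.mp hDnull] with x hx
      constructor
      · intro hxF
        by_cases hxY : x ∈ α Y
        · exact Or.inl hxY
        · have : x ∈ ⋃ i, D i := by
            by_contra h
            exact hx ⟨hxF, h⟩
          obtain ⟨i, hi⟩ := Set.mem_iUnion.mp this
          exact Or.inr (Set.mem_iUnion.mpr ⟨i, hi, hxY⟩)
      · rintro (h | h)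
        · exact hαF Y hYE h
        · obtain ⟨i, hi⟩ := Set.mem_iUnion.mp h
          exact hDF i hi.1
    have := hF'.glue (P := fun i : Option ℕ => i.elim (α Y) fun i => D i \ α Y) (fun x hx => ?_)
      (fun i => ?_) (fun i => Multiplicative.ofAdd (i.elim j m))
    · convert this using 1
      rw [Set.iUnion_option]
      simp only [Option.elim_none, Option.elim_some]
      refine congrArg₂ (· ∪ ·) ?_ hcompl
      ext x
      constructor
      · rintro ⟨y, hy, rfl⟩
        exact ⟨_, ⟨_, ⟨y, hy, rfl⟩, rfl⟩, dil_dil_neg hu j _⟩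
      · rintro ⟨_, ⟨y, hy, rfl⟩, rfl⟩
        rw [dilHom_apply, dil_dil_neg hu]
        exact hy
    · by_cases hxY : x ∈ α Y
      · refine ⟨none, hxY, fun i hi => ?_⟩
        cases i with
        | none => rfl
        | some i => exact absurd hxY hi.2
      · obtain ⟨i, hi⟩ := Set.mem_iUnion.mp (hx.resolve_left hxY)
        refine ⟨some i, hi, fun k hk => ?_⟩
        cases k with
        | none => exact absurd hk hxY
        | some k =>
          by_contra hne
          exact Set.disjoint_left.mp (hDd fun h => hne (congrArg some h)) hk.1 hi.1
    · cases i with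
      | none => exact Set.subset_union_left
      | some i => exact (Set.subset_iUnion (fun i => D i \ α Y) i).trans Set.subset_union_right

/-- A crystallographic group has, with a suitable lattice, common tiles that are also tiles for
the powers of any given expansive matrix. -/
theorem IsCrystal.exists_common_tile [NeZero n] {b : Module.Basis (Fin n) ℝ (Euc n)}
    {V : Subgroup (Euc n ≃ᵢ Euc n)} (hV : IsCrystal (Submodule.span ℤ (Set.range b)) V)
    (hnorm : ∀ g ∈ V, ∀ v ∈ Submodule.span ℤ (Set.range b),
      linPart g v ∈ Submodule.span ℤ (Set.range b)) :
    ∃ b' : Module.Basis (Fin n) ℝ (Euc n), ∀ (A : Matrix (Fin n) (Fin n) ℝ) (hA : IsExpansive A),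
      ∃ W : Set (Euc n), MeasurableSet W ∧ Bornology.IsBounded W ∧ EssTile (isoHom V) W ∧
        EssTile (isoHom (transSub (Submodule.span ℤ (Set.range b')))) W ∧
        EssTile (dilHom hA.isUnit_det) W := by
  obtain ⟨b', H, hH, hVH, hUH, hbb', hidx⟩ := hV.exists_commensurable hnorm 0
  refine ⟨b', fun A hA => ?_⟩
  have hu := hA.isUnit_det
  obtain ⟨F, hFm, hF, ⟨c, hc, hFc⟩, hF1, x₀, hx₀⟩ := hA.exists_tile
  obtain ⟨E, D, m, hEm, hEb, hEV, hEU, hDm, hDF, hDd, hDnull, hDE, hDd'⟩ :=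
    hH.exists_tile_containing hVH hUH hV.le (transSub_mono hbb') hidx hA hFm hc hFc hF1
  obtain ⟨R, hR⟩ := hEb.exists_norm_le
  obtain ⟨K, hK⟩ := exists_span_near b
  obtain ⟨r, hr, hball⟩ := Metric.isOpen_iff.mp isOpen_interior x₀ hx₀
  have hRK : 0 < |R| + |K| + 1 := by positivity
  -- A lattice vector γ within |K| of the J-th power image of x₀ moves the bounded set E close to
  -- that image; going back by J steps contracts the error |R| + |K| below r, inside the ball about
  -- x₀ in F.
  obtain ⟨J, hJ⟩ := hA.exists_norm_dil_neg_le (ε := r / (|R| + |K| + 1)) (by positivity)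
  obtain ⟨γ, hγ, hγK⟩ := hK (-(dil A J x₀))
  have hFt : EssTile (dilHom hu) F := by
    have h0 : ∀ᵐ x : Euc n, x ≠ 0 := by
      refine measure_eq_zero_iff_ae_notMem.mp (measure_singleton (0 : Euc n))
    filter_upwards [h0] with x hx
    exact hF x hx
  refine exists_tile_of_pieces hu hEm hEb hEV hEU hFt hDm hDF hDd hDnull hDE hDd'
    (γ := γ) (hV.le (transl_mem_transSub.mpr hγ)) (transl_mem_transSub.mpr (hbb' hγ)) (j := J)
    fun x hx => interior_subset (hball ?_)
  rw [Metric.mem_ball, dist_eq_norm]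
  have h1 : dil A (-(J : ℤ)) (x + γ) - x₀ = dil A (-(J : ℤ)) (x + (-(dil A J x₀) + γ)) := by
    rw [map_add, map_add _ x, map_add, map_neg, dil_neg_dil hu]
    abel
  rw [h1]
  refine (hJ J le_rfl _).trans_lt ?_
  have h2 : ‖x + (-(dil A J x₀) + γ)‖ ≤ |R| + |K| := (norm_add_le _ _).trans
    (add_le_add ((hR x hx).trans (le_abs_self R)) (hγK.trans (le_abs_self K)))
  calc r / (|R| + |K| + 1) * ‖x + (-(dil A J x₀) + γ)‖
      ≤ r / (|R| + |K| + 1) * (|R| + |K|) := mul_le_mul_of_nonneg_left h2 (by positivity)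
    _ < r := by
      rw [div_mul_eq_mul_div, div_lt_iff₀ hRK]
      nlinarith

end CommonTile

/-! ### The inverse Fourier transform of integrable square-integrable functions -/

section FourierInv

variable {n : ℕ}

/-- The inverse Fourier transform on `L²` is given by the integral on integrable functions. -/
lemma coe_fourierInv_ae_eq (g : Lp ℂ 2 (volume : Measure (Euc n)))
    (hg : Integrable (g : Euc n → ℂ)) :
    ((𝓕⁻ g : Lp ℂ 2 (volume : Measure (Euc n))) : Euc n → ℂ) =ᵐ[volume]
      𝓕⁻ (g : Euc n → ℂ) := by
  have hcont : Continuous (𝓕⁻ (g : Euc n → ℂ)) := by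
    have h1 : Continuous (VectorFourier.fourierIntegral Real.fourierChar volume
        (-(innerₗ (Euc n))) (g : Euc n → ℂ)) := by
      apply VectorFourier.fourierIntegral_continuous Real.continuous_fourierChar _ hg
      exact continuous_inner.neg
    exact h1
  -- Both sides are compared against test functions: on L² the transform agrees with that of
  -- tempered distributions, and for the integral the transform moves to the test function by
  -- Fubini.
  refine ae_eq_of_integral_contDiff_smul_eq
    ((Lp.memLp _).locallyIntegrable (by norm_num)) hcont.locallyIntegrable ?_
  intro φ hφ hφc
  have hφ₁ : HasCompactSupport (Complex.ofRealCLM ∘ φ) := hφc.comp_left rfl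
  have hφ₂ : ContDiff ℝ (⊤ : ℕ∞) (Complex.ofRealCLM ∘ φ) := by fun_prop
  set Φ := hφ₁.toSchwartzMap hφ₂ with hΦ
  have hΦa : ∀ x, Φ x = (φ x : ℂ) := fun x => by simp [hΦ]
  have key := congrArg (fun T => T Φ) (Lp.fourierInv_toTemperedDistribution_eq g)
  simp only [TemperedDistribution.fourierInv_apply, Lp.toTemperedDistribution_apply] at key
  have hflip := VectorFourier.integral_fourierIntegral_smul_eq_flip (L := -innerₗ (Euc n))
    (μ := volume) (ν := volume) (f := Φ) (g := (g : Euc n → ℂ))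
    Real.continuous_fourierChar continuous_inner.neg Φ.integrable hg
  have hflip2 : ∫ x, (𝓕⁻ Φ) x • g x = ∫ x, Φ x • (𝓕⁻ (g : Euc n → ℂ)) x := by
    rw [SchwartzMap.fourierInv_coe]
    have h2 : (-innerₗ (Euc n)).flip = -innerₗ (Euc n) := by
      ext x y
      simp [real_inner_comm]
    rw [h2] at hflip
    exact hflip
  rw [hflip2] at key
  simp only [hΦa] at key
  simpa using key.symm

end FourierInv

/-! ### The character `x ↦ e^{2πix}` -/

/-- The character `e^{2πix}`, with complex values. -/
def unitExp (x : ℝ) : ℂ := Complex.exp (↑(2 * Real.pi * x) * Complex.I)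

lemma unitExp_add (x y : ℝ) : unitExp (x + y) = unitExp x * unitExp y := by
  rw [unitExp, unitExp, unitExp, ← Complex.exp_add]
  congr 1
  push_cast
  ring

@[simp]
lemma unitExp_zero : unitExp 0 = 1 := by simp [unitExp]

@[simp]
lemma norm_unitExp (x : ℝ) : ‖unitExp x‖ = 1 := Complex.norm_exp_ofReal_mul_I _

lemma continuous_unitExp : Continuous unitExp := by
  unfold unitExp
  fun_prop

lemma unitExp_sum {ι : Type*} (s : Finset ι) (f : ι → ℝ) :
    unitExp (∑ i ∈ s, f i) = ∏ i ∈ s, unitExp (f i) := by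
  classical
  induction s using Finset.induction_on with
  | empty => simp
  | insert a s ha ih => rw [Finset.sum_insert ha, Finset.prod_insert ha, unitExp_add, ih]

lemma conj_unitExp (x : ℝ) : (starRingEnd ℂ) (unitExp x) = unitExp (-x) := by
  rw [unitExp, unitExp, ← Complex.exp_conj, map_mul, Complex.conj_ofReal, Complex.conj_I]
  congr 1
  push_cast
  ring

lemma unitExp_int (m : ℤ) : unitExp m = 1 := by
  rw [unitExp, Complex.exp_eq_one_iff]
  exact ⟨m, by push_cast; ring⟩

lemma unitExp_half : unitExp (1 / 2) = -1 := by
  rw [unitExp, ← Complex.exp_pi_mul_I]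
  congr 1
  push_cast
  ring

lemma fourierInv_eq_integral_unitExp {n : ℕ} (f : Euc n → ℂ) (t : Euc n) :
    𝓕⁻ f t = ∫ s, unitExp ⟪s, t⟫ * f s := by
  rw [Real.fourierInv_eq']
  rfl

/-! ### Change of variables by powers of a matrix -/

section ChangeOfVariables

variable {n : ℕ} {A : Matrix (Fin n) (Fin n) ℝ}

lemma map_dil_volume (hA : IsUnit A.det) (m : ℤ) :
    Measure.map (dil A m) (volume : Measure (Euc n)) = ENNReal.ofReal (|A.det| ^ (-m)) • volume := by
  rw [Measure.map_linearMap_addHaar_eq_smul_addHaar _ (det_dil_ne_zero hA m), det_dil,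
    show (A ^ m).det = A.det ^ m from ?_, ← zpow_neg, abs_zpow]
  obtain ⟨k, rfl | rfl⟩ := m.eq_nat_or_neg
  · simp
  · rw [Matrix.zpow_neg hA, Matrix.det_nonsing_inv, Ring.inverse_eq_inv']
    simp

/-- The dilation by a power of an invertible matrix as a homeomorphism. -/
def dilHomeo (hA : IsUnit A.det) (m : ℤ) : Euc n ≃ₜ Euc n where
  toFun := dil A m
  invFun := dil A (-m)
  left_inv := dil_neg_dil hA m
  right_inv := dil_dil_neg hA m
  continuous_toFun := continuous_dil m
  continuous_invFun := continuous_dil (-m)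

lemma integral_comp_dil (hA : IsUnit A.det) (m : ℤ) (f : Euc n → ℂ) :
    ∫ x, f (dil A m x) = ((|A.det| ^ (-m) : ℝ) : ℂ) * ∫ x, f x := by
  have h := (dilHomeo hA m).measurableEmbedding.integral_map (μ := volume) f
  change ∫ y, f y ∂(Measure.map (dil A m) volume) = ∫ x, f (dil A m x) at h
  rw [← h, map_dil_volume hA, integral_smul_measure, ENNReal.toReal_ofReal (by positivity)]
  simp

lemma integrable_comp_dil (hA : IsUnit A.det) (m : ℤ) {f : Euc n → ℂ} (hf : Integrable f) :
    Integrable fun x => f (dil A m x) := by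
  have h := (dilHomeo hA m).measurableEmbedding.integrable_map_iff (μ := volume) (g := f)
  refine h.mp ?_
  change Integrable f (Measure.map (dil A m) volume)
  rw [map_dil_volume hA]
  exact hf.smul_measure ENNReal.ofReal_ne_top

lemma memLp_comp_dil (hA : IsUnit A.det) (m : ℤ) {f : Euc n → ℂ} (hf : MemLp f 2) :
    MemLp (fun x => f (dil A m x)) 2 := by
  have h := (dilHomeo hA m).measurableEmbedding.memLp_map_measure_iff (μ := volume) (p := 2) (g := f)
  refine h.mp ?_
  change MemLp f 2 (Measure.map (dil A m) volume)
  rw [map_dil_volume hA]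
  exact hf.smul_measure ENNReal.ofReal_ne_top

lemma quasiMeasurePreserving_dil (hA : IsUnit A.det) (m : ℤ) :
    Measure.QuasiMeasurePreserving (dil A m) (volume : Measure (Euc n)) volume :=
  quasiInvariant_dilHom hA (Multiplicative.ofAdd m)

lemma inner_dil_transpose (m : ℤ) (x y : Euc n) :
    ⟪dil A m x, y⟫ = ⟪x, dil A.transpose m y⟫ := by
  rw [dil, dil, ← Matrix.transpose_zpow]
  have h := LinearMap.adjoint_inner_right (Matrix.toEuclideanLin (A ^ m)) x y
  rw [← h, ← Matrix.toEuclideanLin_conjTranspose_eq_adjoint, Matrix.conjTranspose_eq_transpose_of_trivial]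

/-- The frequency side of the wavelet `|det A|^{m/2} ψ((Aᵀ)ᵐ t - γ)`. -/
def freqWavelet (A : Matrix (Fin n) (Fin n) ℝ) (m : ℤ) (γ : Euc n) (f : Euc n → ℂ) (s : Euc n) :
    ℂ :=
  ((|A.det| ^ (-(m : ℝ) / 2) : ℝ) : ℂ) *
    (unitExp (-⟪dil A (-m) s, γ⟫) * f (dil A (-m) s))

lemma integrable_fourierChar_mul {f : Euc n → ℂ} {l : Euc n → ℝ} (hl : Continuous l)
    (hf : Integrable f) : Integrable fun s => unitExp (l s) * f s := by
  refine hf.bdd_mul (c := 1) ?_ (Filter.Eventually.of_forall fun x => by simp)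
  exact (continuous_unitExp.comp hl).aestronglyMeasurable

lemma memLp_fourierChar_mul {f : Euc n → ℂ} {l : Euc n → ℝ} (hl : Continuous l)
    (hf : MemLp f 2) : MemLp (fun s => unitExp (l s) * f s) 2 := by
  refine hf.of_le ?_ (Filter.Eventually.of_forall fun x => by simp)
  exact (continuous_unitExp.comp hl).aestronglyMeasurable.mul
    hf.1

lemma continuous_inner_neg (γ : Euc n) : Continuous fun s : Euc n => -⟪s, γ⟫ := by fun_prop

lemma integrable_freqWavelet (hA : IsUnit A.det) (m : ℤ) (γ : Euc n) {f : Euc n → ℂ}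
    (hf : Integrable f) : Integrable (freqWavelet A m γ f) :=
  (integrable_comp_dil hA (-m)
    (integrable_fourierChar_mul (continuous_inner_neg γ) hf)).const_mul _

lemma memLp_freqWavelet (hA : IsUnit A.det) (m : ℤ) (γ : Euc n) {f : Euc n → ℂ}
    (hf : MemLp f 2) : MemLp (freqWavelet A m γ f) 2 :=
  (memLp_comp_dil hA (-m)
    (memLp_fourierChar_mul (continuous_inner_neg γ) hf)).const_mul _

/-- Substituting y for the dilated frequency contributes the Jacobian |det A|^m, which turns the
exponent -m/2 into m/2; the adjoint moves the dilation onto t as a power of the transpose. -/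
lemma fourierInv_freqWavelet (hA : IsUnit A.det) (m : ℤ) (γ : Euc n) (f : Euc n → ℂ) (t : Euc n) :
    𝓕⁻ (freqWavelet A m γ f) t = ((|A.det| ^ ((m : ℝ) / 2) : ℝ) : ℂ) *
      𝓕⁻ f (dil A.transpose m t - γ) := by
  have hpos : 0 < |A.det| := abs_pos.mpr hA.ne_zero
  rw [fourierInv_eq_integral_unitExp, fourierInv_eq_integral_unitExp]
  set F : Euc n → ℂ := fun y => ((|A.det| ^ (-(m : ℝ) / 2) : ℝ) : ℂ) *
    (unitExp ⟪y, dil A.transpose m t - γ⟫ * f y) with hF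
  have h1 : ∀ s, unitExp ⟪s, t⟫ * freqWavelet A m γ f s = F (dil A (-m) s) := by
    intro s
    have h2 : ⟪dil A (-m) s, dil A.transpose m t - γ⟫ = ⟪s, t⟫ + -⟪dil A (-m) s, γ⟫ := by
      rw [inner_sub_right, ← inner_dil_transpose, dil_dil_neg hA, sub_eq_add_neg]
    rw [hF]
    simp only [freqWavelet, h2, unitExp_add]
    ring
  simp_rw [h1]
  rw [integral_comp_dil hA, neg_neg, hF, integral_const_mul, ← mul_assoc, ← Complex.ofReal_mul]
  congr 3
  rw [← Real.rpow_intCast, ← Real.rpow_add hpos]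
  congr 1
  ring

end ChangeOfVariables

/-! ### Fourier series on a tile of a lattice -/

section Periodic

variable {n : ℕ} (b : Module.Basis (Fin n) ℝ (Euc n))

/-- The projection of `ℝⁿ` to the torus `ℝⁿ / Γ` in the coordinates of a basis of `Γ`. -/
def latticeTorusMap (x : Euc n) : UnitAddTorus (Fin n) := fun i => (b.repr x i : UnitAddCircle)

lemma continuous_latticeTorusMap : Continuous (latticeTorusMap b) := by
  refine continuous_pi fun i => ?_
  have h : Continuous fun x => b.repr x i :=
    (b.coord i).continuous_of_finiteDimensional
  exact (AddCircle.continuous_mk' 1).comp h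

lemma sub_mem_of_latticeTorusMap_eq {x y : Euc n} (h : latticeTorusMap b x = latticeTorusMap b y) :
    x - y ∈ Submodule.span ℤ (Set.range b) := by
  rw [mem_span_int_iff]
  intro i
  have h1 : ((b.repr x i : ℝ) : UnitAddCircle) = (b.repr y i : ℝ) := congrFun h i
  rw [← sub_eq_zero, ← AddCircle.coe_sub, AddCircle.coe_eq_zero_iff] at h1
  obtain ⟨z, hz⟩ := h1
  exact ⟨z, by simpa using hz.symm⟩

/-- The functional with prescribed integer values on a basis, as a dual lattice vector. -/
lemma exists_mem_dualLattice_inner (k : Fin n → ℤ) :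
    ∃ γ ∈ dualLattice (Submodule.span ℤ (Set.range b)), ∀ y, ⟪y, γ⟫ = ∑ i, k i * b.repr y i := by
  set l : Euc n →ₗ[ℝ] ℝ := ∑ i, (k i : ℝ) • b.coord i
  have hl : ∀ y, l y = ∑ i, k i * b.repr y i := fun y => by simp [l]
  have hγ : ∀ y, ⟪y, (InnerProductSpace.toDual ℝ (Euc n)).symm l.toContinuousLinearMap⟫
      = ∑ i, k i * b.repr y i := by
    intro y
    rw [real_inner_comm, InnerProductSpace.toDual_symm_apply]
    exact hl y
  refine ⟨_, ?_, hγ⟩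
  intro σ hσ
  rw [mem_span_int_iff] at hσ
  choose z hz using hσ
  refine ⟨∑ i, k i * z i, ?_⟩
  rw [real_inner_comm, hγ]
  push_cast
  exact Finset.sum_congr rfl fun i _ => by rw [hz]

lemma mFourier_latticeTorusMap (k : Fin n → ℤ) (y : Euc n) :
    UnitAddTorus.mFourier k (latticeTorusMap b y) = unitExp (∑ i, k i * b.repr y i) := by
  have h1 : ∀ i, fourier (k i) (latticeTorusMap b y i) = unitExp (k i * b.repr y i) := by
    intro i
    rw [latticeTorusMap, fourier_coe_apply, unitExp]
    congr 1
    push_cast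
    ring
  change ∏ i, fourier (k i) (latticeTorusMap b y i) = _
  rw [Finset.prod_congr rfl fun i _ => h1 i, unitExp_sum]

/-- Finite measures on the torus with the same Fourier coefficients are equal. -/
lemma UnitAddTorus.ext_of_integral_mFourier {d : Type*} [Fintype d]
    {μ ν : Measure (UnitAddTorus d)} [IsFiniteMeasure μ] [IsFiniteMeasure ν]
    (h : ∀ k : d → ℤ, ∫ x, UnitAddTorus.mFourier k x ∂μ = ∫ x, UnitAddTorus.mFourier k x ∂ν) :
    μ = ν := by
  -- Trigonometric polynomials form a point-separating star-algebra, so their integrals determine a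
  -- finite measure.
  let S : StarSubalgebra ℂ (BoundedContinuousFunction (UnitAddTorus d) ℂ) :=
    (UnitAddTorus.mFourierSubalgebra d).comap (BoundedContinuousFunction.toContinuousMapStarₐ ℂ)
  refine ext_of_forall_mem_subalgebra_integral_eq_of_pseudoEMetric_complete_countable
    (A := S) ?_ ?_
  · intro x y hxy
    obtain ⟨f, ⟨g, hg, rfl⟩, hf⟩ := UnitAddTorus.mFourierSubalgebra_separatesPoints hxy
    refine ⟨_, ⟨g, ⟨BoundedContinuousFunction.mkOfCompact g, hg, rfl⟩, rfl⟩, hf⟩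
  · intro g hg
    have hg' : (g : C(UnitAddTorus d, ℂ)) ∈
        Submodule.span ℂ (Set.range (UnitAddTorus.mFourier (d := d))) := by
      rw [← UnitAddTorus.mFourierSubalgebra_coe]
      exact hg
    have key : ∀ f : C(UnitAddTorus d, ℂ),
        f ∈ Submodule.span ℂ (Set.range (UnitAddTorus.mFourier (d := d))) →
        ∫ x, f x ∂μ = ∫ x, f x ∂ν := by
      intro f hf
      have hint : ∀ (f : C(UnitAddTorus d, ℂ)) (μ : Measure (UnitAddTorus d)) [IsFiniteMeasure μ],
          Integrable f μ := fun f μ _ =>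
        f.continuous.integrable_of_hasCompactSupport (HasCompactSupport.of_compactSpace _)
      induction hf using Submodule.span_induction with
      | mem f hf => obtain ⟨k, rfl⟩ := hf; exact h k
      | zero => simp
      | add f g _ _ hf hg =>
        simp only [ContinuousMap.add_apply]
        rw [integral_add (hint f μ) (hint g μ), integral_add (hint f ν) (hint g ν), hf, hg]
      | smul c f _ hf =>
        simp only [ContinuousMap.smul_apply]
        rw [integral_smul, integral_smul, hf]
    exact key _ hg'

/-- An essential tile for the translations of a lattice contains a conull part on which different
points are not congruent modulo the lattice. -/
lemma EssTile.exists_injOn {W : Set (Euc n)} (hWm : MeasurableSet W)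
    (hW : EssTile (isoHom (transSub (Submodule.span ℤ (Set.range b)))) W) :
    ∃ W₀ ⊆ W, MeasurableSet W₀ ∧ volume (W \ W₀) = 0 ∧ Set.InjOn (latticeTorusMap b) W₀ := by
  set Γ := Submodule.span ℤ (Set.range b)
  have hp : ∀ᵐ x, x ∈ W → ∀ v ∈ Γ, v ≠ 0 → x + v ∉ W := by
    filter_upwards [hW] with x hx hxW v hv hv0 hxv
    have h := hx.unique (y₁ := ⟨transl v, transl_mem_transSub.mpr hv⟩) (y₂ := 1)
      (by simpa [isoHom_apply, transl_apply] using hxv) (by simpa [isoHom_apply] using hxW)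
    have h2 : transl v = (1 : Euc n ≃ᵢ Euc n) := congrArg Subtype.val h
    rw [← transl_zero] at h2
    exact hv0 (transl_injective h2)
  obtain ⟨N, hN, hNm, hN0⟩ := exists_measurable_superset_of_null (ae_iff.mp hp)
  refine ⟨W \ N, Set.sdiff_subset, hWm.diff hNm, ?_, ?_⟩
  · refine measure_mono_null ?_ hN0
    intro x hx
    by_contra hxN
    exact hx.2 ⟨hx.1, hxN⟩
  · intro x hx y hy hxy
    by_contra hne
    have h1 := sub_mem_of_latticeTorusMap_eq b hxy
    have h2 : y ∈ W → ∀ v ∈ Γ, v ≠ 0 → y + v ∉ W := by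
      by_contra hcon
      exact hy.2 (hN hcon)
    exact h2 hy.1 _ h1 (sub_ne_zero.mpr hne) (by simpa using hx.1)

end Periodic

/-! ### Characters of the dual lattice on a tile -/

section Tile

variable {n : ℕ} (b : Module.Basis (Fin n) ℝ (Euc n))

/-- Push the positive and the negative part of h on W to the torus. The two measures have the same
Fourier coefficients, so they are equal. The projection is injective on a conull part of W, so the
parts already agree there; having disjoint supports, both vanish. -/
lemma ae_eq_zero_of_integral_unitExp_real {W : Set (Euc n)} (hWm : MeasurableSet W)
    (hW : EssTile (isoHom (transSub (Submodule.span ℤ (Set.range b)))) W) {h : Euc n → ℝ}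
    (hm : Measurable h) (hi : IntegrableOn h W)
    (h0 : ∀ γ ∈ dualLattice (Submodule.span ℤ (Set.range b)),
      ∫ y in W, unitExp ⟪y, γ⟫ * (h y : ℂ) = 0) :
    ∀ᵐ y, y ∈ W → h y = 0 := by
  have hTm : Measurable (latticeTorusMap b) := (continuous_latticeTorusMap b).measurable
  set ν : (Euc n → ℝ) → Measure (Euc n) := fun h =>
    (volume.restrict W).withDensity fun y => ENNReal.ofReal (h y) with hν
  have hfin : ∀ h : Euc n → ℝ, IntegrableOn h W → IsFiniteMeasure (ν h) := fun h hi =>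
    isFiniteMeasure_withDensity_ofReal hi.2
  have hf1 := hfin h hi
  have hf2 := hfin (fun y => -h y) hi.neg
  have hint : ∀ h : Euc n → ℝ, Measurable h → ∀ k : Fin n → ℤ,
      ∫ x, UnitAddTorus.mFourier k x ∂((ν h).map (latticeTorusMap b)) =
        ∫ y in W, ((max (h y) 0 : ℝ) : ℂ) * unitExp (∑ i, k i * b.repr y i) := by
    intro h hm k
    rw [integral_map hTm.aemeasurable
      (UnitAddTorus.mFourier k).continuous.aestronglyMeasurable]
    rw [hν]
    simp only
    rw [integral_withDensity_eq_integral_toReal_smul hm.ennreal_ofReal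
      (Filter.Eventually.of_forall fun _ => ENNReal.ofReal_lt_top)]
    simp only [mFourier_latticeTorusMap, ENNReal.toReal_ofReal', Complex.real_smul]
  have heq : (ν h).map (latticeTorusMap b) = (ν fun y => -h y).map (latticeTorusMap b) := by
    refine UnitAddTorus.ext_of_integral_mFourier fun k => ?_
    rw [hint h hm, hint (fun y => -h y) hm.neg, ← sub_eq_zero]
    have hi' : ∀ h : Euc n → ℝ, IntegrableOn h W → IntegrableOn (fun y =>
        ((max (h y) 0 : ℝ) : ℂ) * unitExp (∑ i, k i * b.repr y i)) W := by
      intro h hi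
      have hc : Continuous fun y => unitExp (∑ i, k i * b.repr y i) := by
        refine continuous_unitExp.comp (continuous_finsetSum _ fun i _ => ?_)
        exact continuous_const.mul (b.coord i).continuous_of_finiteDimensional
      exact hi.pos_part.ofReal.mul_bdd (c := 1) hc.aestronglyMeasurable
        (Filter.Eventually.of_forall fun y => by simp)
    rw [← integral_sub (hi' h hi) (hi' (fun y => -h y) hi.neg)]
    obtain ⟨γ, hγ, hγy⟩ := exists_mem_dualLattice_inner b k
    rw [← h0 γ hγ]
    congr 1
    ext y
    rw [hγy, ← sub_mul, ← Complex.ofReal_sub, mul_comm]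
    congr 2
    rcases le_total (h y) 0 with h | h
    · simp [max_eq_right h, max_eq_left (neg_nonneg.mpr h)]
    · simp [max_eq_left h, max_eq_right (neg_nonpos.mpr h)]
  obtain ⟨W₀, hsub, hW₀m, hnull, hinj⟩ := hW.exists_injOn b hWm
  have hmeas : ∀ E ⊆ W₀, MeasurableSet E → ν h E = ν (fun y => -h y) E := by
    intro E hE hEm
    have hTE := hEm.image_of_measurable_injOn hTm (hinj.mono hE)
    have h1 : ∀ h : Euc n → ℝ, (ν h).map (latticeTorusMap b) (latticeTorusMap b '' E) = ν h E := by
      intro h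
      rw [Measure.map_apply hTm hTE]
      refine measure_congr ?_
      have h2 : ∀ᵐ y ∂(ν h), y ∈ W₀ := by
        refine (withDensity_absolutelyContinuous _ _).ae_le ?_
        change ∀ᵐ y ∂(volume.restrict W), y ∈ W₀
        rw [ae_restrict_iff' hWm, ae_iff]
        refine measure_mono_null ?_ hnull
        intro y hy
        simpa using hy
      filter_upwards [h2] with y hy
      refine propext ⟨?_, fun h => ⟨y, h, rfl⟩⟩
      rintro ⟨z, hz, hzy⟩
      rw [← hinj (hE hz) hy hzy]
      exact hz
    rw [← h1 h, ← h1, heq]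
  -- On the set where h is positive the negative part has measure zero, so the positive part has
  -- too.
  have hhalf : ∀ h : Euc n → ℝ, Measurable h →
      (∀ E ⊆ W₀, MeasurableSet E → ν h E = ν (fun y => -h y) E) →
      volume (W₀ ∩ {y | 0 < h y}) = 0 := by
    intro h hm hE
    have hEm : MeasurableSet (W₀ ∩ {y | 0 < h y}) := hW₀m.inter (hm measurableSet_Ioi)
    have h3 := hE _ Set.inter_subset_left hEm
    have h4 : ν (fun y => -h y) (W₀ ∩ {y | 0 < h y}) = 0 := by
      rw [hν]
      simp only
      rw [withDensity_apply _ hEm, setLIntegral_eq_zero_iff hEm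
        (f := fun y => ENNReal.ofReal (-h y)) hm.neg.ennreal_ofReal]
      refine Filter.Eventually.of_forall fun y hy => ?_
      simpa using hy.2.le
    rw [h4, hν] at h3
    simp only at h3
    rw [withDensity_apply _ hEm, setLIntegral_eq_zero_iff hEm hm.ennreal_ofReal] at h3
    rw [ae_restrict_iff' hWm, ae_iff] at h3
    refine measure_mono_null ?_ h3
    intro y hy
    simpa using ⟨⟨hsub hy.1, hy.1⟩, hsub hy.1, hy.2⟩
  have hA := hhalf h hm hmeas
  have hB := hhalf (fun y => -h y) hm.neg (fun E hE hEm => by simpa using (hmeas E hE hEm).symm)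
  rw [ae_iff]
  refine measure_mono_null ?_ (measure_union_null hnull (measure_union_null hA hB))
  intro y hy
  simp only [Classical.not_imp, Set.mem_ofPred_eq] at hy
  by_cases hy0 : y ∈ W₀
  · right
    rcases lt_or_gt_of_ne hy.2 with h | h
    · exact Or.inr ⟨hy0, by simpa using h⟩
    · exact Or.inl ⟨hy0, h⟩
  · exact Or.inl ⟨hy.1, hy0⟩

/-- A function on a tile of a lattice is determined by its coefficients with respect to the
characters given by the dual lattice. -/
lemma ae_eq_zero_of_integral_unitExp {W : Set (Euc n)} (hWm : MeasurableSet W)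
    (hW : EssTile (isoHom (transSub (Submodule.span ℤ (Set.range b)))) W) {h : Euc n → ℂ}
    (hm : Measurable h) (hi : IntegrableOn h W)
    (h0 : ∀ γ ∈ dualLattice (Submodule.span ℤ (Set.range b)),
      ∫ y in W, unitExp ⟪y, γ⟫ * h y = 0) :
    ∀ᵐ y, y ∈ W → h y = 0 := by
  have hconj : ∀ γ ∈ dualLattice (Submodule.span ℤ (Set.range b)),
      ∫ y in W, unitExp ⟪y, γ⟫ * (starRingEnd ℂ) (h y) = 0 := by
    intro γ hγ
    have h1 := congrArg (starRingEnd ℂ) (h0 (-γ) (neg_mem hγ))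
    rw [← integral_conj, map_zero] at h1
    rw [← h1]
    congr 1
    ext y
    rw [map_mul, conj_unitExp, inner_neg_right, neg_neg]
  have hint : ∀ (γ : Euc n) {f : Euc n → ℂ}, IntegrableOn f W →
      IntegrableOn (fun y => unitExp ⟪y, γ⟫ * f y) W := by
    intro γ f hf
    refine hf.bdd_mul (c := 1) ?_ (Filter.Eventually.of_forall fun y => by simp)
    exact (continuous_unitExp.comp (by fun_prop)).aestronglyMeasurable
  have hic : IntegrableOn (fun y => (starRingEnd ℂ) (h y)) W :=
    (Complex.conjCLE.toContinuousLinearMap.integrable_comp hi)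
  have hre : ∀ᵐ y, y ∈ W → (h y).re = 0 := by
    refine ae_eq_zero_of_integral_unitExp_real b hWm hW (Complex.measurable_re.comp hm) hi.re ?_
    intro γ hγ
    have h1 : ∀ y, unitExp ⟪y, γ⟫ * (((h y).re : ℝ) : ℂ) = (1 / 2 : ℂ) *
        (unitExp ⟪y, γ⟫ * h y + unitExp ⟪y, γ⟫ * (starRingEnd ℂ) (h y)) := by
      intro y
      rw [Complex.re_eq_add_conj]
      ring
    simp_rw [h1]
    rw [integral_const_mul, integral_add (hint γ hi) (hint γ hic), h0 γ hγ, hconj γ hγ]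
    simp
  have him : ∀ᵐ y, y ∈ W → (h y).im = 0 := by
    refine ae_eq_zero_of_integral_unitExp_real b hWm hW (Complex.measurable_im.comp hm) hi.im ?_
    intro γ hγ
    have h1 : ∀ y, unitExp ⟪y, γ⟫ * (((h y).im : ℝ) : ℂ) = (1 / (2 * Complex.I) : ℂ) *
        (unitExp ⟪y, γ⟫ * h y - unitExp ⟪y, γ⟫ * (starRingEnd ℂ) (h y)) := by
      intro y
      rw [Complex.im_eq_sub_conj]
      ring
    simp_rw [h1]
    rw [integral_const_mul, integral_sub (hint γ hi) (hint γ hic), h0 γ hγ, hconj γ hγ]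
    simp
  filter_upwards [hre, him] with y h1 h2 hy
  exact Complex.ext (h1 hy) (h2 hy)

/-- An essential tile for the translations of a lattice is a fundamental domain. -/
lemma EssTile.isAddFundamentalDomain {Γ : Submodule ℤ (Euc n)} [Countable Γ] {W : Set (Euc n)}
    (hWm : MeasurableSet W) (hW : EssTile (isoHom (transSub Γ)) W) :
    IsAddFundamentalDomain Γ W volume := by
  have hp : ∀ᵐ x, ∃! v : Γ, (v : Euc n) + x ∈ W := by
    filter_upwards [hW] with x hx
    obtain ⟨g, hg, hgu⟩ := hx
    obtain ⟨v, rfl⟩ := (transEquiv Γ).surjective g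
    have hc : ∀ v : Γ, isoHom (transSub Γ) (transEquiv Γ v) x = (v : Euc n) + x := fun v =>
      add_comm _ _
    simp only [hc] at hg
    refine ⟨v, hg, fun w hw => ?_⟩
    exact (transEquiv Γ).injective (hgu _ (by simpa only [hc] using hw))
  refine IsAddFundamentalDomain.mk'' hWm.nullMeasurableSet (hp.mono fun x hx => hx.exists) ?_ ?_
  · intro v hv
    rw [AEDisjoint, measure_eq_zero_iff_ae_notMem]
    filter_upwards [hp] with x hx hxW
    obtain ⟨⟨y, hy, hyx⟩, hxW⟩ := hxW
    have h1 : (v : Euc n) + y = x := hyx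
    have := hx.unique (y₁ := 0) (y₂ := -v) (by simpa using hxW) (by simpa [← h1] using hy)
    exact hv (by simpa using this.symm)
  · intro v
    exact (measurePreserving_add_left volume (v : Euc n)).quasiMeasurePreserving

/-- The nontrivial characters given by the dual lattice have mean zero on a tile of a lattice. -/
lemma integral_unitExp_eq_zero {Γ : Submodule ℤ (Euc n)} [Countable Γ] {W : Set (Euc n)}
    (hWm : MeasurableSet W) (hW : EssTile (isoHom (transSub Γ)) W) {γ : Euc n}
    (hγ : γ ∈ dualLattice Γ) (hγ0 : γ ≠ 0) : ∫ y in W, unitExp ⟪y, γ⟫ = 0 := by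
  have hF := hW.isAddFundamentalDomain hWm
  have : VAddInvariantMeasure Γ (Euc n) volume :=
    inferInstanceAs (VAddInvariantMeasure Γ.toAddSubgroup (Euc n) volume)
  have : MeasurableConstVAdd Γ (Euc n) :=
    inferInstanceAs (MeasurableConstVAdd Γ.toAddSubgroup (Euc n))
  -- Translation by t changes the sign of the character, while W and its translate are both
  -- fundamental domains; the integral equals its own negative.
  set t : Euc n := (1 / 2 * (⟪γ, γ⟫)⁻¹ : ℝ) • γ
  have ht : ⟪t, γ⟫ = 1 / 2 := by
    have h1 : (⟪γ, γ⟫ : ℝ) ≠ 0 := inner_self_ne_zero.mpr hγ0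
    simp only [t, real_inner_smul_left]
    field_simp
  have h1 : ∫ y in W, unitExp ⟪y, γ⟫ = ∫ y in t +ᵥ W, unitExp ⟪y, γ⟫ := by
    refine hF.setIntegral_eq (hF.vadd_of_comm t) ?_
    intro v y
    obtain ⟨m, hm⟩ := hγ v v.2
    change unitExp ⟪(v : Euc n) + y, γ⟫ = _
    rw [inner_add_left, real_inner_comm, hm, unitExp_add, unitExp_int, one_mul]
  have h2 : ∫ y in t +ᵥ W, unitExp ⟪y, γ⟫ = ∫ y in W, unitExp ⟪t + y, γ⟫ := by
    have := (measurePreserving_add_left volume t).setIntegral_image_emb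
      (measurableEmbedding_addLeft t) (fun y => unitExp ⟪y, γ⟫) W
    exact this
  simp_rw [inner_add_left, ht, unitExp_add, unitExp_half] at h2
  rw [integral_const_mul, ← h1] at h2
  have h3 : (2 : ℂ) * ∫ y in W, unitExp ⟪y, γ⟫ = 0 := by linear_combination h2
  simpa using h3

end Tile

/-! ### Common tiles of a lattice and of dilations are wavelet sets -/

section Wavelet

variable {n : ℕ} {A : Matrix (Fin n) (Fin n) ℝ} {W : Set (Euc n)}

lemma EssTile.volume_ne_zero {X G : Type*} [MeasureSpace X] [Group G] [Countable G]
    [NeZero (volume : Measure X)]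
    {φ : G →* Equiv.Perm X} (hφ : QuasiInvariant φ) {W : Set X} (hW : EssTile φ W) :
    volume W ≠ 0 := by
  intro h0
  have h1 : ∀ᵐ x : X, x ∉ W := measure_eq_zero_iff_ae_notMem.mp h0
  have h2 : ∀ᵐ x : X, False := by
    filter_upwards [hW, hφ.ae_forall h1] with x hx hx'
    obtain ⟨g, hg, -⟩ := hx
    exact hx' g hg
  rw [Filter.eventually_false_iff_eq_bot, ae_eq_bot] at h2
  exact NeZero.ne _ h2

/-- The frequency side of the wavelets, as square-integrable functions. -/
def freqWaveletLp (hA : IsUnit A.det) {f : Euc n → ℂ} (hf : MemLp f 2) (m : ℤ) (γ : Euc n) :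
    Lp ℂ 2 (volume : Measure (Euc n)) :=
  (memLp_freqWavelet hA m γ hf).toLp _

lemma coeFn_freqWaveletLp (hA : IsUnit A.det) {f : Euc n → ℂ} (hf : MemLp f 2) (m : ℤ)
    (γ : Euc n) : freqWaveletLp hA hf m γ =ᵐ[volume] freqWavelet A m γ f :=
  (memLp_freqWavelet hA m γ hf).coeFn_toLp

/-- For f a multiple of the indicator of W, this makes the inner product a Fourier coefficient over
W of h rescaled by the m-th power; orthonormality and totality thereby reduce to characters on W. -/
lemma inner_freqWaveletLp (hA : IsUnit A.det) (m : ℤ) (γ : Euc n) {f : Euc n → ℂ}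
    (hf : MemLp f 2) (h : Lp ℂ 2 (volume : Measure (Euc n))) :
    inner ℂ (freqWaveletLp hA hf m γ) h = ((|A.det| ^ ((m : ℝ) / 2) : ℝ) : ℂ) *
        ∫ y, unitExp ⟪y, γ⟫ * ((starRingEnd ℂ) (f y) * h (dil A m y)) := by
  have hpos : 0 < |A.det| := abs_pos.mpr hA.ne_zero
  rw [L2.inner_def]
  set K : Euc n → ℂ := fun y => ((|A.det| ^ (-(m : ℝ) / 2) : ℝ) : ℂ) *
    (unitExp ⟪y, γ⟫ * ((starRingEnd ℂ) (f y) * h (dil A m y))) with hK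
  have h1 : ∫ x, inner ℂ (freqWaveletLp hA hf m γ x) (h x) = ∫ x, K (dil A (-m) x) := by
    refine integral_congr_ae ?_
    filter_upwards [coeFn_freqWaveletLp hA hf m γ] with x hx
    rw [hx, RCLike.inner_apply, hK]
    simp only [freqWavelet, map_mul, conj_unitExp, neg_neg, dil_dil_neg hA, Complex.conj_ofReal]
    ring
  rw [h1, integral_comp_dil hA, neg_neg, hK, integral_const_mul, ← mul_assoc, ← Complex.ofReal_mul]
  congr 3
  rw [← Real.rpow_intCast, ← Real.rpow_add hpos]
  congr 1
  ring

lemma fourierInv_congr_ae {f g : Euc n → ℂ} (h : f =ᵐ[volume] g) : 𝓕⁻ f = 𝓕⁻ g := by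
  ext t
  rw [fourierInv_eq_integral_unitExp, fourierInv_eq_integral_unitExp]
  refine integral_congr_ae ?_
  filter_upwards [h] with x hx
  rw [hx]

lemma integral_mul_indicator_const (hWm : MeasurableSet W) (κ : ℂ) (g h : Euc n → ℂ) :
    ∫ y, g y * ((starRingEnd ℂ) (W.indicator (fun _ => κ) y) * h y) =
      (starRingEnd ℂ) κ * ∫ y in W, g y * h y := by
  rw [← integral_indicator hWm, ← integral_const_mul]
  congr 1
  ext y
  by_cases hy : y ∈ W
  · simp only [Set.indicator_of_mem hy]
    ring
  · simp [Set.indicator_of_notMem hy]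

/-- The frequency side of the wavelets of a wavelet set is orthonormal. -/
lemma orthonormal_freqWaveletLp {Γ : Submodule ℤ (Euc n)} [Countable Γ]
    (hA : IsUnit A.det) (hWm : MeasurableSet W) (hΓ : EssTile (isoHom (transSub Γ)) W)
    (hD : EssTile (dilHom hA) W) {κ : ℂ} (hκ : (starRingEnd ℂ) κ * (κ * (volume.real W : ℂ)) = 1)
    (hfL : MemLp (W.indicator fun _ => κ) 2 (volume : Measure (Euc n))) :
    Orthonormal ℂ fun p : ℤ × dualLattice Γ => freqWaveletLp hA hfL p.1 (p.2 : Euc n) := by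
  classical
  have hpos : 0 < |A.det| := abs_pos.mpr hA.ne_zero
  rw [orthonormal_iff_ite]
  rintro ⟨m, γ⟩ ⟨m', γ'⟩
  rw [inner_freqWaveletLp, integral_mul_indicator_const hWm]
  have hae : ∀ᵐ y, freqWaveletLp hA hfL m' (γ' : Euc n) (dil A m y) =
      freqWavelet A m' γ' (W.indicator fun _ => κ) (dil A m y) :=
    (quasiMeasurePreserving_dil hA m).ae (coeFn_freqWaveletLp hA hfL m' γ')
  -- On one scale the inner product is a multiple of the mean of a character over W; on different
  -- scales the dilates of W are almost disjoint.
  by_cases hm : m = m'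
  · subst hm
    have h1 : ∫ y in W, unitExp ⟪y, (γ : Euc n)⟫ *
        freqWaveletLp hA hfL m (γ' : Euc n) (dil A m y) =
        ((|A.det| ^ (-(m : ℝ) / 2) : ℝ) : ℂ) * κ *
          ∫ y in W, unitExp ⟪y, (γ : Euc n) - γ'⟫ := by
      rw [← integral_const_mul]
      refine setIntegral_congr_ae hWm ?_
      filter_upwards [hae] with y hy hyW
      rw [hy, freqWavelet, dil_neg_dil hA, Set.indicator_of_mem hyW, inner_sub_right,
        sub_eq_add_neg, unitExp_add]
      ring
    rw [h1]
    have h2 : ((|A.det| ^ ((m : ℝ) / 2) : ℝ) : ℂ) * ((|A.det| ^ (-(m : ℝ) / 2) : ℝ) : ℂ) = 1 := by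
      rw [← Complex.ofReal_mul, ← Real.rpow_add hpos, ← add_div, add_neg_cancel]
      simp
    by_cases hγ : γ = γ'
    · subst hγ
      simp only [sub_self, inner_zero_right, unitExp_zero, if_true]
      rw [setIntegral_const, Complex.real_smul, mul_one]
      linear_combination ((starRingEnd ℂ) κ * (κ * (volume.real W : ℂ))) * h2 + hκ
    · have h3 : (γ : Euc n) - γ' ≠ 0 := sub_ne_zero.mpr fun h => hγ (Subtype.ext h)
      rw [integral_unitExp_eq_zero hWm hΓ (sub_mem γ.2 γ'.2) h3, if_neg (by simpa using hγ)]
      simp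
  · rw [if_neg (by simpa using fun h => absurd h hm)]
    have h1 : ∫ y in W, unitExp ⟪y, (γ : Euc n)⟫ *
        freqWaveletLp hA hfL m' (γ' : Euc n) (dil A m y) = ∫ y in W, (0 : ℂ) := by
      refine setIntegral_congr_ae hWm ?_
      filter_upwards [hae, hD] with y hy hyD hyW
      have h2 : dil A (-m') (dil A m y) ∉ W := by
        intro hcon
        rw [← dil_add hA] at hcon
        have := hyD.unique (y₁ := Multiplicative.ofAdd (-m' + m)) (y₂ := 1) hcon
          (by simpa using hyW)
        have h3 : -m' + m = 0 := this
        exact hm (by omega)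
      rw [hy, freqWavelet, Set.indicator_of_notMem h2]
      simp
    rw [h1]
    simp

/-- The frequency side of the wavelets of a wavelet set is total. -/
lemma orthogonal_span_freqWaveletLp (b : Module.Basis (Fin n) ℝ (Euc n))
    (hA : IsUnit A.det) (hWm : MeasurableSet W) (hfin : volume W ≠ ⊤)
    (hΓ : EssTile (isoHom (transSub (Submodule.span ℤ (Set.range b)))) W)
    (hD : EssTile (dilHom hA) W) {κ : ℂ} (hκ : κ ≠ 0)
    (hfL : MemLp (W.indicator fun _ => κ) 2 (volume : Measure (Euc n))) :
    (Submodule.span ℂ (Set.range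
      fun p : ℤ × dualLattice (Submodule.span ℤ (Set.range b)) =>
        freqWaveletLp hA hfL p.1 (p.2 : Euc n)))ᗮ = ⊥ := by
  have hpos : 0 < |A.det| := abs_pos.mpr hA.ne_zero
  rw [Submodule.eq_bot_iff]
  intro h hh
  -- All characters annihilate h on the m-th dilate of W, so h vanishes there; these dilates cover
  -- almost everything.
  have h1 : ∀ m : ℤ, ∀ᵐ y, y ∈ W → h (dil A m y) = 0 := by
    intro m
    refine ae_eq_zero_of_integral_unitExp b hWm hΓ
      ((Lp.stronglyMeasurable h).measurable.comp (continuous_dil m).measurable) ?_ ?_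
    · have : IsFiniteMeasure (volume.restrict W) := isFiniteMeasure_restrict.mpr hfin
      exact ((memLp_comp_dil hA m (Lp.memLp h)).restrict W).integrable one_le_two
    · intro γ hγ
      have h2 := (Submodule.mem_orthogonal _ _).mp hh _
        (Submodule.subset_span ⟨(m, ⟨γ, hγ⟩), rfl⟩)
      rw [inner_freqWaveletLp, integral_mul_indicator_const hWm] at h2
      have h3 : ((|A.det| ^ ((m : ℝ) / 2) : ℝ) : ℂ) ≠ 0 :=
        Complex.ofReal_ne_zero.mpr (Real.rpow_pos_of_pos hpos _).ne'
      have h4 : (starRingEnd ℂ) κ ≠ 0 := (map_ne_zero _).mpr hκ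
      simpa [h3, h4] using h2
  have h5 : ∀ᵐ x, ∀ m : ℤ, dil A (-m) x ∈ W → h x = 0 := by
    rw [ae_all_iff]
    intro m
    filter_upwards [(quasiMeasurePreserving_dil hA (-m)).ae (h1 m)] with x hx hxW
    have := hx hxW
    rwa [dil_dil_neg hA] at this
  rw [Lp.eq_zero_iff_ae_eq_zero]
  filter_upwards [h5, hD] with x hx hxD
  obtain ⟨g, hg, -⟩ := hxD
  refine hx (-g.toAdd) ?_
  rw [neg_neg]
  exact hg

/-- A set of finite measure that tiles under the powers of `A` and under the translations of a
lattice is a dilation-translation wavelet set. -/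
theorem isDilationTranslationWaveletSet_of_essTile (b : Module.Basis (Fin n) ℝ (Euc n))
    (hA : IsUnit A.det) (hWm : MeasurableSet W) (hfin : volume W ≠ ⊤)
    (hΓ : EssTile (isoHom (transSub (Submodule.span ℤ (Set.range b)))) W)
    (hD : EssTile (dilHom hA) W) :
    IsDilationTranslationWaveletSet A (Submodule.span ℤ (Set.range b)) W := by
  have hW0 : 0 < volume.real W :=
    ENNReal.toReal_pos (hD.volume_ne_zero (quasiInvariant_dilHom hA)) hfin
  obtain ⟨κ, hκ⟩ : ∃ κ : ℂ, κ = (((Real.sqrt (volume.real W))⁻¹ : ℝ) : ℂ) := ⟨_, rfl⟩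
  have hκ0 : κ ≠ 0 := by
    rw [hκ, Complex.ofReal_ne_zero]
    exact inv_ne_zero (Real.sqrt_ne_zero'.mpr hW0)
  have hκ2 : (starRingEnd ℂ) κ * (κ * (volume.real W : ℂ)) = 1 := by
    rw [hκ, Complex.conj_ofReal, ← Complex.ofReal_mul, ← Complex.ofReal_mul, ← Complex.ofReal_one]
    congr 1
    have := Real.mul_self_sqrt hW0.le
    have h2 := Real.sqrt_ne_zero'.mpr hW0
    field_simp
    linarith
  have hfL : MemLp (W.indicator fun _ => κ) 2 (volume : Measure (Euc n)) :=
    memLp_indicator_const 2 hWm κ (Or.inr hfin)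
  have hfI : Integrable (W.indicator fun _ => κ) (volume : Measure (Euc n)) :=
    memLp_one_iff_integrable.mp (memLp_indicator_const 1 hWm κ (Or.inr hfin))
  let B := HilbertBasis.mkOfOrthogonalEqBot (orthonormal_freqWaveletLp hA hWm hΓ hD hκ2 hfL)
    (orthogonal_span_freqWaveletLp b hA hWm hfin hΓ hD hκ0 hfL)
  have hB : ∀ p, B p = freqWaveletLp hA hfL p.1 (p.2 : Euc n) := fun p =>
    congrFun (HilbertBasis.coe_mkOfOrthogonalEqBot _ _) p
  -- The representation is composed with the unitary Fourier transform, so the basis vectors are the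
  -- inverse transforms of those of B.
  refine ⟨hWm, hfin, HilbertBasis.ofRepr ((Lp.fourierTransformₗᵢ (Euc n) ℂ).trans B.repr), ?_⟩
  intro m γ
  have h1 : (HilbertBasis.ofRepr ((Lp.fourierTransformₗᵢ (Euc n) ℂ).trans B.repr)) (m, γ) =
      (𝓕⁻ (freqWaveletLp hA hfL m (γ : Euc n)) : Lp ℂ 2 (volume : Measure (Euc n))) :=
    congrArg (Lp.fourierTransformₗᵢ (Euc n) ℂ).symm (hB (m, γ))
  rw [h1, ← hκ, Matrix.det_transpose]
  have h2 := coe_fourierInv_ae_eq (freqWaveletLp hA hfL m (γ : Euc n))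
    ((integrable_congr (coeFn_freqWaveletLp hA hfL m γ)).mpr (integrable_freqWavelet hA m γ hfI))
  have h3 : (indicatorConstLp 2 hWm hfin κ : Euc n → ℂ) =ᵐ[volume] W.indicator fun _ => κ :=
    indicatorConstLp_coeFn
  have h4 := coe_fourierInv_ae_eq (indicatorConstLp 2 hWm hfin κ) ((integrable_congr h3).mpr hfI)
  have hAt : IsUnit A.transpose.det := by rwa [Matrix.det_transpose]
  have h5 : Measure.QuasiMeasurePreserving
      (fun t => dil A.transpose m t - (γ : Euc n)) volume volume :=
    (measurePreserving_sub_right volume (γ : Euc n)).quasiMeasurePreserving.comp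
      (quasiMeasurePreserving_dil hAt m)
  filter_upwards [h2, h5.ae h4] with t ht ht'
  rw [ht, fourierInv_congr_ae (coeFn_freqWaveletLp hA hfL m γ), fourierInv_freqWavelet hA]
  rw [fourierInv_congr_ae h3] at ht'
  rw [← ht']
  rfl

end Wavelet

/-! ### Similarities and polyhedra -/

section Similarity

variable {n : ℕ}

/-- The similarity with ratio `r`, linear part `L` and translation part `v`. -/
def simMap (r : ℝ) (L : Euc n ≃ₗᵢ[ℝ] Euc n) (v : Euc n) (x : Euc n) : Euc n := r • L x + v

/-- Dividing a dilation by its ratio leaves an isometry, whose linear part is L. -/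
lemma exists_eq_simMap (d : Euc n ≃ᵈ Euc n) :
    ∃ (r : ℝ) (L : Euc n ≃ₗᵢ[ℝ] Euc n) (v : Euc n), 0 < r ∧ ∀ x, d x = simMap r L v x := by
  have hr : (0 : ℝ) < Dilation.ratio d := Dilation.ratio_pos d
  have hrd : ∀ x y, dist (d x) (d y) = (Dilation.ratio d : ℝ) * dist x y := Dilation.dist_eq d
  generalize (Dilation.ratio d : ℝ) = r at hr hrd
  let g : Euc n ≃ᵢ Euc n :=
    { toFun := fun x => r⁻¹ • d x
      invFun := fun y => d.symm (r • y)
      left_inv := fun x => by simp [smul_smul, hr.ne']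
      right_inv := fun y => by simp [smul_smul, hr.ne']
      isometry_toFun := Isometry.of_dist_eq fun x y => by
        rw [dist_smul₀, hrd, norm_inv, Real.norm_of_nonneg hr.le, ← mul_assoc,
          inv_mul_cancel₀ hr.ne', one_mul] }
  refine ⟨r, linPart g, d 0, hr, fun x => ?_⟩
  rw [simMap, linPart_apply]
  change d x = r • (r⁻¹ • d x - r⁻¹ • d 0) + d 0
  rw [smul_sub, smul_smul, smul_smul, mul_inv_cancel₀ hr.ne', one_smul, one_smul, sub_add_cancel]

lemma simMap_comp (r r' : ℝ) (L L' : Euc n ≃ₗᵢ[ℝ] Euc n) (v v' x : Euc n) :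
    simMap r L v (simMap r' L' v' x) =
      simMap (r * r') (L'.trans L) (r • L v' + v) x := by
  simp only [simMap, map_add, map_smul, smul_add, smul_smul, LinearIsometryEquiv.trans_apply,
    add_assoc]

/-- The inverse of a similarity. -/
lemma simMap_symm {r : ℝ} (hr : r ≠ 0) (L : Euc n ≃ₗᵢ[ℝ] Euc n) (v x : Euc n) :
    simMap r⁻¹ L.symm (-(r⁻¹ • L.symm v)) (simMap r L v x) = x := by
  simp [simMap, smul_smul, hr]

lemma simMap_symm' {r : ℝ} (hr : r ≠ 0) (L : Euc n ≃ₗᵢ[ℝ] Euc n) (v x : Euc n) :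
    simMap r L v (simMap r⁻¹ L.symm (-(r⁻¹ • L.symm v)) x) = x := by
  simp [simMap, smul_smul, hr]

/-- A similarity as a homeomorphism. -/
def simHomeo {r : ℝ} (hr : r ≠ 0) (L : Euc n ≃ₗᵢ[ℝ] Euc n) (v : Euc n) : Euc n ≃ₜ Euc n where
  toFun := simMap r L v
  invFun := simMap r⁻¹ L.symm (-(r⁻¹ • L.symm v))
  left_inv := simMap_symm hr L v
  right_inv := simMap_symm' hr L v
  continuous_toFun := by unfold simMap; fun_prop
  continuous_invFun := by unfold simMap; fun_prop

lemma volume_simMap_image {r : ℝ} (hr : 0 < r) (L : Euc n ≃ₗᵢ[ℝ] Euc n) (v : Euc n)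
    (C : Set (Euc n)) : volume (simMap r L v '' C) = ENNReal.ofReal (r ^ n) * volume C := by
  have h1 : simMap r L v '' C = (fun x => x + v) '' (r • (L '' C)) := by
    rw [← Set.image_smul, Set.image_image, Set.image_image]
    rfl
  rw [h1, Set.image_add_right, measure_preimage_add_right, Measure.addHaar_smul,
    finrank_euclideanSpace_fin, abs_of_pos (by positivity), L.image_eq_preimage_symm]
  congr 1
  exact L.symm.measurePreserving.measure_preimage_equiv (f := L.symm.toMeasurableEquiv) C

lemma dist_simMap {r : ℝ} (hr : 0 < r) (L : Euc n ≃ₗᵢ[ℝ] Euc n) (v x y : Euc n) :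
    dist (simMap r L v x) (simMap r L v y) = r * dist x y := by
  simp [simMap, dist_smul₀, abs_of_pos hr]

/-- Finite intersections of closed half-spaces. -/
def polyhedron (s : Finset (Euc n × ℝ)) : Set (Euc n) := {x | ∀ p ∈ s, ⟪x, p.1⟫ ≤ p.2}

lemma convex_polyhedron (s : Finset (Euc n × ℝ)) : Convex ℝ (polyhedron s) := by
  intro x hx y hy a b ha hb hab p hp
  rw [inner_add_left, real_inner_smul_left, real_inner_smul_left]
  nlinarith [mul_le_mul_of_nonneg_left (hx p hp) ha, mul_le_mul_of_nonneg_left (hy p hp) hb,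
    congrArg (· * p.2) hab]

lemma polyhedron_union [DecidableEq (Euc n × ℝ)] (s t : Finset (Euc n × ℝ)) :
    polyhedron (s ∪ t) = polyhedron s ∩ polyhedron t := by
  ext x
  simp only [polyhedron, Finset.mem_union, Set.mem_ofPred_eq, Set.mem_inter_iff]
  exact ⟨fun h => ⟨fun p hp => h p (Or.inl hp), fun p hp => h p (Or.inr hp)⟩,
    fun h p hp => hp.elim (h.1 p) (h.2 p)⟩

lemma exists_polyhedron_eq_preimage (r : ℝ) (L : Euc n ≃ₗᵢ[ℝ] Euc n) (v : Euc n)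
    (s : Finset (Euc n × ℝ)) : ∃ t, simMap r L v ⁻¹' polyhedron s = polyhedron t := by
  classical
  refine ⟨s.image fun p => (r • L.symm p.1, p.2 - ⟪v, p.1⟫), ?_⟩
  ext x
  simp only [polyhedron, Set.mem_preimage, Set.mem_ofPred_eq, Finset.forall_mem_image]
  refine forall₂_congr fun p _ => ?_
  rw [simMap, inner_add_left, real_inner_smul_left, real_inner_smul_right,
    ← L.inner_map_map x (L.symm p.1), L.apply_symm_apply, le_sub_iff_add_le]

lemma exists_polyhedron_eq_image {r : ℝ} (hr : r ≠ 0) (L : Euc n ≃ₗᵢ[ℝ] Euc n) (v : Euc n)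
    (s : Finset (Euc n × ℝ)) : ∃ t, simMap r L v '' polyhedron s = polyhedron t := by
  obtain ⟨t, ht⟩ := exists_polyhedron_eq_preimage r⁻¹ L.symm (-(r⁻¹ • L.symm v)) s
  refine ⟨t, ?_⟩
  rw [← ht]
  exact (simHomeo hr L v).toEquiv.image_eq_preimage_symm _

end Similarity

/-! ### Pieces of a foldable figure -/

section Pieces

variable {n : ℕ} {S : Finset (Euc n × ℝ)} {C : Set (Euc n)}

/-- Scaling each constraint by minus the signed value at x turns the same-side condition into a
closed half-space. -/
lemma exists_polyhedron_cutPiece (S : Finset (Euc n × ℝ)) (C : Set (Euc n)) (x : Euc n) :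
    ∃ t, cutPiece S C x = C ∩ polyhedron t := by
  classical
  refine ⟨S.image fun p => (-(⟪x, p.1⟫ - p.2) • p.1, -(⟪x, p.1⟫ - p.2) * p.2), ?_⟩
  ext y
  simp only [cutPiece, polyhedron, Set.mem_ofPred_eq, Finset.forall_mem_image, Set.mem_inter_iff]
  refine and_congr_right fun _ => forall₂_congr fun p _ => ?_
  rw [real_inner_smul_right]
  constructor <;> intro h <;> nlinarith

lemma cutPiece_subset (x : Euc n) : cutPiece S C x ⊆ C := fun _ hy => hy.1

/-- Different pieces lie on different sides of one of the cutting hyperplanes. -/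
lemma exists_separating_hyperplane {P Q : Set (Euc n)} (hP : P ∈ cutPieces S C)
    (hQ : Q ∈ cutPieces S C) (hPQ : P ≠ Q) : ∃ p ∈ S, ∀ y ∈ P, y ∈ Q → ⟪y, p.1⟫ = p.2 := by
  obtain ⟨x, -, hx, rfl⟩ := hP
  obtain ⟨x', -, hx', rfl⟩ := hQ
  by_contra! hcon
  apply hPQ
  -- If for every hyperplane the pieces share a point off it, that point shows x and x' to be on the
  -- same side; all signs agree, so the pieces coincide.
  have key : ∀ p ∈ S, 0 < (⟪x, p.1⟫ - p.2) * (⟪x', p.1⟫ - p.2) := by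
    intro p hp
    obtain ⟨y, hy, hy', hyp⟩ := hcon p hp
    have h1 := hy.2 p hp
    have h2 := hy'.2 p hp
    have h3 := sub_ne_zero.mpr hyp
    have h4 := sub_ne_zero.mpr (hx p hp)
    have h5 := sub_ne_zero.mpr (hx' p hp)
    have h6 := mul_nonneg h1 h2
    have h7 : 0 < (⟪y, p.1⟫ - p.2) ^ 2 := by positivity
    have h8 : 0 ≤ ((⟪x, p.1⟫ - p.2) * (⟪x', p.1⟫ - p.2)) * (⟪y, p.1⟫ - p.2) ^ 2 := by
      linarith
    exact lt_of_le_of_ne (nonneg_of_mul_nonneg_left h8 h7) (mul_ne_zero h4 h5).symm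
  ext y
  refine and_congr_right fun _ => forall₂_congr fun p hp => ?_
  have h := key p hp
  constructor <;> intro h1
  · by_contra! h2
    nlinarith [mul_nonneg h1 h.le, mul_pos_of_neg_of_neg h2 h2, mul_self_pos.mpr (sub_ne_zero.mpr (hx p hp)),
      mul_neg_of_pos_of_neg (mul_self_pos.mpr (sub_ne_zero.mpr (hx p hp))) h2]
  · by_contra! h2
    nlinarith [mul_nonneg h1 h.le, mul_neg_of_pos_of_neg (mul_self_pos.mpr (sub_ne_zero.mpr (hx' p hp))) h2]

lemma volume_inter_cutPieces (hS : ∀ p ∈ S, p.1 ≠ 0) {P Q : Set (Euc n)}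
    (hP : P ∈ cutPieces S C) (hQ : Q ∈ cutPieces S C) (hPQ : P ≠ Q) : volume (P ∩ Q) = 0 := by
  obtain ⟨p, hp, h⟩ := exists_separating_hyperplane hP hQ hPQ
  exact measure_mono_null (fun y hy => h y hy.1 hy.2) (volume_setOf_inner_eq (hS p hp) p.2)

lemma isClosed_cutPiece (hC : IsClosed C) (x : Euc n) : IsClosed (cutPiece S C x) := by
  have : cutPiece S C x = C ∩ ⋂ p ∈ S, {y | 0 ≤ (⟪x, p.1⟫ - p.2) * (⟪y, p.1⟫ - p.2)} := by
    ext y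
    simp [cutPiece]
  rw [this]
  refine hC.inter (isClosed_biInter fun p _ => isClosed_le (by fun_prop) (by fun_prop))

/-- Every nonempty open set has a point on none of finitely many hyperplanes. -/
lemma exists_mem_forall_inner_ne (hS : ∀ p ∈ S, p.1 ≠ 0) {O : Set (Euc n)} (hO : IsOpen O)
    (hne : O.Nonempty) : ∃ x ∈ O, ∀ p ∈ S, ⟪x, p.1⟫ ≠ p.2 := by
  by_contra! hcon
  have h0 : volume O = 0 := by
    refine measure_mono_null (t := ⋃ p ∈ S, {x | ⟪x, p.1⟫ = p.2}) (fun x hx => ?_) ?_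
    · obtain ⟨p, hp, h⟩ := hcon x hx
      exact Set.mem_biUnion hp h
    · exact (measure_biUnion_null_iff S.countable_toSet).mpr fun p hp =>
        volume_setOf_inner_eq (hS p hp) p.2
  exact (hO.measure_pos volume hne).ne' h0

/-- A point of an open part of `C` on none of the cutting hyperplanes is an interior point of its
piece. -/
lemma mem_interior_cutPiece {O : Set (Euc n)} (hO : IsOpen O) (hOC : O ⊆ C) {x : Euc n}
    (hx : x ∈ O) (hxS : ∀ p ∈ S, ⟪x, p.1⟫ ≠ p.2) : x ∈ interior (cutPiece S C x) := by
  rw [mem_interior]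
  refine ⟨O ∩ ⋂ p ∈ S, {y | 0 < (⟪x, p.1⟫ - p.2) * (⟪y, p.1⟫ - p.2)}, ?_, ?_, hx, ?_⟩
  · intro y hy
    refine ⟨hOC hy.1, fun p hp => ?_⟩
    have := Set.mem_iInter₂.mp hy.2 p hp
    exact le_of_lt (α := ℝ) this
  · exact hO.inter (isOpen_biInter_finset fun p _ => isOpen_lt (by fun_prop) (by fun_prop))
  · refine Set.mem_iInter₂.mpr fun p hp => ?_
    exact mul_self_pos.mpr (sub_ne_zero.mpr (hxS p hp))

end Pieces

/-! ### Foldable figures are polygons -/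

lemma volume_isometryEquiv_image {n : ℕ} (g : Euc n ≃ᵢ Euc n) (F : Set (Euc n)) :
    volume (g '' F) = volume F := by
  have h : g '' F = g.symm ⁻¹' F := g.toEquiv.image_eq_preimage_symm F
  rw [h]
  exact (measurePreserving_isometryEquiv g.symm).measure_preimage_equiv
    (f := g.symm.toHomeomorph.toMeasurableEquiv) F

section Polygon

variable {S : Finset (Euc 2 × ℝ)} {C : Set (Euc 2)}

/-- The ratio of similarity of the pieces to the figure is bounded away from `1`. -/
lemma ratio_le_of_cutPieces (hCc : IsCompact C) (hCi : (interior C).Nonempty)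
    (hS : ∀ p ∈ S, p.1 ≠ 0) (hnt : (cutPieces S C).Nontrivial)
    (hcong : ∀ P ∈ cutPieces S C, ∀ Q ∈ cutPieces S C, ∃ g : Euc 2 ≃ᵢ Euc 2, g '' P = Q)
    {r : ℝ} (hr : 0 < r) (L : Euc 2 ≃ₗᵢ[ℝ] Euc 2) (v : Euc 2)
    (hP : simMap r L v '' C ∈ cutPieces S C) : r ≤ 3 / 4 := by
  obtain ⟨Q, hQ, hPQ⟩ := hnt.exists_ne (simMap r L v '' C)
  have hC0 : volume C ≠ 0 :=
    (Measure.measure_pos_of_nonempty_interior volume hCi).ne'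
  have hCt : volume C ≠ ⊤ := hCc.measure_lt_top.ne
  obtain ⟨g, hg⟩ := hcong _ hP _ hQ
  have hvQ : volume Q = volume (simMap r L v '' C) := by
    rw [← hg]
    exact volume_isometryEquiv_image g _
  have hQm : MeasurableSet Q := by
    obtain ⟨x, -, -, rfl⟩ := hQ
    exact (isClosed_cutPiece hCc.isClosed x).measurableSet
  have hsub : ∀ P ∈ cutPieces S C, P ⊆ C := by
    rintro P ⟨x, -, -, rfl⟩
    exact cutPiece_subset x
  have h1 : volume (simMap r L v '' C ∪ Q) ≤ volume C :=
    measure_mono (Set.union_subset (hsub _ hP) (hsub _ hQ))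
  rw [measure_union₀ hQm.nullMeasurableSet (volume_inter_cutPieces hS hP hQ hPQ.symm), hvQ,
    volume_simMap_image hr] at h1
  rw [← ENNReal.ofReal_toReal hCt, ← ENNReal.ofReal_mul (by positivity),
    ← ENNReal.ofReal_add (by positivity) (by positivity),
    ENNReal.ofReal_le_ofReal_iff (by positivity)] at h1
  have h2 : 0 < (volume C).toReal := ENNReal.toReal_pos hC0 hCt
  -- Two almost disjoint congruent pieces of area r² times that of C fit into C, so r² ≤ 1/2, and
  -- 3/4 exceeds 1/√2.
  have h3 : r ^ 2 + r ^ 2 ≤ 1 := by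
    by_contra! hcon
    nlinarith
  nlinarith

/-- Repeated cutting gives small similar copies of the figure that are cut out by polyhedra and
meet a given open part of the figure. -/
lemma exists_small_copy (hCc : IsCompact C) (hCi : (interior C).Nonempty)
    (hS : ∀ p ∈ S, p.1 ≠ 0) (hnt : (cutPieces S C).Nontrivial)
    (hcong : ∀ P ∈ cutPieces S C, ∀ Q ∈ cutPieces S C, ∃ g : Euc 2 ≃ᵢ Euc 2, g '' P = Q)
    (hsim : ∀ P ∈ cutPieces S C, ∃ d : Euc 2 ≃ᵈ Euc 2, d '' C = P)
    {O : Set (Euc 2)} (hO : IsOpen O) (hOC : O ⊆ C) (hOne : O.Nonempty) (N : ℕ) :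
    ∃ (r : ℝ) (L : Euc 2 ≃ₗᵢ[ℝ] Euc 2) (v : Euc 2) (s : Finset (Euc 2 × ℝ)), 0 < r ∧
      r ≤ (3 / 4) ^ N ∧ simMap r L v '' C = C ∩ polyhedron s ∧
      (interior (simMap r L v '' C) ∩ O).Nonempty := by
  classical
  induction N with
  | zero =>
    have hid : simMap 1 (LinearIsometryEquiv.refl ℝ _) 0 '' C = C := by
      have h : ∀ x : Euc 2, simMap 1 (LinearIsometryEquiv.refl ℝ _) 0 x = x := fun x => by
        simp [simMap]
      simp [h]
    refine ⟨1, LinearIsometryEquiv.refl ℝ _, 0, ∅, one_pos, by simp, ?_, ?_⟩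
    · rw [hid]
      simp [polyhedron]
    · rw [hid]
      obtain ⟨x, hx⟩ := hOne
      exact ⟨x, mem_interior.mpr ⟨O, hOC, hO, hx⟩, hx⟩
  | succ N ih =>
    obtain ⟨r, L, v, s, hr, hrN, hs, hne⟩ := ih
    set f := simHomeo hr.ne' L v with hf
    have hfa : ∀ x, f x = simMap r L v x := fun x => rfl
    have hfi : simMap r L v '' C = f '' C := rfl
    have hO'o : IsOpen (f ⁻¹' (interior (simMap r L v '' C) ∩ O)) :=
      (isOpen_interior.inter hO).preimage f.continuous
    have hO'C : f ⁻¹' (interior (simMap r L v '' C) ∩ O) ⊆ C := by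
      intro x hx
      obtain ⟨y, hy, hyx⟩ := interior_subset hx.1
      rwa [← f.injective hyx]
    have hO'ne : (f ⁻¹' (interior (simMap r L v '' C) ∩ O)).Nonempty := by
      obtain ⟨y, hy⟩ := hne
      exact ⟨f.symm y, by simpa using hy⟩
    -- The open set is pulled back along the similarity f onto C; a generic point of it selects a
    -- piece, and the image of that piece under f is the next smaller copy.
    obtain ⟨x, hxO, hxS⟩ := exists_mem_forall_inner_ne hS hO'o hO'ne
    have hP : cutPiece S C x ∈ cutPieces S C := ⟨x, hO'C hxO, hxS, rfl⟩
    obtain ⟨d, hd⟩ := hsim _ hP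
    obtain ⟨r', L', v', hr', hd'⟩ := exists_eq_simMap d
    have hd2 : simMap r' L' v' '' C = cutPiece S C x := by
      rw [← hd]
      exact Set.image_congr fun y _ => (hd' y).symm
    have hr34 := ratio_le_of_cutPieces hCc hCi hS hnt hcong hr' L' v' (hd2 ▸ hP)
    obtain ⟨t, ht⟩ := exists_polyhedron_cutPiece S C x
    obtain ⟨t', ht'⟩ := exists_polyhedron_eq_image hr.ne' L v t
    have himg : simMap (r * r') (L'.trans L) (r • L v' + v) '' C = f '' cutPiece S C x := by
      rw [← hd2, Set.image_image]
      exact Set.image_congr fun y _ => (simMap_comp r r' L L' v v' y).symm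
    refine ⟨r * r', L'.trans L, r • L v' + v, s ∪ t', mul_pos hr hr', ?_, ?_, ?_⟩
    · rw [pow_succ]
      gcongr
    · rw [himg, ht, Set.image_inter f.injective, ← hfi, hs, polyhedron_union, ← ht',
        Set.inter_assoc]
      rfl
    · rw [himg, ← f.image_interior]
      exact ⟨f x, ⟨x, mem_interior_cutPiece hO'o hO'C hxO hxS, rfl⟩, hxO.2⟩

/-- A foldable figure is a convex polygon. -/
lemma IsFoldableFigure.exists_polyhedron (hC : IsFoldableFigure C) : ∃ s, C = polyhedron s := by
  obtain ⟨S, hS, hnt, hcong, hsim, -⟩ := hC.exists_cut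
  have hCc := hC.isCompact
  have hCi := hC.nonempty_interior
  obtain ⟨c, hc⟩ := hCi
  obtain ⟨ρ, hρ, hball⟩ := Metric.isOpen_iff.mp isOpen_interior c hc
  obtain ⟨D, hD⟩ := hCc.isBounded.subset_closedBall c
  have hball2 : Metric.ball c (ρ / 2) ⊆ C :=
    (Metric.ball_subset_ball (by linarith)).trans (hball.trans interior_subset)
  have hDpos : 0 ≤ D := by
    by_contra! h
    have := hD (interior_subset hc)
    rw [Metric.closedBall_eq_empty.mpr h] at this
    exact this
  -- The diameter of the copy, at most 2Dr, drops below ρ/2, so a copy meeting the ball of radius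
  -- ρ/2 stays in the ball of radius ρ.
  obtain ⟨N, hN⟩ := exists_pow_lt_of_lt_one (show 0 < ρ / (4 * (D + 1)) by positivity)
    (show (3 / 4 : ℝ) < 1 by norm_num)
  obtain ⟨r, L, v, s, hr, hrN, hs, y, hy, hyc⟩ := exists_small_copy hCc ⟨c, hc⟩ hS hnt hcong hsim
    (Metric.isOpen_ball (x := c) (ε := ρ / 2)) hball2 (Metric.nonempty_ball.mpr (by linarith)) N
  have hr2 : r * (2 * D) < ρ / 2 := by
    have h1 : r < ρ / (4 * (D + 1)) := hrN.trans_lt hN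
    rw [lt_div_iff₀ (by positivity)] at h1
    nlinarith
  have hsub : simMap r L v '' C ⊆ Metric.ball c ρ := by
    rintro _ ⟨z, hz, rfl⟩
    obtain ⟨w, hw, hwy⟩ := interior_subset hy
    rw [Metric.mem_ball] at hyc ⊢
    have h1 : dist z w ≤ 2 * D := by
      have h2 := Metric.mem_closedBall.mp (hD hz)
      have h3 := Metric.mem_closedBall.mp (hD hw)
      have h4 := dist_triangle_right z w c
      linarith
    have h5 : dist (simMap r L v z) y = r * dist z w := by rw [← hwy, dist_simMap hr]
    have h6 := dist_triangle (simMap r L v z) y c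
    have h7 := mul_le_mul_of_nonneg_left h1 hr.le
    linarith
  have hclosed : IsClosed (simMap r L v '' C) :=
    (hCc.image (simHomeo hr.ne' L v).continuous).isClosed
  -- The polyhedron is connected. If it were larger than the copy, some point of it outside the copy
  -- would lie in the ball; but the ball is inside C, and C meets the polyhedron only in the copy.
  have hpoly : polyhedron s = simMap r L v '' C := by
    apply Set.Subset.antisymm
    · by_contra hnot
      rw [Set.not_subset] at hnot
      obtain ⟨z, hz, hzn⟩ := hnot
      have hconn := (convex_polyhedron s).isPreconnected
      have hyR : y ∈ polyhedron s := (hs ▸ interior_subset hy : y ∈ C ∩ polyhedron s).2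
      obtain ⟨w, hwR, hwb, hwn⟩ := hconn (Metric.ball c ρ) (simMap r L v '' C)ᶜ
        Metric.isOpen_ball hclosed.isOpen_compl
        (fun x _ => by
          by_cases hx : x ∈ simMap r L v '' C
          · exact Or.inl (hsub hx)
          · exact Or.inr hx)
        ⟨y, hyR, hsub (interior_subset hy)⟩ ⟨z, hz, hzn⟩
      apply hwn
      rw [hs]
      exact ⟨interior_subset (hball hwb), hwR⟩
    · rw [hs]
      exact Set.inter_subset_right
  obtain ⟨t, ht⟩ := exists_polyhedron_eq_preimage r L v s
  refine ⟨t, ?_⟩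
  rw [← ht, hpoly]
  exact ((simHomeo hr.ne' L v).injective.preimage_image C).symm

/-- The constraints `⟨x, p.1⟩ ≤ p.2`, `p ∈ s`, describe the polygon `C`; the normals `p.1` are
unit vectors, and every constraint is the only active one at some point. -/
structure IsPolygon (s : Finset (Euc 2 × ℝ)) (C : Set (Euc 2)) : Prop where
  eq_polyhedron : C = polyhedron s
  norm_eq_one : ∀ p ∈ s, ‖p.1‖ = 1
  exists_active : ∀ p ∈ s, ∃ w, ⟪w, p.1⟫ = p.2 ∧ ∀ q ∈ s, q ≠ p → ⟪w, q.1⟫ < q.2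

lemma inner_lt_of_mem_interior {s : Finset (Euc 2 × ℝ)} {c : Euc 2}
    (hc : c ∈ interior (polyhedron s)) {p : Euc 2 × ℝ} (hp : p ∈ s) (hp0 : p.1 ≠ 0) :
    ⟪c, p.1⟫ < p.2 := by
  obtain ⟨ρ, hρ, hball⟩ := Metric.isOpen_iff.mp isOpen_interior c hc
  have hn : 0 < ‖p.1‖ := norm_pos_iff.mpr hp0
  have h1 : c + (ρ / 2 / ‖p.1‖) • p.1 ∈ polyhedron s := by
    refine interior_subset (hball ?_)
    rw [Metric.mem_ball, dist_eq_norm, add_sub_cancel_left, norm_smul, Real.norm_of_nonneg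
      (by positivity), div_mul_cancel₀ _ hn.ne']
    linarith
  have h2 := h1 p hp
  rw [inner_add_left, real_inner_smul_left, real_inner_self_eq_norm_sq] at h2
  have h3 : 0 < ρ / 2 / ‖p.1‖ * ‖p.1‖ ^ 2 := by positivity
  linarith

/-- Take a description by the fewest half-planes. Dropping p then admits some z outside C satisfying
the other constraints, and the segment to z from an interior point c crosses the line of p where all
others are strict. Normals are scaled to length 1 afterwards. -/
lemma exists_isPolygon {t : Finset (Euc 2 × ℝ)} (hC : C = polyhedron t)
    (hCi : (interior C).Nonempty) : ∃ s, IsPolygon s C := by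
  classical
  obtain ⟨c, hc⟩ := hCi
  have hex : ∃ k, ∃ s : Finset (Euc 2 × ℝ), C = polyhedron s ∧ s.card = k := ⟨_, t, hC, rfl⟩
  obtain ⟨s, hs, hcard⟩ := Nat.find_spec hex
  have hmin : ∀ u : Finset (Euc 2 × ℝ), C = polyhedron u → s.card ≤ u.card := fun u hu => by
    rw [hcard]
    exact Nat.find_min' hex ⟨u, hu, rfl⟩
  have hex2 : ∀ p ∈ s, ∃ z ∉ C, ∀ q ∈ s, q ≠ p → ⟪z, q.1⟫ ≤ q.2 := by
    intro p hp
    by_contra! hcon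
    have h1 : C = polyhedron (s.erase p) := by
      apply Set.Subset.antisymm
      · rw [hs]
        exact fun x hx q hq => hx q (Finset.mem_of_mem_erase hq)
      · intro x hx
        by_contra hxC
        obtain ⟨q, hq, hqp, hlt⟩ := hcon x hxC
        exact absurd (hx q (Finset.mem_erase.mpr ⟨hqp, hq⟩)) (not_le.mpr hlt)
    have h2 := hmin _ h1
    exact absurd (Finset.card_erase_lt_of_mem hp) (not_lt.mpr h2)
  have hcC : c ∈ polyhedron s := hs ▸ interior_subset hc
  have hn0 : ∀ p ∈ s, p.1 ≠ 0 := by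
    intro p hp h0
    obtain ⟨z, hz, hzq⟩ := hex2 p hp
    rw [hs] at hz
    refine hz fun q hq => ?_
    by_cases hqp : q = p
    · have := hcC p hp
      rw [hqp]
      simpa [h0] using this
    · exact hzq q hq hqp
  refine ⟨s.image fun p => (‖p.1‖⁻¹ • p.1, ‖p.1‖⁻¹ * p.2), ?_, ?_, ?_⟩
  · rw [hs]
    ext x
    simp only [polyhedron, Set.mem_ofPred_eq, Finset.forall_mem_image]
    refine forall₂_congr fun p hp => ?_
    have hn : 0 < ‖p.1‖⁻¹ := inv_pos.mpr (norm_pos_iff.mpr (hn0 p hp))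
    rw [real_inner_smul_right]
    exact (mul_le_mul_iff_right₀ hn).symm
  · simp only [Finset.forall_mem_image]
    intro p hp
    rw [norm_smul, norm_inv, norm_norm, inv_mul_cancel₀ (norm_ne_zero_iff.mpr (hn0 p hp))]
  · simp only [Finset.forall_mem_image]
    intro p hp
    obtain ⟨z, hz, hzq⟩ := hex2 p hp
    have hlt : ∀ q ∈ s, ⟪c, q.1⟫ < q.2 := fun q hq =>
      inner_lt_of_mem_interior (hs ▸ hc) hq (hn0 q hq)
    have hzp : p.2 < ⟪z, p.1⟫ := by
      by_contra! hle
      rw [hs] at hz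
      exact hz fun q hq => if h : q = p then h ▸ hle else hzq q hq h
    -- The parameter at which the segment from c to z crosses the line of p.
    set τ : ℝ := (p.2 - ⟪c, p.1⟫) / (⟪z, p.1⟫ - ⟪c, p.1⟫) with hτ
    have hd : 0 < ⟪z, p.1⟫ - ⟪c, p.1⟫ := by linarith [hlt p hp]
    have hτ0 : 0 < τ := div_pos (by linarith [hlt p hp]) hd
    have hτ1 : τ < 1 := (div_lt_one hd).mpr (by linarith)
    have hτm : τ * (⟪z, p.1⟫ - ⟪c, p.1⟫) = p.2 - ⟪c, p.1⟫ := div_mul_cancel₀ _ hd.ne'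
    refine ⟨c + τ • (z - c), ?_, ?_⟩
    · rw [real_inner_smul_right, inner_add_left, real_inner_smul_left, inner_sub_left, hτm]
      ring
    · intro q hq hqp
      have hqp' : q ≠ p := fun h => hqp (h ▸ rfl)
      have hn : 0 < ‖q.1‖⁻¹ := inv_pos.mpr (norm_pos_iff.mpr (hn0 q hq))
      rw [real_inner_smul_right, inner_add_left, real_inner_smul_left, inner_sub_left]
      refine mul_lt_mul_of_pos_left ?_ hn
      nlinarith [hlt q hq, hzq q hq hqp']

end Polygon

/-! ### Orthonormal frames of the plane -/

section Frame

lemma inner_euc_two (x y : Euc 2) : ⟪x, y⟫ = x 0 * y 0 + x 1 * y 1 := by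
  simp [PiLp.inner_apply, Fin.sum_univ_two, mul_comm]

lemma exists_unit_perp {ν : Euc 2} (hν : ‖ν‖ = 1) : ∃ e : Euc 2, ‖e‖ = 1 ∧ ⟪e, ν⟫ = 0 := by
  refine ⟨!₂[-ν 1, ν 0], ?_, ?_⟩
  · rw [← hν, EuclideanSpace.norm_eq, EuclideanSpace.norm_eq]
    simp [Fin.sum_univ_two, add_comm]
  · rw [inner_euc_two]
    simp
    ring

lemma inner_self_of_norm_eq_one {ν : Euc 2} (hν : ‖ν‖ = 1) : (⟪ν, ν⟫ : ℝ) = 1 := by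
  rw [real_inner_self_eq_norm_sq, hν, one_pow]

lemma eq_frame_sum {e f : Euc 2} (he : ‖e‖ = 1) (hf : ‖f‖ = 1) (hef : ⟪e, f⟫ = 0) (v : Euc 2) :
    v = ⟪v, e⟫ • e + ⟪v, f⟫ • f := by
  have h1 := inner_self_of_norm_eq_one he
  have h2 := inner_self_of_norm_eq_one hf
  rw [inner_euc_two] at h1 h2 hef
  set a := e 0
  set b := e 1
  set c := f 0
  set d := f 1
  -- f is e turned by a right angle, up to the sign a d - b c.
  have hδ : (a * d - b * c) ^ 2 = 1 := by
    linear_combination (c * c + d * d) * h1 + h2 - (a * c + b * d) * hef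
  have hc : c = -b * (a * d - b * c) := by linear_combination -c * h1 + a * hef
  have hd : d = a * (a * d - b * c) := by linear_combination -d * h1 + b * hef
  have e1 : a * a + c * c = 1 := by
    linear_combination h1 + (c - b * (a * d - b * c)) * hc + b ^ 2 * hδ
  have e2 : b * b + d * d = 1 := by
    linear_combination h1 + (d + a * (a * d - b * c)) * hd + a ^ 2 * hδ
  have e3 : a * b + c * d = 0 := by
    linear_combination d * hc + (-b * (a * d - b * c)) * hd - a * b * hδ
  ext i
  fin_cases i
  · simp only [inner_euc_two]
    simp
    linear_combination (-v 0) * e1 - v 1 * e3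
  · simp only [inner_euc_two]
    simp
    linear_combination (-v 1) * e2 - v 0 * e3

lemma exists_eq_smul_of_inner_eq_zero {e f v : Euc 2} (he : e ≠ 0) (hf : ‖f‖ = 1)
    (hef : ⟪e, f⟫ = 0) (hve : ⟪v, e⟫ = 0) : v = ⟪v, f⟫ • f := by
  have hn : 0 < ‖e‖ := norm_pos_iff.mpr he
  have h := eq_frame_sum (e := ‖e‖⁻¹ • e) (f := f)
    (by rw [norm_smul, norm_inv, norm_norm, inv_mul_cancel₀ hn.ne']) hf
    (by rw [real_inner_smul_left, hef, mul_zero]) v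
  rw [real_inner_smul_right, hve, mul_zero, zero_smul, zero_add] at h
  exact h

end Frame

/-! ### Facets and reflections -/

/-- The set `K` has a nondegenerate segment through `x` on its boundary, with outer unit normal
`ν`. -/
def IsFacet (K : Set (Euc 2)) (ν x : Euc 2) : Prop :=
  ‖ν‖ = 1 ∧ x ∈ K ∧ (∀ y ∈ K, ⟪y - x, ν⟫ ≤ 0) ∧ ∃ y ∈ K, y ≠ x ∧ ⟪y - x, ν⟫ = 0

section Facet

variable {K : Set (Euc 2)} {ν x : Euc 2}

lemma IsFacet.image_simMap (h : IsFacet K ν x) {r : ℝ} (hr : 0 < r) (L : Euc 2 ≃ₗᵢ[ℝ] Euc 2)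
    (v : Euc 2) : IsFacet (simMap r L v '' K) (L ν) (simMap r L v x) := by
  obtain ⟨h1, h2, h3, y, hy, hyx, hyν⟩ := h
  have hi : ∀ z, ⟪simMap r L v z - simMap r L v x, L ν⟫ = r * ⟪z - x, ν⟫ := fun z => by
    rw [simMap, simMap, add_sub_add_right_eq_sub, ← smul_sub, ← map_sub, real_inner_smul_left,
      L.inner_map_map]
  refine ⟨by rw [L.norm_map, h1], Set.mem_image_of_mem _ h2, ?_, _, Set.mem_image_of_mem _ hy,
    fun h => hyx ((simHomeo hr.ne' L v).injective h), by rw [hi, hyν, mul_zero]⟩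
  rintro _ ⟨z, hz, rfl⟩
  rw [hi]
  exact mul_nonpos_of_nonneg_of_nonpos hr.le (h3 z hz)

/-- The hyperplane of the constraint `p` passes through `x` with normal parallel to `ν`. -/
def IsLineAt (p : Euc 2 × ℝ) (ν x : Euc 2) : Prop := ⟪x, p.1⟫ = p.2 ∧ ∃ c : ℝ, c ≠ 0 ∧ p.1 = c • ν

lemma affReflection_apply_of_isLineAt {p : Euc 2 × ℝ} (hν : ‖ν‖ = 1) (hp : IsLineAt p ν x)
    (y : Euc 2) : affReflection p.1 p.2 y = y - (2 * ⟪y - x, ν⟫) • ν := by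
  obtain ⟨h1, c, hc, h2⟩ := hp
  change affReflectionFun p.1 p.2 y = _
  rw [affReflectionFun, ← h1, h2, ← inner_sub_left, real_inner_smul_right, real_inner_smul_left,
    real_inner_smul_right, inner_self_of_norm_eq_one hν, smul_smul]
  congr 2
  field_simp

lemma IsFacet.image_reflection {μ : Euc 2} (h : IsFacet K μ x) {p : Euc 2 × ℝ} (hν : ‖ν‖ = 1)
    (hp : IsLineAt p ν x) :
    IsFacet (affReflection p.1 p.2 '' K) (μ - (2 * ⟪μ, ν⟫) • ν) x := by
  obtain ⟨h1, h2, h3, y, hy, hyx, hyν⟩ := h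
  have hR := affReflection_apply_of_isLineAt hν hp
  have hx : affReflection p.1 p.2 x = x := by rw [hR]; simp
  have hi : ∀ z, ⟪affReflection p.1 p.2 z - x, μ - (2 * ⟪μ, ν⟫) • ν⟫ = ⟪z - x, μ⟫ := fun z => by
    rw [hR, sub_right_comm]
    generalize z - x = w
    simp only [inner_sub_left, inner_sub_right, real_inner_smul_left, real_inner_smul_right,
      inner_self_of_norm_eq_one hν, real_inner_comm μ ν]
    ring
  refine ⟨?_, ⟨x, h2, hx⟩, ?_, _, Set.mem_image_of_mem _ hy, fun h => hyx ?_, by rw [hi, hyν]⟩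
  · rw [← sq_eq_sq₀ (norm_nonneg _) zero_le_one, ← real_inner_self_eq_norm_sq]
    simp only [inner_sub_left, inner_sub_right, real_inner_smul_left, real_inner_smul_right,
      inner_self_of_norm_eq_one hν, inner_self_of_norm_eq_one h1, real_inner_comm μ ν]
    ring
  · rintro _ ⟨z, hz, rfl⟩
    rw [hi]
    exact h3 z hz
  · exact (affReflection p.1 p.2).injective (h.trans hx.symm)

/-- A facet determines a bounding hyperplane. -/
lemma IsFacet.isBoundingHyperplane (h : IsFacet K ν x) {p : Euc 2 × ℝ} (hp : IsLineAt p ν x) :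
    IsBoundingHyperplane p.1 p.2 K := by
  obtain ⟨h1, h2, h3, y, hy, hyx, hyν⟩ := h
  obtain ⟨hx, c, hc, hpc⟩ := hp
  have hν0 : ν ≠ 0 := fun h0 => by simp [h0] at h1
  have hi : ∀ z, ⟪z, p.1⟫ - p.2 = c * ⟪z - x, ν⟫ := fun z => by
    rw [← hx, ← inner_sub_left, hpc, real_inner_smul_right]
  refine ⟨by rw [hpc]; exact smul_ne_zero hc hν0, ?_, ?_⟩
  · rcases lt_or_gt_of_ne hc with hc | hc
    · exact Or.inr fun z hz => by nlinarith [h3 z hz, hi z]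
    · exact Or.inl fun z hz => by nlinarith [h3 z hz, hi z]
  · have hyp : ⟪y, p.1⟫ = p.2 := by
      have := hi y
      rw [hyν, mul_zero] at this
      linarith
    apply Set.Subset.antisymm
    · let H : AffineSubspace ℝ (Euc 2) := AffineSubspace.mk' x (LinearMap.ker (innerₗ (Euc 2) p.1))
      have hH : ∀ z, z ∈ H ↔ z ∈ affHyperplane p.1 p.2 := fun z => by
        rw [AffineSubspace.mem_mk', LinearMap.mem_ker]
        simp only [vsub_eq_sub, innerₗ_apply_apply, affHyperplane, Set.mem_ofPred_eq]
        rw [real_inner_comm, inner_sub_left, hx, sub_eq_zero]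
      intro z hz
      rw [← hH]
      refine (affineSpan_le (s := K ∩ affHyperplane p.1 p.2) (Q := H)).mpr ?_ hz
      exact fun w hw => (hH w).mpr hw.2
    · intro z hz
      have hz' : ⟪z - x, ν⟫ = 0 := by
        have := hi z
        rw [show ⟪z, p.1⟫ = p.2 from hz, sub_self] at this
        exact (mul_eq_zero.mp this.symm).resolve_left hc
      have hyx0 : y - x ≠ 0 := sub_ne_zero.mpr hyx
      obtain ⟨u, hu, huν⟩ := exists_unit_perp h1
      have hyu := exists_eq_smul_of_inner_eq_zero hν0 hu (by rw [real_inner_comm]; exact huν) hyν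
      have hzu := exists_eq_smul_of_inner_eq_zero hν0 hu (by rw [real_inner_comm]; exact huν) hz'
      have hyu0 : ⟪y - x, u⟫ ≠ 0 := fun h0 => hyx0 (by rw [hyu, h0, zero_smul])
      have hline : z = AffineMap.lineMap x y (⟪z - x, u⟫ / ⟪y - x, u⟫) := by
        rw [AffineMap.lineMap_apply, vsub_eq_sub, vadd_eq_add, hyu, smul_smul]
        rw [real_inner_smul_left, inner_self_of_norm_eq_one hu, mul_one, div_mul_cancel₀ _ hyu0,
          ← hzu, sub_add_cancel]
      rw [hline]
      exact AffineMap.lineMap_mem _ (subset_affineSpan ℝ _ ⟨h2, hx⟩)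
        (subset_affineSpan ℝ _ ⟨hy, hyp⟩)

/-- A bounding hyperplane comes from a facet. -/
lemma IsBoundingHyperplane.exists_isFacet {r : Euc 2} {k : ℝ} (h : IsBoundingHyperplane r k K) :
    ∃ ν x, IsFacet K ν x ∧ IsLineAt (r, k) ν x := by
  obtain ⟨hr, hside, hspan⟩ := h
  have hn : 0 < ‖r‖ := norm_pos_iff.mpr hr
  have hrr : (⟪r, r⟫ : ℝ) ≠ 0 := inner_self_ne_zero.mpr hr
  obtain ⟨e, he, her⟩ := exists_unit_perp (ν := ‖r‖⁻¹ • r)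
    (by rw [norm_smul, norm_inv, norm_norm, inv_mul_cancel₀ hn.ne'])
  have her' : ⟪e, r⟫ = 0 := by
    rw [real_inner_smul_right] at her
    exact (mul_eq_zero.mp her).resolve_left (inv_ne_zero hn.ne')
  have hp1 : (k / ⟪r, r⟫) • r ∈ affHyperplane r k := by
    change ⟪(k / ⟪r, r⟫) • r, r⟫ = k
    rw [real_inner_smul_left, div_mul_cancel₀ _ hrr]
  have hp2 : (k / ⟪r, r⟫) • r + e ∈ affHyperplane r k := by
    change ⟪(k / ⟪r, r⟫) • r + e, r⟫ = k
    rw [inner_add_left, real_inner_smul_left, div_mul_cancel₀ _ hrr, her', add_zero]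
  -- A line is not spanned by at most one point, so K has two different points on it.
  have hns : ¬ (K ∩ affHyperplane r k).Subsingleton := by
    intro hsub
    have h1 : ((affineSpan ℝ (K ∩ affHyperplane r k) : AffineSubspace ℝ (Euc 2)) :
        Set (Euc 2)).Subsingleton := by
      rcases hsub.eq_empty_or_singleton with h0 | ⟨z, h0⟩
      · rw [h0, AffineSubspace.span_empty]
        exact Set.subsingleton_empty
      · rw [h0, AffineSubspace.coe_affineSpan_singleton]
        exact Set.subsingleton_singleton
    rw [hspan] at h1
    have h2 := h1 hp1 hp2
    have h3 : e = 0 := by simpa using h2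
    rw [h3, norm_zero] at he
    exact zero_ne_one he
  rw [Set.not_subsingleton_iff] at hns
  obtain ⟨x, hx, y, hy, hxy⟩ := hns
  have hxk : ⟪x, r⟫ = k := hx.2
  have hyk : ⟪y, r⟫ = k := hy.2
  rcases hside with hs | hs
  · refine ⟨‖r‖⁻¹ • r, x, ⟨?_, hx.1, ?_, y, hy.1, hxy.symm, ?_⟩, hxk, ‖r‖, hn.ne', ?_⟩
    · rw [norm_smul, norm_inv, norm_norm, inv_mul_cancel₀ hn.ne']
    · intro z hz
      rw [real_inner_smul_right, inner_sub_left, hxk]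
      exact mul_nonpos_of_nonneg_of_nonpos (inv_pos.mpr hn).le (by linarith [hs z hz])
    · rw [real_inner_smul_right, inner_sub_left, hxk, hyk, sub_self, mul_zero]
    · rw [smul_smul, mul_inv_cancel₀ hn.ne', one_smul]
  · refine ⟨-(‖r‖⁻¹ • r), x, ⟨?_, hx.1, ?_, y, hy.1, hxy.symm, ?_⟩, hxk, -‖r‖, by simpa using hr, ?_⟩
    · rw [norm_neg, norm_smul, norm_inv, norm_norm, inv_mul_cancel₀ hn.ne']
    · intro z hz
      rw [inner_neg_right, real_inner_smul_right, inner_sub_left, hxk, neg_nonpos]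
      exact mul_nonneg (inv_pos.mpr hn).le (by linarith [hs z hz])
    · rw [inner_neg_right, real_inner_smul_right, inner_sub_left, hxk, hyk, sub_self, mul_zero,
        neg_zero]
    · rw [smul_neg, neg_smul, neg_neg, smul_smul, mul_inv_cancel₀ hn.ne', one_smul]

/-- A facet contains a segment starting at the given point in the direction in which a further
constraint is inactive. -/
lemma IsFacet.exists_add_smul_mem (h : IsFacet K ν x) {u μ : Euc 2} (hu : ‖u‖ = 1)
    (huν : ⟪u, ν⟫ = 0) (hμ : ∀ y ∈ K, ⟪y - x, μ⟫ ≤ 0) (huμ : ⟪u, μ⟫ < 0) :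
    ∃ c : ℝ, 0 < c ∧ x + c • u ∈ K := by
  obtain ⟨h1, h2, h3, y, hy, hyx, hyν⟩ := h
  have hν0 : ν ≠ 0 := fun h0 => by simp [h0] at h1
  have hyu := exists_eq_smul_of_inner_eq_zero hν0 hu (by rw [real_inner_comm]; exact huν) hyν
  have h4 := hμ y hy
  rw [hyu, real_inner_smul_left] at h4
  have h5 : ⟪y - x, u⟫ ≠ 0 := fun h0 => by
    rw [h0, zero_smul] at hyu
    exact hyx (sub_eq_zero.mp hyu)
  have h6 : 0 ≤ ⟪y - x, u⟫ := by
    by_contra! hneg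
    nlinarith [mul_pos_of_neg_of_neg hneg huμ]
  exact ⟨⟪y - x, u⟫, lt_of_le_of_ne h6 h5.symm, by rw [← hyu, add_sub_cancel]; exact hy⟩

end Facet

/-! ### Corner angles of foldable figures -/

section Corner

variable {S : Finset (Euc 2 × ℝ)} {C : Set (Euc 2)}

/-- The hyperplanes `S` fold the convex body `C`. -/
structure IsFolding (S : Finset (Euc 2 × ℝ)) (C : Set (Euc 2)) : Prop where
  isCompact : IsCompact C
  convex : Convex ℝ C
  nonempty_interior : (interior C).Nonempty
  ne_zero : ∀ p ∈ S, p.1 ≠ 0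
  nontrivial : (cutPieces S C).Nontrivial
  congruent : ∀ P ∈ cutPieces S C, ∀ Q ∈ cutPieces S C, ∃ g : Euc 2 ≃ᵢ Euc 2, g '' P = Q
  similar : ∀ P ∈ cutPieces S C, ∃ d : Euc 2 ≃ᵈ Euc 2, d '' C = P
  reflect : ∀ P ∈ cutPieces S C, ∀ p ∈ S, IsBoundingHyperplane p.1 p.2 P →
      ∃ Q ∈ cutPieces S C, affReflection p.1 p.2 '' P ⊆ Q

lemma convex_cutPiece (hC : Convex ℝ C) (x : Euc 2) : Convex ℝ (cutPiece S C x) := by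
  obtain ⟨t, ht⟩ := exists_polyhedron_cutPiece S C x
  rw [ht]
  exact hC.inter (convex_polyhedron t)

/-- A facet of a piece is a facet of the figure or lies on a cutting line. -/
lemma IsFacet.of_cutPiece (hC : Convex ℝ C) {x₀ : Euc 2} (hx₀ : ∀ p ∈ S, ⟪x₀, p.1⟫ ≠ p.2)
    {ν x : Euc 2} (h : IsFacet (cutPiece S C x₀) ν x) :
    IsFacet C ν x ∨ ∃ p ∈ S, IsLineAt p ν x := by
  by_contra! hcon
  obtain ⟨hnC, hnS⟩ := hcon
  obtain ⟨h1, h2, h3, y, hy, hyx, hyν⟩ := h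
  apply hnC
  refine ⟨h1, h2.1, ?_, y, hy.1, hyx, hyν⟩
  have hν0 : ν ≠ 0 := fun h0 => by simp [h0] at h1
  have hyx0 : y - x ≠ 0 := sub_ne_zero.mpr hyx
  -- A cutting line meeting the segment from x to y twice would contain it and so run through x with
  -- normal parallel to ν, which is excluded.
  have hsub : ∀ p ∈ S, {τ : ℝ | ⟪x + τ • (y - x), p.1⟫ = p.2}.Subsingleton := by
    intro p hp τ hτ τ' hτ'
    have h4 : ⟪x, p.1⟫ + τ * ⟪y - x, p.1⟫ = p.2 := by
      rw [← real_inner_smul_left, ← inner_add_left]; exact hτ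
    have h5 : ⟪x, p.1⟫ + τ' * ⟪y - x, p.1⟫ = p.2 := by
      rw [← real_inner_smul_left, ← inner_add_left]; exact hτ'
    by_cases h6 : ⟪y - x, p.1⟫ = 0
    · exfalso
      apply hnS p hp
      refine ⟨by rw [h6, mul_zero, add_zero] at h4; exact h4, ⟪p.1, ν⟫, ?_, ?_⟩
      · intro h0
        have := exists_eq_smul_of_inner_eq_zero hyx0 h1 hyν (v := p.1)
          (by rw [real_inner_comm]; exact h6)
        rw [h0, zero_smul] at this
        have h7 := hx₀ p hp
        rw [h6, mul_zero, add_zero] at h4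
        rw [this, inner_zero_right] at h7 h4
        exact h7 h4
      · exact exists_eq_smul_of_inner_eq_zero hyx0 h1 hyν (by rw [real_inner_comm]; exact h6)
    · have h7 : (τ - τ') * ⟪y - x, p.1⟫ = 0 := by linear_combination h4 - h5
      exact sub_eq_zero.mp ((mul_eq_zero.mp h7).resolve_right h6)
  have hfin : (⋃ p ∈ S, {τ : ℝ | ⟪x + τ • (y - x), p.1⟫ = p.2}).Finite :=
    S.finite_toSet.biUnion fun p hp => (hsub p hp).finite
  -- Near a point m of the segment off all cutting lines the piece coincides with C, so the
  -- supporting inequality there extends from the piece to C by convexity.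
  obtain ⟨τ, hτ, hτS⟩ := ((Set.Ioo_infinite (show (0 : ℝ) < 1 by norm_num)).sdiff hfin).nonempty
  set m := x + τ • (y - x) with hm
  have hmP : m ∈ cutPiece S C x₀ := by
    refine (convex_cutPiece hC x₀).add_smul_sub_mem h2 hy ⟨hτ.1.le, hτ.2.le⟩
  have hmS : ∀ p ∈ S, 0 < (⟪x₀, p.1⟫ - p.2) * (⟪m, p.1⟫ - p.2) := by
    intro p hp
    refine lt_of_le_of_ne (hmP.2 p hp) (mul_ne_zero (sub_ne_zero.mpr (hx₀ p hp))
      (sub_ne_zero.mpr fun h0 => hτS ?_)).symm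
    exact Set.mem_biUnion hp h0
  have hmν : ⟪m - x, ν⟫ = 0 := by
    rw [hm, add_sub_cancel_left, real_inner_smul_left, hyν, mul_zero]
  intro z hz
  have hev : ∀ᶠ ε : ℝ in nhdsWithin 0 (Set.Ioi 0), ∀ p ∈ S,
      0 < (⟪x₀, p.1⟫ - p.2) * (⟪m + ε • (z - m), p.1⟫ - p.2) := by
    rw [Filter.eventually_all_finset]
    intro p hp
    refine Filter.Eventually.filter_mono nhdsWithin_le_nhds ?_
    have hcont : Continuous fun ε : ℝ =>
        (⟪x₀, p.1⟫ - p.2) * (⟪m + ε • (z - m), p.1⟫ - p.2) := by fun_prop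
    refine hcont.continuousAt.eventually (p := fun t => 0 < t) ?_
    simpa using lt_mem_nhds (hmS p hp)
  have hev2 : ∀ᶠ ε : ℝ in nhdsWithin 0 (Set.Ioi 0), ε ∈ Set.Ioo (0 : ℝ) 1 :=
    Ioo_mem_nhdsGT one_pos
  obtain ⟨ε, hε, hε01⟩ := (hev.and hev2).exists
  have h8 := h3 (m + ε • (z - m))
    ⟨hC.add_smul_sub_mem hmP.1 hz ⟨hε01.1.le, hε01.2.le⟩, fun p hp => (hε p hp).le⟩
  rw [show m + ε • (z - m) - x = (1 - ε) • (m - x) + ε • (z - x) by module, inner_add_left,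
    real_inner_smul_left, real_inner_smul_left, hmν, mul_zero, zero_add] at h8
  by_contra! hneg
  nlinarith [mul_pos hε01.1 hneg]

/-- A facet of a piece on a cutting line: the reflected piece is a piece. -/
lemma IsFolding.reflection_mem (hF : IsFolding S C) {P : Set (Euc 2)} (hP : P ∈ cutPieces S C)
    {p : Euc 2 × ℝ} (hp : p ∈ S) {ν x : Euc 2} (hfac : IsFacet P ν x) (hline : IsLineAt p ν x) :
    affReflection p.1 p.2 '' P ∈ cutPieces S C := by
  obtain ⟨Q, hQ, hPQ⟩ := hF.reflect P hP p hp (hfac.isBoundingHyperplane hline)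
  have hclosed : ∀ P ∈ cutPieces S C, IsCompact P := by
    rintro P ⟨y, -, -, rfl⟩
    exact hF.isCompact.of_isClosed_subset (isClosed_cutPiece hF.isCompact.isClosed y)
      (cutPiece_subset y)
  have hQc : Convex ℝ Q := by
    obtain ⟨y, -, -, rfl⟩ := hQ
    exact convex_cutPiece hF.convex y
  have hQi : (interior Q).Nonempty := by
    obtain ⟨d, rfl⟩ := hF.similar Q hQ
    obtain ⟨r, L, v, hr, hd⟩ := exists_eq_simMap d
    have h : d '' C = simHomeo hr.ne' L v '' C := Set.image_congr fun y _ => hd y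
    rw [h, ← (simHomeo hr.ne' L v).image_interior]
    exact hF.nonempty_interior.image _
  have hvol : volume (affReflection p.1 p.2 '' P) = volume Q := by
    obtain ⟨g, rfl⟩ := hF.congruent P hP Q hQ
    rw [volume_isometryEquiv_image, volume_isometryEquiv_image]
  have himc : IsCompact (affReflection p.1 p.2 '' P) :=
    (hclosed P hP).image (affReflection p.1 p.2).continuous
  have heq : affReflection p.1 p.2 '' P = Q := by
    -- The mirror image has the volume of the piece Q that contains it, so the open part of Q
    -- outside it is null, hence empty; Q is the closure of its interior.
    apply Set.Subset.antisymm hPQ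
    have h1 : interior Q ⊆ affReflection p.1 p.2 '' P := by
      by_contra hnot
      rw [Set.not_subset] at hnot
      obtain ⟨y, hy, hyn⟩ := hnot
      have hO : IsOpen (interior Q \ affReflection p.1 p.2 '' P) :=
        isOpen_interior.sdiff himc.isClosed
      have h2 := hO.measure_pos volume ⟨y, hy, hyn⟩
      have h3 : volume (Q \ affReflection p.1 p.2 '' P) = 0 := by
        rw [measure_sdiff hPQ himc.measurableSet.nullMeasurableSet himc.measure_lt_top.ne, hvol,
          tsub_self]
      exact h2.ne' (measure_mono_null (Set.sdiff_subset_sdiff_left interior_subset) h3)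
    have h4 := hQc.closure_interior_eq_closure_of_nonempty_interior hQi
    calc Q ⊆ closure Q := subset_closure
      _ = closure (interior Q) := h4.symm
      _ ⊆ _ := closure_minimal h1 himc.isClosed
  rw [heq]
  exact hQ

end Corner

/-! ### Folding a piece round a corner -/

section Rotation

variable {S : Finset (Euc 2 × ℝ)} {C : Set (Euc 2)}

/-- The direction at angle `t` in the frame `e, f`. -/
def rayDir (e f : Euc 2) (t : ℝ) : Euc 2 := Real.cos t • e + Real.sin t • f

/-- The normal at angle `t` in the frame `e, f`. -/
def rayNormal (e f : Euc 2) (t : ℝ) : Euc 2 := -(Real.sin t) • e + Real.cos t • f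

variable {e f : Euc 2}

lemma inner_frame (he : ‖e‖ = 1) (hf : ‖f‖ = 1) (hef : ⟪e, f⟫ = 0) (a b c d : ℝ) :
    ⟪a • e + b • f, c • e + d • f⟫ = a * c + b * d := by
  simp only [inner_add_left, inner_add_right, real_inner_smul_left, real_inner_smul_right,
    inner_self_of_norm_eq_one he, inner_self_of_norm_eq_one hf, hef, real_inner_comm e f]
  ring

lemma inner_rayDir_rayNormal (he : ‖e‖ = 1) (hf : ‖f‖ = 1) (hef : ⟪e, f⟫ = 0) (s t : ℝ) :
    ⟪rayDir e f s, rayNormal e f t⟫ = Real.sin (s - t) := by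
  rw [rayDir, rayNormal, inner_frame he hf hef, Real.sin_sub]
  ring

lemma inner_rayNormal_rayNormal (he : ‖e‖ = 1) (hf : ‖f‖ = 1) (hef : ⟪e, f⟫ = 0) (s t : ℝ) :
    ⟪rayNormal e f s, rayNormal e f t⟫ = Real.cos (s - t) := by
  rw [rayNormal, rayNormal, inner_frame he hf hef, Real.cos_sub]
  ring

lemma norm_rayNormal (he : ‖e‖ = 1) (hf : ‖f‖ = 1) (hef : ⟪e, f⟫ = 0) (t : ℝ) :
    ‖rayNormal e f t‖ = 1 := by
  rw [← sq_eq_sq₀ (norm_nonneg _) zero_le_one, ← real_inner_self_eq_norm_sq,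
    inner_rayNormal_rayNormal he hf hef, sub_self, Real.cos_zero, one_pow]

lemma norm_rayDir (he : ‖e‖ = 1) (hf : ‖f‖ = 1) (hef : ⟪e, f⟫ = 0) (t : ℝ) :
    ‖rayDir e f t‖ = 1 := by
  rw [← sq_eq_sq₀ (norm_nonneg _) zero_le_one, ← real_inner_self_eq_norm_sq, rayDir,
    inner_frame he hf hef, one_pow]
  linarith [Real.sin_sq_add_cos_sq t]

lemma rayNormal_reflect (s t : ℝ) :
    rayNormal e f s - (2 * Real.cos (s - t)) • rayNormal e f t = -rayNormal e f (2 * t - s) := by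
  have h1 : Real.sin (2 * t - s) = -Real.sin s + 2 * Real.cos (s - t) * Real.sin t := by
    rw [show 2 * t - s = t - (s - t) by ring, show s = (s - t) + t by ring, Real.sin_sub,
      Real.sin_add, show s - t + t - t = s - t by ring]
    ring
  have h2 : Real.cos (2 * t - s) = -Real.cos s + 2 * Real.cos (s - t) * Real.cos t := by
    rw [show 2 * t - s = t - (s - t) by ring, show s = (s - t) + t by ring, Real.cos_sub,
      Real.cos_add, show s - t + t - t = s - t by ring]
    ring
  rw [rayNormal, rayNormal, rayNormal, h1, h2]
  module

/-- Angles that are not of the form `π / m`. -/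
def IsBadAngle (θ : ℝ) : Prop := 0 < θ ∧ θ < Real.pi ∧ ∀ m : ℕ, 2 ≤ m → θ ≠ Real.pi / m

/-- Reflecting a piece around one of its corners on a cutting line, one reaches the boundary of
the figure. -/
lemma IsFolding.exists_isFacet_multiple (hF : IsFolding S C) {x : Euc 2} (he : ‖e‖ = 1)
    (hf : ‖f‖ = 1) (hef : ⟪e, f⟫ = 0) {θ : ℝ} (hθ : IsBadAngle θ) {p : Euc 2 × ℝ} (hp : p ∈ S)
    (hpf : IsLineAt p f x) {P : Set (Euc 2)} (hP : P ∈ cutPieces S C) (h0 : IsFacet P (-f) x)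
    (h1 : IsFacet P (rayNormal e f θ) x) :
    ∃ a : ℕ, 1 ≤ a ∧ a * θ < Real.pi ∧ IsFacet C (rayNormal e f (a * θ)) x ∧
      ∃ c : ℝ, 0 < c ∧ x + c • rayDir e f (a * θ) ∈ C := by
  obtain ⟨hθ0, hθπ, hbad⟩ := hθ
  by_contra hcon
  have hsub : ∀ P ∈ cutPieces S C, P ⊆ C := by
    rintro P ⟨x, -, -, rfl⟩
    exact cutPiece_subset x
  have hsinθ : 0 < Real.sin θ := Real.sin_pos_of_pos_of_lt_pi hθ0 hθπ
  -- After k foldings the piece fills the sector at x between the angles kθ and (k + 1)θ.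
  have key : ∀ k : ℕ, ∃ Q ∈ cutPieces S C, IsFacet Q (-rayNormal e f (k * θ)) x ∧
      IsFacet Q (rayNormal e f ((k + 1) * θ)) x ∧ k * θ < Real.pi := by
    intro k
    induction k with
    | zero =>
      refine ⟨P, hP, ?_, by simpa using h1, by simpa using Real.pi_pos⟩
      simpa [rayNormal] using h0
    | succ k ih =>
      obtain ⟨Q, hQ, hlow, hup, hk⟩ := ih
      obtain ⟨c, hc, hcQ⟩ := hup.exists_add_smul_mem (μ := -rayNormal e f (k * θ))
        (norm_rayDir he hf hef ((k + 1) * θ))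
        (by rw [inner_rayDir_rayNormal he hf hef, sub_self, Real.sin_zero]) hlow.2.2.1
        (by
          rw [inner_neg_right, inner_rayDir_rayNormal he hf hef,
            show ((k : ℝ) + 1) * θ - k * θ = θ by ring]
          linarith)
      -- A sector ending exactly at π would make θ good, and one passing π would belong to a piece
      -- with points strictly on both sides of the cutting line p.
      have hlt : ((k : ℝ) + 1) * θ < Real.pi := by
        rcases Nat.eq_zero_or_pos k with h0 | hkpos
        · rw [h0]
          simpa using hθπ
        by_contra! hge
        rcases hge.eq_or_lt with heq | hgt
        · refine hbad (k + 1) (by omega) ?_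
          push_cast
          rw [eq_div_iff (by positivity), heq]
          ring
        · obtain ⟨c₀, hc₀, hc₀Q⟩ := hlow.exists_add_smul_mem (u := rayDir e f (k * θ))
            (μ := rayNormal e f ((k + 1) * θ)) (norm_rayDir he hf hef _)
            (by rw [inner_neg_right, inner_rayDir_rayNormal he hf hef, sub_self, Real.sin_zero,
              neg_zero]) hup.2.2.1
            (by
              rw [inner_rayDir_rayNormal he hf hef,
                show (k : ℝ) * θ - (k + 1) * θ = -θ by ring, Real.sin_neg]
              linarith)
          have hs1 : 0 < Real.sin (k * θ) := by
            have : (0 : ℝ) < k := by exact_mod_cast hkpos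
            exact Real.sin_pos_of_pos_of_lt_pi (by positivity) hk
          have hs2 : Real.sin ((k + 1) * θ) < 0 := by
            rw [← Real.sin_sub_two_pi]
            exact Real.sin_neg_of_neg_of_neg_pi_lt (by nlinarith) (by linarith)
          obtain ⟨y, -, hy, rfl⟩ := hQ
          obtain ⟨hpx, l, hl, hpl⟩ := hpf
          have hval : ∀ (c t : ℝ), ⟪x + c • rayDir e f t, p.1⟫ - p.2 = l * (c * Real.sin t) := by
            intro c t
            have h := inner_rayDir_rayNormal he hf hef t 0
            rw [rayNormal, Real.sin_zero, Real.cos_zero, neg_zero, zero_smul, zero_add, one_smul,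
              sub_zero] at h
            rw [inner_add_left, hpx, add_sub_cancel_left, hpl, real_inner_smul_left,
              real_inner_smul_right, h]
            ring
          have e1 := hcQ.2 p hp
          have e2 := hc₀Q.2 p hp
          rw [hval] at e1 e2
          have hA := sub_ne_zero.mpr (hy p hp)
          have e3 : 0 < ((⟪y, p.1⟫ - p.2) * l) ^ 2 := by positivity
          have e4 := mul_nonneg e1 e2
          have e5 : 0 < c * c₀ * (Real.sin (k * θ) * -Real.sin ((k + 1) * θ)) := by
            have : 0 < -Real.sin ((k + 1) * θ) := by linarith
            positivity
          nlinarith [mul_pos e3 e5]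
      obtain ⟨y, hyC, hy, rfl⟩ := hQ
      have hQ : cutPiece S C y ∈ cutPieces S C := ⟨y, hyC, hy, rfl⟩
      -- Either the upper side of the sector bounds C, and the process stops, or it lies on a
      -- cutting line, and reflecting in it gives the next piece.
      rcases IsFacet.of_cutPiece hF.convex hy hup with hC | ⟨p', hp', hline⟩
      · exfalso
        exact hcon ⟨k + 1, by omega, by exact_mod_cast hlt, by exact_mod_cast hC, c, hc,
          by exact_mod_cast hsub _ hQ hcQ⟩
      · refine ⟨_, hF.reflection_mem hQ hp' hup hline, ?_, ?_, by exact_mod_cast hlt⟩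
        · have h := hup.image_reflection (norm_rayNormal he hf hef _) hline
          rw [inner_self_of_norm_eq_one (norm_rayNormal he hf hef _)] at h
          convert h using 1
          push_cast
          module
        · have h := hlow.image_reflection (norm_rayNormal he hf hef _) hline
          convert h using 1
          rw [inner_neg_left, inner_rayNormal_rayNormal he hf hef]
          have h2 := rayNormal_reflect (e := e) (f := f) (k * θ) (((k : ℝ) + 1) * θ)
          rw [show 2 * (((k : ℝ) + 1) * θ) - k * θ = (k + 1 + 1) * θ by ring] at h2
          push_cast
          rw [← neg_neg (rayNormal e f ((k + 1 + 1) * θ)), ← h2]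
          module
  -- The process cannot go on forever, since kθ stays below π.
  obtain ⟨k, hk⟩ := exists_nat_gt (Real.pi / θ)
  obtain ⟨-, -, -, -, hlt⟩ := key k
  rw [div_lt_iff₀ hθ0] at hk
  linarith

/-- If all larger corner angles of the figure are good, the facets of a piece at a bad corner do
not lie on cutting lines. -/
lemma IsFolding.not_isLineAt_of_isBadAngle (hF : IsFolding S C) {θ : ℝ} (hθ : IsBadAngle θ)
    (hmax : ∀ (x ν ν' : Euc 2) (φ : ℝ), IsFacet C ν x → IsFacet C ν' x →
      ⟪ν, ν'⟫ = -Real.cos φ → θ < φ → ¬ IsBadAngle φ)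
    {P : Set (Euc 2)} (hP : P ∈ cutPieces S C) {ν ν' x : Euc 2} (h : IsFacet P ν x)
    (h' : IsFacet P ν' x) (hνν : ⟪ν, ν'⟫ = -Real.cos θ) {p : Euc 2 × ℝ} (hp : p ∈ S) :
    ¬ IsLineAt p ν x := by
  intro hline
  have hθ' := hθ
  obtain ⟨hθ0, hθπ, hbad⟩ := hθ'
  have hν := h.1
  have hsinθ : 0 < Real.sin θ := Real.sin_pos_of_pos_of_lt_pi hθ0 hθπ
  -- The sign of e is chosen so that P fills the sector from 0 to θ in the frame e, -ν.
  obtain ⟨e, he, heν, heν'⟩ : ∃ e : Euc 2, ‖e‖ = 1 ∧ ⟪e, ν⟫ = 0 ∧ ⟪ν', e⟫ = -Real.sin θ := by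
    obtain ⟨e, he, heν⟩ := exists_unit_perp hν
    have h1 := eq_frame_sum he hν heν ν'
    have h2 := inner_frame he hν heν ⟪ν', e⟫ ⟪ν', ν⟫ ⟪ν', e⟫ ⟪ν', ν⟫
    rw [← h1, inner_self_of_norm_eq_one h'.1, real_inner_comm ν ν', hνν] at h2
    have h3 : (⟪ν', e⟫ - Real.sin θ) * (⟪ν', e⟫ + Real.sin θ) = 0 := by
      linear_combination -h2 - Real.sin_sq_add_cos_sq θ
    rcases mul_eq_zero.mp h3 with h4 | h4
    · exact ⟨-e, by rw [norm_neg, he], by rw [inner_neg_left, heν, neg_zero],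
        by rw [inner_neg_right]; linarith⟩
    · exact ⟨e, he, heν, by linarith⟩
  have hnν : ‖-ν‖ = 1 := by rw [norm_neg, hν]
  have henν : ⟪e, -ν⟫ = 0 := by rw [inner_neg_right, heν, neg_zero]
  have hν'eq : ν' = rayNormal e (-ν) θ := by
    rw [eq_frame_sum he hν heν ν', heν', real_inner_comm, hνν, rayNormal]
    module
  have hline' : IsLineAt p (-ν) x := by
    obtain ⟨h1, c, hc, h2⟩ := hline
    exact ⟨h1, -c, neg_ne_zero.mpr hc, by rw [h2]; module⟩
  -- Folding P one way round x reaches a side of C at angle aθ; its mirror image, folded the other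
  -- way, reaches one at angle -bθ.
  obtain ⟨a, ha1, haπ, haC, c, hc, hcC⟩ := hF.exists_isFacet_multiple he hnν henν hθ hp hline' hP
    (by rw [neg_neg]; exact h) (hν'eq ▸ h')
  have hP' := hF.reflection_mem hP hp h hline
  have hr0 := h.image_reflection hν hline
  have hr1 := h'.image_reflection hν hline
  obtain ⟨b, hb1, hbπ, hbC, -⟩ := hF.exists_isFacet_multiple he hν heν hθ hp hline hP'
    (by
      rw [inner_self_of_norm_eq_one hν] at hr0
      convert hr0 using 1
      module)
    (by
      convert hr1 using 1
      rw [real_inner_comm, hνν, hν'eq, rayNormal, rayNormal]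
      module)
  have hflip : ∀ t, rayNormal e ν t = -rayNormal e (-ν) (-t) := by
    intro t
    rw [rayNormal, rayNormal, Real.sin_neg, Real.cos_neg]
    module
  rw [hflip] at hbC
  have hsum : (2 : ℝ) * θ ≤ (a + b) * θ := by
    have : (2 : ℝ) ≤ a + b := by exact_mod_cast (by omega : 2 ≤ a + b)
    nlinarith
  have hαpos : 0 < (a + b) * θ := by linarith
  -- A point of C on the ray at angle aθ lies on the inner side of the facet at -bθ; as both angles
  -- are below π, the total is at most π.
  have hsin : 0 ≤ Real.sin ((a + b) * θ) := by
    have h1 := hbC.2.2.1 _ hcC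
    rw [add_sub_cancel_left, real_inner_smul_left, inner_neg_right,
      inner_rayDir_rayNormal he hnν henν, show (a : ℝ) * θ - -(b * θ) = (a + b) * θ by ring] at h1
    by_contra! hneg
    nlinarith
  have hle : (a + b) * θ ≤ Real.pi := by
    by_contra! hgt
    have h1 : Real.sin ((a + b) * θ) < 0 := by
      rw [← Real.sin_sub_two_pi]
      exact Real.sin_neg_of_neg_of_neg_pi_lt (by nlinarith) (by linarith)
    linarith
  -- A total of π makes θ good. A smaller total is a corner angle of C larger than θ; it is bad,
  -- since (a + b)θ = π/m would make θ good, and this contradicts maximality.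
  rcases hle.eq_or_lt with heq | hlt
  · refine hbad (a + b) (by omega) ?_
    push_cast
    rw [eq_div_iff (by positivity), ← heq]
    ring
  · refine hmax x _ _ ((a + b) * θ) haC hbC ?_ (by linarith) ⟨hαpos, hlt, fun m hm heq => ?_⟩
    · rw [inner_neg_right, inner_rayNormal_rayNormal he hnν henν]
      congr 2
      ring
    · refine hbad (m * (a + b)) ?_ ?_
      · nlinarith
      · have hm0 : (0 : ℝ) < m := by exact_mod_cast (by omega : 0 < m)
        have hab : (0 : ℝ) < a + b := by exact_mod_cast (by omega : 0 < a + b)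
        push_cast
        rw [eq_div_iff (by positivity)]
        rw [eq_div_iff hm0.ne'] at heq
        linarith

lemma IsFolding.isFacet_of_isBadAngle (hF : IsFolding S C) {θ : ℝ} (hθ : IsBadAngle θ)
    (hmax : ∀ (x ν ν' : Euc 2) (φ : ℝ), IsFacet C ν x → IsFacet C ν' x →
      ⟪ν, ν'⟫ = -Real.cos φ → θ < φ → ¬ IsBadAngle φ)
    {P : Set (Euc 2)} (hP : P ∈ cutPieces S C) {ν ν' x : Euc 2} (h : IsFacet P ν x)
    (h' : IsFacet P ν' x) (hνν : ⟪ν, ν'⟫ = -Real.cos θ) : IsFacet C ν x := by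
  have hP' := hP
  obtain ⟨y, -, hy, rfl⟩ := hP'
  rcases IsFacet.of_cutPiece hF.convex hy h with hC | ⟨p, hp, hline⟩
  · exact hC
  · exact absurd hline (hF.not_isLineAt_of_isBadAngle hθ hmax hP h h' hνν hp)

end Rotation

/-! ### Bad corner angles are impossible -/

section CornerAngle

variable {S s : Finset (Euc 2 × ℝ)} {C : Set (Euc 2)}

lemma inner_sub_neg_of_isFacet {ν x c : Euc 2} (h : IsFacet C ν x) (hc : c ∈ interior C) :
    ⟪c - x, ν⟫ < 0 := by
  obtain ⟨ρ, hρ, hball⟩ := Metric.isOpen_iff.mp isOpen_interior c hc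
  have h1 : c + (ρ / 2) • ν ∈ C := by
    refine interior_subset (hball ?_)
    rw [Metric.mem_ball, dist_eq_norm, add_sub_cancel_left, norm_smul, h.1, mul_one,
      Real.norm_of_nonneg (by positivity)]
    linarith
  have h2 := h.2.2.1 _ h1
  rw [add_sub_right_comm, inner_add_left, real_inner_smul_left, inner_self_of_norm_eq_one h.1] at h2
  linarith

/-- A facet of a polygon comes from one of its constraints. -/
lemma IsPolygon.exists_of_isFacet (hC : IsPolygon s C) (hCi : (interior C).Nonempty) {ν x : Euc 2}
    (h : IsFacet C ν x) : ∃ p ∈ s, p.1 = ν ∧ p.2 = ⟪x, ν⟫ := by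
  have hF := h
  obtain ⟨h1, hx, h3, y, hy, hyx, hyν⟩ := h
  obtain ⟨c, hc⟩ := hCi
  have hmemC : ∀ z, z ∈ C ↔ ∀ p ∈ s, ⟪z, p.1⟫ ≤ p.2 := fun z => by
    rw [hC.eq_polyhedron]; rfl
  set m := (1 / 2 : ℝ) • (x + y) with hm
  have hmν : ⟪m - x, ν⟫ = 0 := by
    rw [hm, show (1 / 2 : ℝ) • (x + y) - x = (1 / 2 : ℝ) • (y - x) by module,
      real_inner_smul_left, hyν, mul_zero]
  have hmi : ∀ r : Euc 2, ⟪m, r⟫ = (⟪x, r⟫ + ⟪y, r⟫) / 2 := fun r => by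
    rw [hm, real_inner_smul_left, inner_add_left]
    ring
  -- If no constraint were active at the midpoint of the segment, the midpoint could be pushed
  -- outward along ν. A constraint active there is active at both ends, so its normal is parallel to
  -- ν.
  obtain ⟨p, hp, hpm⟩ : ∃ p ∈ s, p.2 ≤ ⟪m, p.1⟫ := by
    by_contra! hcon
    have hev : ∀ᶠ ε : ℝ in nhdsWithin 0 (Set.Ioi 0), ∀ p ∈ s, ⟪m + ε • ν, p.1⟫ < p.2 := by
      rw [Filter.eventually_all_finset]
      intro p hp
      refine Filter.Eventually.filter_mono nhdsWithin_le_nhds ?_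
      have hcont : Continuous fun ε : ℝ => ⟪m + ε • ν, p.1⟫ := by fun_prop
      refine hcont.continuousAt.eventually (p := fun t => t < p.2) ?_
      simpa using gt_mem_nhds (hcon p hp)
    obtain ⟨ε, hε, hε0⟩ := (hev.and self_mem_nhdsWithin).exists
    have h4 := h3 _ ((hmemC _).mpr fun p hp => (hε p hp).le)
    rw [add_sub_right_comm, inner_add_left, hmν, real_inner_smul_left,
      inner_self_of_norm_eq_one h1] at h4
    have : 0 < ε := hε0
    linarith
  have hx' := (hmemC x).mp hx p hp
  have hy' := (hmemC y).mp hy p hp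
  rw [hmi] at hpm
  have hyx0 : y - x ≠ 0 := sub_ne_zero.mpr hyx
  have hpν := exists_eq_smul_of_inner_eq_zero hyx0 h1 hyν (v := p.1)
    (by rw [real_inner_comm, inner_sub_left]; linarith)
  have hpn := hC.norm_eq_one p hp
  have hp0 : p.1 ≠ 0 := fun h0 => by simp [h0] at hpn
  have hcp : ⟪c, p.1⟫ < p.2 := inner_lt_of_mem_interior (hC.eq_polyhedron ▸ hc) hp hp0
  have hcν := inner_sub_neg_of_isFacet hF hc
  have h5 : ⟪c - x, p.1⟫ < 0 := by rw [inner_sub_left]; linarith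
  rw [hpν, real_inner_smul_right] at h5
  have h6 : 0 < ⟪p.1, ν⟫ := by
    by_contra! hneg
    nlinarith
  have h7 : ⟪p.1, ν⟫ = 1 := by
    have h8 : ‖p.1‖ = ⟪p.1, ν⟫ := by
      conv_lhs => rw [hpν]
      rw [norm_smul, h1, mul_one, Real.norm_of_nonneg h6.le]
    rw [← h8, hpn]
  rw [h7, one_smul] at hpν
  refine ⟨p, hp, hpν, ?_⟩
  rw [← hpν]
  linarith

/-- The constraints of a polygon give facets. -/
lemma IsPolygon.isFacet (hC : IsPolygon s C) {p : Euc 2 × ℝ} (hp : p ∈ s) {x : Euc 2} (hx : x ∈ C)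
    (hxp : ⟪x, p.1⟫ = p.2) : IsFacet C p.1 x := by
  have hmemC : ∀ z, z ∈ C ↔ ∀ p ∈ s, ⟪z, p.1⟫ ≤ p.2 := fun z => by
    rw [hC.eq_polyhedron]; rfl
  refine ⟨hC.norm_eq_one p hp, hx, fun y hy => ?_, ?_⟩
  · rw [inner_sub_left, hxp]
    linarith [(hmemC y).mp hy p hp]
  · obtain ⟨w, hw, hws⟩ := hC.exists_active p hp
    have hwC : w ∈ C := (hmemC w).mpr fun q hq =>
      if h : q = p then by rw [h, hw] else (hws q hq h).le
    by_cases hwx : w = x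
    · obtain ⟨e, he, hep⟩ := exists_unit_perp (hC.norm_eq_one p hp)
      have hev : ∀ᶠ ε : ℝ in nhdsWithin 0 (Set.Ioi 0), ∀ q ∈ s, ⟪w + ε • e, q.1⟫ ≤ q.2 := by
        rw [Filter.eventually_all_finset]
        intro q hq
        by_cases hqp : q = p
        · refine Filter.Eventually.of_forall fun ε => ?_
          rw [hqp, inner_add_left, real_inner_smul_left, hep, hw, mul_zero, add_zero]
        · refine Filter.Eventually.filter_mono nhdsWithin_le_nhds ?_
          have hcont : Continuous fun ε : ℝ => ⟪w + ε • e, q.1⟫ := by fun_prop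
          refine (hcont.continuousAt.eventually (p := fun t => t < q.2) ?_).mono fun _ h => h.le
          simpa using gt_mem_nhds (hws q hq hqp)
      obtain ⟨ε, hε, hε0⟩ := (hev.and self_mem_nhdsWithin).exists
      refine ⟨w + ε • e, (hmemC _).mpr hε, ?_, ?_⟩
      · rw [← hwx]
        intro h0
        have h1 : ε • e = 0 := by simpa using h0
        rcases smul_eq_zero.mp h1 with h2 | h2
        · exact (ne_of_gt (show 0 < ε from hε0)) h2
        · rw [h2, norm_zero] at he
          exact zero_ne_one he
      · rw [← hwx, add_sub_cancel_left, real_inner_smul_left, hep, mul_zero]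
    · exact ⟨w, hwC, hwx, by rw [inner_sub_left, hw, hxp, sub_self]⟩

/-- Every corner angle of a foldable figure is of the form `π / m`. -/
lemma IsFolding.exists_corner_angle (hF : IsFolding S C) (hC : IsPolygon s C) {x₀ ν₀ ν₀' : Euc 2}
    (h₀ : IsFacet C ν₀ x₀) (h₀' : IsFacet C ν₀' x₀) (hne : ν₀ ≠ ν₀') :
    ∃ m : ℕ, 2 ≤ m ∧ ⟪ν₀, ν₀'⟫ = -Real.cos (Real.pi / m) := by
  classical
  obtain ⟨c, hc⟩ := hF.nonempty_interior
  have hangle : ∀ x ν ν', IsFacet C ν x → IsFacet C ν' x → ν ≠ ν' →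
      -1 < ⟪ν, ν'⟫ ∧ ⟪ν, ν'⟫ < 1 := by
    intro x ν ν' h h' hn
    have hab : |⟪ν, ν'⟫| ≤ 1 := by
      have := abs_real_inner_le_norm ν ν'
      rwa [h.1, h'.1, mul_one] at this
    constructor
    · refine lt_of_le_of_ne (abs_le.mp hab).1 fun heq => ?_
      have h1 := (inner_eq_neg_one_iff_of_norm_eq_one h.1 h'.1).mp heq.symm
      have h2 := inner_sub_neg_of_isFacet h hc
      have h3 := inner_sub_neg_of_isFacet h' hc
      rw [h1, inner_neg_right] at h2
      linarith
    · refine lt_of_le_of_ne (abs_le.mp hab).2 fun heq => ?_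
      exact hn ((inner_eq_one_iff_of_norm_eq_one h.1 h'.1).mp heq)
  by_contra! hcon
  -- The bad corner angles are finite in number, being determined by pairs of sides; θ will be the
  -- largest.
  set B : Set ℝ := {θ | IsBadAngle θ ∧ ∃ x ν ν', IsFacet C ν x ∧ IsFacet C ν' x ∧
    ⟪ν, ν'⟫ = -Real.cos θ} with hB
  have hBfin : B.Finite := by
    refine ((s ×ˢ s).finite_toSet.image fun q => Real.arccos (-⟪q.1.1, q.2.1⟫)).subset ?_
    rintro θ ⟨⟨h1, h2, -⟩, x, ν, ν', h, h', hi⟩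
    obtain ⟨p, hp, hpν, -⟩ := hC.exists_of_isFacet ⟨c, hc⟩ h
    obtain ⟨p', hp', hpν', -⟩ := hC.exists_of_isFacet ⟨c, hc⟩ h'
    refine ⟨(p, p'), by simp [hp, hp'], ?_⟩
    simp only
    rw [hpν, hpν', hi, neg_neg, Real.arccos_cos h1.le h2.le]
  have hBne : B.Nonempty := by
    obtain ⟨h1, h2⟩ := hangle _ _ _ h₀ h₀' hne
    have hcos : Real.cos (Real.arccos (-⟪ν₀, ν₀'⟫)) = -⟪ν₀, ν₀'⟫ :=
      Real.cos_arccos (by linarith) (by linarith)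
    refine ⟨Real.arccos (-⟪ν₀, ν₀'⟫), ⟨Real.arccos_pos.mpr (by linarith), ?_, ?_⟩,
      x₀, ν₀, ν₀', h₀, h₀', by rw [hcos, neg_neg]⟩
    · refine lt_of_le_of_ne (Real.arccos_le_pi _) fun h => ?_
      rw [Real.arccos_eq_pi] at h
      linarith
    · intro m hm h
      apply hcon m hm
      rw [← h, hcos, neg_neg]
  obtain ⟨θ, ⟨hθbad, x₁, ν₁, ν₁', h₁, h₁', hi₁⟩, hθmax⟩ := hBfin.exists_maximal hBne
  have hmax : ∀ (x ν ν' : Euc 2) (φ : ℝ), IsFacet C ν x → IsFacet C ν' x →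
      ⟪ν, ν'⟫ = -Real.cos φ → θ < φ → ¬ IsBadAngle φ := by
    intro x ν ν' φ h h' hi hlt hbad
    exact absurd (hθmax (show φ ∈ B from ⟨hbad, x, ν, ν', h, h', hi⟩) hlt.le) (not_le.mpr hlt)
  set W : Set (Euc 2 × Euc 2 × Euc 2) := {w | IsFacet C w.2.1 w.1 ∧ IsFacet C w.2.2 w.1 ∧
    ⟪w.2.1, w.2.2⟫ = -Real.cos θ} with hW
  have hcos : -1 < Real.cos θ ∧ Real.cos θ < 1 := by
    constructor
    · rw [← Real.cos_pi]
      exact Real.cos_lt_cos_of_nonneg_of_le_pi hθbad.1.le le_rfl hθbad.2.1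
    · rw [← Real.cos_zero]
      exact Real.cos_lt_cos_of_nonneg_of_le_pi le_rfl hθbad.2.1.le hθbad.1
  have hindep : ∀ {ν ν' v : Euc 2}, ‖ν‖ = 1 → ‖ν'‖ = 1 → ⟪ν, ν'⟫ = -Real.cos θ → ⟪v, ν⟫ = 0 →
      ⟪v, ν'⟫ = 0 → v = 0 := by
    intro ν ν' v h h' hi hv hv'
    by_contra hv0
    have h1 := exists_eq_smul_of_inner_eq_zero hv0 h hv (v := ν') (by rw [real_inner_comm]; exact hv')
    have h2 : ‖ν'‖ = |⟪ν', ν⟫| := by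
      conv_lhs => rw [h1]
      rw [norm_smul, h, mul_one, Real.norm_eq_abs]
    rw [h', real_inner_comm, hi, abs_neg] at h2
    have := abs_lt.mpr hcos
    linarith
  have hWfin : W.Finite := by
    refine Set.Finite.of_finite_image (f := Prod.snd) ?_ ?_
    · refine ((s ×ˢ s).finite_toSet.image fun q => (q.1.1, q.2.1)).subset ?_
      rintro _ ⟨⟨x, ν, ν'⟩, ⟨h, h', hi⟩, rfl⟩
      obtain ⟨p, hp, hpν, -⟩ := hC.exists_of_isFacet ⟨c, hc⟩ h
      obtain ⟨p', hp', hpν', -⟩ := hC.exists_of_isFacet ⟨c, hc⟩ h'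
      exact ⟨(p, p'), by simp [hp, hp'], by simp [hpν, hpν']⟩
    · rintro ⟨x, ν, ν'⟩ ⟨h, h', hi⟩ ⟨y, μ, μ'⟩ ⟨g, g', -⟩ heq
      simp only [Prod.mk.injEq] at heq
      obtain ⟨rfl, rfl⟩ := heq
      simp only at h h' hi g g'
      have e1 : ⟪x - y, ν⟫ = 0 := by
        have t1 := h.2.2.1 y g.2.1
        have t2 := g.2.2.1 x h.2.1
        rw [inner_sub_left] at t1 t2 ⊢
        linarith
      have e2 : ⟪x - y, ν'⟫ = 0 := by
        have t1 := h'.2.2.1 y g.2.1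
        have t2 := g'.2.2.1 x h.2.1
        rw [inner_sub_left] at t1 t2 ⊢
        linarith
      rw [sub_eq_zero.mp (hindep h.1 h'.1 hi e1 e2)]
  -- The similarity from C to P sends θ-corners of C to θ-corners of P, which are again θ-corners of
  -- C. An injective self-map of a finite set is onto, so P has every θ-corner of C.
  have hWP : ∀ P ∈ cutPieces S C, IsFacet P ν₁ x₁ ∧ IsFacet P ν₁' x₁ := by
    intro P hP
    obtain ⟨d, rfl⟩ := hF.similar P hP
    obtain ⟨r, L, v, hr, hd⟩ := exists_eq_simMap d
    have hdC : d '' C = simMap r L v '' C := Set.image_congr fun y _ => hd y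
    rw [hdC] at hP ⊢
    set F : Euc 2 × Euc 2 × Euc 2 → Euc 2 × Euc 2 × Euc 2 :=
      fun w => (simMap r L v w.1, L w.2.1, L w.2.2) with hFdef
    have hFinj : Function.Injective F := by
      rintro ⟨x, ν, ν'⟩ ⟨y, μ, μ'⟩ heq
      simp only [hFdef, Prod.mk.injEq, L.injective.eq_iff] at heq
      obtain ⟨e1, rfl, rfl⟩ := heq
      rw [(simHomeo hr.ne' L v).injective e1]
    have hFP : ∀ w ∈ W, IsFacet (simMap r L v '' C) (F w).2.1 (F w).1 ∧
        IsFacet (simMap r L v '' C) (F w).2.2 (F w).1 ∧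
        ⟪(F w).2.1, (F w).2.2⟫ = -Real.cos θ := by
      rintro w ⟨h, h', hi⟩
      exact ⟨h.image_simMap hr L v, h'.image_simMap hr L v, by rw [← hi]; exact L.inner_map_map _ _⟩
    have hFW : F '' W ⊆ W := by
      rintro _ ⟨w, hw, rfl⟩
      obtain ⟨h, h', hi⟩ := hFP w hw
      exact ⟨hF.isFacet_of_isBadAngle hθbad hmax hP h h' hi,
        hF.isFacet_of_isBadAngle hθbad hmax hP h' h (by rw [real_inner_comm]; exact hi), hi⟩
    have heq : F '' W = W := Set.eq_of_subset_of_ncard_le hFW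
      (Set.ncard_image_of_injective W hFinj).ge hWfin
    have hw : (x₁, ν₁, ν₁') ∈ F '' W := by
      rw [heq]
      exact ⟨h₁, h₁', hi₁⟩
    obtain ⟨w, hw, hwe⟩ := hw
    obtain ⟨h, h', -⟩ := hFP w hw
    rw [hwe] at h h'
    exact ⟨h, h'⟩
  obtain ⟨P, hP, Q, hQ, hPQ⟩ := hF.nontrivial
  obtain ⟨p, hp, hsep⟩ := exists_separating_hyperplane hP hQ hPQ
  have hconv : ∀ P ∈ cutPieces S C, Convex ℝ P := by
    rintro P ⟨y, -, -, rfl⟩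
    exact convex_cutPiece hF.convex y
  -- Two pieces share an initial segment of each side at the corner x₁, so the line separating them
  -- contains both segments, although these are not parallel.
  have hdir : ∀ {ν ν' : Euc 2}, ⟪ν, ν'⟫ = -Real.cos θ →
      (∀ P ∈ cutPieces S C, IsFacet P ν x₁ ∧ IsFacet P ν' x₁) →
      ∃ u, ‖u‖ = 1 ∧ ⟪u, ν⟫ = 0 ∧ ⟪u, p.1⟫ = 0 := by
    intro ν ν' hi hall
    have hν := (hall P hP).1.1
    have hν' := (hall P hP).2.1
    obtain ⟨u, hu, huν, huν'⟩ : ∃ u, ‖u‖ = 1 ∧ ⟪u, ν⟫ = 0 ∧ ⟪u, ν'⟫ < 0 := by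
      obtain ⟨e, he, heν⟩ := exists_unit_perp hν
      have h1 : ⟪e, ν'⟫ ≠ 0 := fun h0 => by
        rw [hindep hν hν' hi heν h0, norm_zero] at he
        exact zero_ne_one he
      rcases lt_or_gt_of_ne h1 with h2 | h2
      · exact ⟨e, he, heν, h2⟩
      · exact ⟨-e, by rw [norm_neg, he], by rw [inner_neg_left, heν, neg_zero],
          by rw [inner_neg_left]; linarith⟩
    refine ⟨u, hu, huν, ?_⟩
    obtain ⟨a, ha, haP⟩ := (hall P hP).1.exists_add_smul_mem hu huν (hall P hP).2.2.2.1 huν'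
    obtain ⟨b, hb, hbQ⟩ := (hall Q hQ).1.exists_add_smul_mem hu huν (hall Q hQ).2.2.2.1 huν'
    have hmem : ∀ {K : Set (Euc 2)} {t : ℝ}, Convex ℝ K → x₁ ∈ K → 0 < t → min a b ≤ t →
        x₁ + t • u ∈ K → x₁ + min a b • u ∈ K := by
      intro K t hK hx ht hle hmem
      have h2 := hK.add_smul_mem hx hmem (t := min a b / t)
        ⟨div_nonneg (lt_min ha hb).le ht.le, (div_le_one ht).mpr hle⟩
      rwa [smul_smul, div_mul_cancel₀ _ ht.ne'] at h2
    have h3 := hsep _ (hmem (hconv P hP) (hall P hP).1.2.1 ha (min_le_left a b) haP)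
      (hmem (hconv Q hQ) (hall Q hQ).1.2.1 hb (min_le_right a b) hbQ)
    have h4 := hsep _ (hall P hP).1.2.1 (hall Q hQ).1.2.1
    rw [inner_add_left, h4, real_inner_smul_left, add_eq_left] at h3
    exact (mul_eq_zero.mp h3).resolve_left (lt_min ha hb).ne'
  obtain ⟨u, hu, huν, hup⟩ := hdir hi₁ hWP
  obtain ⟨u', hu', huν', hup'⟩ := hdir (by rw [real_inner_comm]; exact hi₁)
    fun P hP => (hWP P hP).symm
  have hu0 : u ≠ 0 := fun h0 => by simp [h0] at hu
  have hp1 := exists_eq_smul_of_inner_eq_zero hu0 h₁.1 huν (v := p.1)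
    (by rw [real_inner_comm]; exact hup)
  rw [hp1, real_inner_smul_right] at hup'
  rcases mul_eq_zero.mp hup' with h0 | h0
  · rw [h0, zero_smul] at hp1
    exact hF.ne_zero p hp hp1
  · have := hindep h₁.1 h₁'.1 hi₁ h0 huν'
    rw [this, norm_zero] at hu'
    exact zero_ne_one hu'

end CornerAngle

/-! ### Polygons with corner angles `π / m` -/

section Classification

variable {s : Finset (Euc 2 × ℝ)} {C : Set (Euc 2)}

/-- All corner angles of `C` are of the form `π / m`. -/
def HasReflectionAngles (C : Set (Euc 2)) : Prop :=
  ∀ x ν ν' : Euc 2, IsFacet C ν x → IsFacet C ν' x → ν ≠ ν' →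
    ∃ m : ℕ, 2 ≤ m ∧ ⟪ν, ν'⟫ = -Real.cos (Real.pi / m)

lemma IsPolygon.mem_iff (hC : IsPolygon s C) {z : Euc 2} : z ∈ C ↔ ∀ p ∈ s, ⟪z, p.1⟫ ≤ p.2 := by
  rw [hC.eq_polyhedron]; rfl

lemma IsPolygon.exists_mem_active (hC : IsPolygon s C) {p : Euc 2 × ℝ} (hp : p ∈ s) :
    ∃ w ∈ C, ⟪w, p.1⟫ = p.2 ∧ ∀ q ∈ s, q ≠ p → ⟪w, q.1⟫ < q.2 := by
  obtain ⟨w, hw, hws⟩ := hC.exists_active p hp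
  exact ⟨w, hC.mem_iff.mpr fun q hq =>
      if h : q = p then by rw [h, hw] else (hws q hq h).le, hw, hws⟩

lemma cos_pi_div_nonneg {m : ℕ} (hm : 2 ≤ m) : 0 ≤ Real.cos (Real.pi / m) := by
  have h2 : (2 : ℝ) ≤ m := by exact_mod_cast hm
  refine Real.cos_nonneg_of_neg_pi_div_two_le_of_le ?_ ?_
  · have : 0 ≤ Real.pi / m := by positivity
    linarith [Real.pi_pos]
  · exact div_le_div_of_nonneg_left Real.pi_pos.le two_pos h2

lemma sin_pi_div_pos {m : ℕ} (hm : 2 ≤ m) : 0 < Real.sin (Real.pi / m) := by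
  have h2 : (2 : ℝ) ≤ m := by exact_mod_cast hm
  refine Real.sin_pos_of_pos_of_lt_pi (by positivity) ?_
  rw [div_lt_iff₀ (by linarith)]
  nlinarith [Real.pi_pos]

/-- At the end of the side `p` in the direction `u` there is another side. -/
lemma IsPolygon.exists_side_end (hC : IsPolygon s C) (hCc : IsCompact C)
    (hCa : HasReflectionAngles C) {p : Euc 2 × ℝ} (hp : p ∈ s) {u : Euc 2} (hu : ‖u‖ = 1)
    (hup : ⟪u, p.1⟫ = 0) :
    ∃ q ∈ s, ∃ m : ℕ, 2 ≤ m ∧ ⟪p.1, q.1⟫ = -Real.cos (Real.pi / m) ∧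
      ⟪q.1, u⟫ = Real.sin (Real.pi / m) ∧
      ∃ x ∈ C, ⟪x, p.1⟫ = p.2 ∧ ∀ y ∈ C, ⟪y, u⟫ ≤ ⟪x, u⟫ := by
  obtain ⟨w, hwC, hwp, -⟩ := hC.exists_mem_active hp
  -- The end of the side maximizes the component along u; if no other active constraint opposed u
  -- there, the side would extend further.
  have hK : IsCompact (C ∩ {y | ⟪y, p.1⟫ = p.2}) :=
    hCc.inter_right (isClosed_eq (by fun_prop) (by fun_prop))
  obtain ⟨x, ⟨hxC, hxp⟩, hxmax⟩ := hK.exists_isMaxOn ⟨w, hwC, hwp⟩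
    (f := fun y => (⟪y, u⟫ : ℝ)) (by fun_prop)
  have hxp' : ⟪x, p.1⟫ = p.2 := hxp
  obtain ⟨q, hq, hqx, hqu⟩ : ∃ q ∈ s, ⟪x, q.1⟫ = q.2 ∧ 0 < ⟪u, q.1⟫ := by
    by_contra! hcon
    have hev : ∀ᶠ ε : ℝ in nhdsWithin 0 (Set.Ioi 0), ∀ q ∈ s, ⟪x + ε • u, q.1⟫ ≤ q.2 := by
      rw [Filter.eventually_all_finset]
      intro q hq
      rcases (hC.mem_iff.mp hxC q hq).eq_or_lt with h | h
      · filter_upwards [self_mem_nhdsWithin] with ε hε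
        rw [inner_add_left, real_inner_smul_left, h]
        nlinarith [hcon q hq h, show (0 : ℝ) < ε from hε]
      · refine Filter.Eventually.filter_mono nhdsWithin_le_nhds ?_
        have hcont : Continuous fun ε : ℝ => ⟪x + ε • u, q.1⟫ := by fun_prop
        refine (hcont.continuousAt.eventually (p := fun t => t < q.2) ?_).mono fun _ h => h.le
        simpa using gt_mem_nhds h
    obtain ⟨ε, hε, hε0⟩ := (hev.and self_mem_nhdsWithin).exists
    have h1 : x + ε • u ∈ C ∩ {y | ⟪y, p.1⟫ = p.2} := by
      refine ⟨hC.mem_iff.mpr hε, ?_⟩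
      change ⟪x + ε • u, p.1⟫ = p.2
      rw [inner_add_left, real_inner_smul_left, hup, mul_zero, add_zero, hxp']
    have h2 : ⟪x + ε • u, u⟫ ≤ ⟪x, u⟫ := hxmax h1
    rw [inner_add_left, real_inner_smul_left, inner_self_of_norm_eq_one hu] at h2
    have : 0 < ε := hε0
    linarith
  have hne : p.1 ≠ q.1 := fun h => by rw [← h, hup] at hqu; exact lt_irrefl _ hqu
  obtain ⟨m, hm, hpq⟩ := hCa x _ _ (hC.isFacet hp hxC hxp') (hC.isFacet hq hxC hqx) hne
  have hsin := sin_pi_div_pos hm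
  have hpn := hC.norm_eq_one p hp
  have hqu' : ⟪q.1, u⟫ = Real.sin (Real.pi / m) := by
    have h1 := eq_frame_sum hu hpn hup q.1
    have h2 := inner_frame hu hpn hup ⟪q.1, u⟫ ⟪q.1, p.1⟫ ⟪q.1, u⟫ ⟪q.1, p.1⟫
    rw [← h1, inner_self_of_norm_eq_one (hC.norm_eq_one q hq), real_inner_comm p.1 q.1, hpq] at h2
    rw [real_inner_comm] at hqu
    have h3 : (⟪q.1, u⟫ - Real.sin (Real.pi / m)) * (⟪q.1, u⟫ + Real.sin (Real.pi / m)) = 0 := by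
      linear_combination -h2 - Real.sin_sq_add_cos_sq (Real.pi / m)
    rcases mul_eq_zero.mp h3 with h4 | h4 <;> linarith
  refine ⟨q, hq, m, hm, hpq, hqu', x, hxC, hxp', fun y hy => ?_⟩
  -- The corner angle is at most π/2, so the constraints of p and q together keep all of C from
  -- going beyond x in the direction u.
  have h1 : ⟪y - x, q.1⟫ ≤ 0 := by
    rw [inner_sub_left, hqx]
    linarith [hC.mem_iff.mp hy q hq]
  have h2 : ⟪y - x, p.1⟫ ≤ 0 := by
    rw [inner_sub_left, hxp']
    linarith [hC.mem_iff.mp hy p hp]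
  rw [eq_frame_sum hu hpn hup q.1, hqu', real_inner_comm p.1 q.1, hpq, inner_add_right,
    real_inner_smul_right, real_inner_smul_right] at h1
  have h3 : ⟪y - x, u⟫ ≤ 0 := by
    by_contra! hneg
    nlinarith [mul_pos hsin hneg, mul_nonneg_of_nonpos_of_nonpos h2
      (neg_nonpos.mpr (cos_pi_div_nonneg hm))]
  rw [inner_sub_left] at h3
  linarith

/-- The outer normals of different sides do not form acute angles. -/
lemma IsPolygon.inner_nonpos (hC : IsPolygon s C) (hCc : IsCompact C)
    (hCa : HasReflectionAngles C) {p q : Euc 2 × ℝ} (hp : p ∈ s) (hq : q ∈ s) (hpq : p ≠ q) :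
    ⟪p.1, q.1⟫ ≤ 0 := by
  by_contra! hpos
  have hpn := hC.norm_eq_one p hp
  obtain ⟨u, hu, hup⟩ := exists_unit_perp hpn
  obtain ⟨-, -, -, -, -, -, x, hxC, hxp, hx⟩ := hC.exists_side_end hCc hCa hp hu hup
  obtain ⟨-, -, -, -, -, -, x', hxC', hxp', hx'⟩ := hC.exists_side_end hCc hCa hp (u := -u)
    (by rw [norm_neg, hu]) (by rw [inner_neg_left, hup, neg_zero])
  obtain ⟨w, hwC, hwq, hws⟩ := hC.exists_mem_active hq
  have h1 := hx w hwC
  have h2 := hx' w hwC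
  rw [inner_neg_right, inner_neg_right, neg_le_neg_iff] at h2
  set h := p.2 - ⟪w, p.1⟫ with hh
  -- The projection of w to the line of p falls between the ends of that side, so it belongs to C;
  -- if the normals formed an acute angle it would violate the constraint q, which is active at w.
  have hz : w + h • p.1 ∈ C := by
    rw [hC.mem_iff]
    intro r hr
    have e0 := hC.mem_iff.mp hxC r hr
    have e1 := hC.mem_iff.mp hxC' r hr
    have hexp : ∀ y : Euc 2, ⟪y, p.1⟫ = p.2 → ⟪y, r.1⟫ = ⟪y, u⟫ * ⟪u, r.1⟫ + p.2 * ⟪p.1, r.1⟫ := by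
      intro y hy
      conv_lhs => rw [eq_frame_sum hu hpn hup y]
      rw [inner_add_left, real_inner_smul_left, real_inner_smul_left, hy]
    have hz1 : ⟪w + h • p.1, p.1⟫ = p.2 := by
      rw [inner_add_left, real_inner_smul_left, inner_self_of_norm_eq_one hpn, hh]
      ring
    have hz2 : ⟪w + h • p.1, u⟫ = ⟪w, u⟫ := by
      rw [inner_add_left, real_inner_smul_left, real_inner_comm u p.1, hup, mul_zero, add_zero]
    rw [hexp _ hz1, hz2]
    rw [hexp _ hxp] at e0
    rw [hexp _ hxp'] at e1
    rcases le_total 0 ⟪u, r.1⟫ with hs | hs <;> nlinarith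
  have h3 := hC.mem_iff.mp hz q hq
  rw [inner_add_left, hwq, real_inner_smul_left] at h3
  have h4 := hws p hp hpq
  nlinarith [mul_pos (show 0 < h by rw [hh]; linarith) hpos]

/-- Two of the sides at the ends of a side enclose a corner. -/
lemma IsPolygon.eq_of_inner_nonpos (hC : IsPolygon s C) {p q q' : Euc 2 × ℝ} (hp : p ∈ s)
    {u : Euc 2} (hu : ‖u‖ = 1) (hup : ⟪u, p.1⟫ = 0) {a b a' b' : ℝ}
    (hq : q.1 = -a • p.1 + b • u) (hq' : q'.1 = -a' • p.1 + -b' • u) (ha : 0 ≤ a) (ha' : 0 ≤ a')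
    (hb : 0 < b) (hb' : 0 < b') {r : Euc 2 × ℝ} (hr : r ∈ s) (hrp : ⟪p.1, r.1⟫ ≤ 0)
    (hrq : ⟪q.1, r.1⟫ ≤ 0) (hrq' : ⟪q'.1, r.1⟫ ≤ 0) : ⟪u, r.1⟫ = 0 ∧ a = 0 ∧ a' = 0 := by
  have hpn := hC.norm_eq_one p hp
  rw [hq, inner_add_left, real_inner_smul_left, real_inner_smul_left] at hrq
  rw [hq', inner_add_left, real_inner_smul_left, real_inner_smul_left] at hrq'
  have h1 := mul_nonneg_of_nonpos_of_nonpos hrp (neg_nonpos.mpr ha)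
  have h2 := mul_nonneg_of_nonpos_of_nonpos hrp (neg_nonpos.mpr ha')
  -- The normal at one end bounds this component from above and that at the other end from below, so
  -- r is parallel to p and opposite to it.
  have hu1 : ⟪u, r.1⟫ ≤ 0 := by
    by_contra! hneg
    nlinarith [mul_pos hb hneg]
  have hu2 : 0 ≤ ⟪u, r.1⟫ := by
    by_contra! hneg
    nlinarith [mul_pos hb' (neg_pos.mpr hneg)]
  have hu0 : ⟪u, r.1⟫ = 0 := le_antisymm hu1 hu2
  have hp0 : ⟪p.1, r.1⟫ ≠ 0 := by
    intro h0
    have h := eq_frame_sum hu hpn hup r.1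
    rw [real_inner_comm, hu0, real_inner_comm p.1, h0, zero_smul, zero_smul, add_zero] at h
    have := hC.norm_eq_one r hr
    rw [h, norm_zero] at this
    exact zero_ne_one this
  have hp1 : ⟪p.1, r.1⟫ < 0 := lt_of_le_of_ne hrp hp0
  rw [hu0, mul_zero, add_zero] at hrq hrq'
  refine ⟨hu0, ?_, ?_⟩
  · by_contra hne
    have := lt_of_le_of_ne ha (Ne.symm hne)
    nlinarith
  · by_contra hne
    have := lt_of_le_of_ne ha' (Ne.symm hne)
    nlinarith

/-- The equation says 1/a + 1/b + 1/c = 1. If a ≥ 7, then 1/b + 1/c would lie in [6/7, 1), but it is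
1 or at most 5/6. By symmetry all three are at most 6. -/
lemma sum_inv_eq_one_cases {a b c : ℕ} (ha : 2 ≤ a) (hb : 2 ≤ b) (hc : 2 ≤ c)
    (h : b * c + a * c + a * b = a * b * c) :
    (a = 3 ∧ b = 3 ∧ c = 3) ∨ (a = 2 ∧ b = 4 ∧ c = 4) ∨ (a = 4 ∧ b = 2 ∧ c = 4) ∨
    (a = 4 ∧ b = 4 ∧ c = 2) ∨ (a = 2 ∧ b = 3 ∧ c = 6) ∨ (a = 2 ∧ b = 6 ∧ c = 3) ∨
    (a = 3 ∧ b = 2 ∧ c = 6) ∨ (a = 6 ∧ b = 2 ∧ c = 3) ∨ (a = 3 ∧ b = 6 ∧ c = 2) ∨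
    (a = 6 ∧ b = 3 ∧ c = 2) := by
  have key : ∀ {a b c : ℕ}, 2 ≤ a → 2 ≤ b → 2 ≤ c → b * c + a * c + a * b = a * b * c → a ≤ 6 := by
    intro a b c ha hb hc h
    by_contra! hgt
    rcases Nat.lt_or_ge b 3 with h1 | h1
    · obtain rfl : b = 2 := by omega
      rcases Nat.lt_or_ge c 3 with h2 | h2
      · obtain rfl : c = 2 := by omega
        omega
      · nlinarith [Nat.mul_le_mul hgt h2]
    · rcases Nat.lt_or_ge c 3 with h2 | h2
      · obtain rfl : c = 2 := by omega
        nlinarith [Nat.mul_le_mul hgt h1]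
      · have e1 : 3 * (a * b) ≤ a * b * c := by nlinarith [Nat.mul_le_mul_left (a * b) h2]
        have e2 : 3 * (a * c) ≤ a * b * c := by nlinarith [Nat.mul_le_mul_left (a * c) h1]
        have e3 : 7 * (b * c) ≤ a * b * c := by nlinarith [Nat.mul_le_mul_left (b * c) hgt]
        have e4 : 0 < b * c := by positivity
        omega
  have ha6 := key ha hb hc h
  have hb6 : b ≤ 6 := key (a := b) (b := a) (c := c) hb ha hc (by linarith)
  have hc6 : c ≤ 6 := key (a := c) (b := a) (c := b) hc ha hb (by linarith)
  clear key
  interval_cases a <;> interval_cases b <;> interval_cases c <;> omega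

/-- The sides of a polygon with reflection angles are those of a rectangle or of a triangle
with angles `(π/3, π/3, π/3)`, `(π/2, π/4, π/4)` or `(π/2, π/3, π/6)`. -/
lemma IsPolygon.classification (hC : IsPolygon s C) (hCc : IsCompact C)
    (hCa : HasReflectionAngles C) :
    (∃ p q q' r, (∀ t, t ∈ s ↔ t = p ∨ t = q ∨ t = q' ∨ t = r) ∧ ⟪p.1, q.1⟫ = 0 ∧
      q'.1 = -q.1 ∧ r.1 = -p.1) ∨
    (∃ p₀ p₁ p₂ : Euc 2 × ℝ, (∀ t, t ∈ s ↔ t = p₀ ∨ t = p₁ ∨ t = p₂) ∧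
      ((⟪p₀.1, p₁.1⟫ = -(1 / 2) ∧ ⟪p₁.1, p₂.1⟫ = -(1 / 2) ∧ ⟪p₀.1, p₂.1⟫ = -(1 / 2)) ∨
       (⟪p₀.1, p₁.1⟫ = -(√2 / 2) ∧ ⟪p₁.1, p₂.1⟫ = -(√2 / 2) ∧ ⟪p₀.1, p₂.1⟫ = 0) ∨
       (⟪p₀.1, p₁.1⟫ = -(1 / 2) ∧ ⟪p₁.1, p₂.1⟫ = -(√3 / 2) ∧ ⟪p₀.1, p₂.1⟫ = 0))) := by
  have hobt : ∀ {p q}, p ∈ s → q ∈ s → p ≠ q → ⟪p.1, q.1⟫ ≤ 0 := fun hp hq h =>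
    hC.inner_nonpos hCc hCa hp hq h
  have hend : ∀ {p}, p ∈ s → ∀ {u : Euc 2}, ‖u‖ = 1 → ⟪u, p.1⟫ = 0 → ∃ q ∈ s, ∃ m : ℕ, 2 ≤ m ∧
      ⟪p.1, q.1⟫ = -Real.cos (Real.pi / m) ∧ ⟪q.1, u⟫ = Real.sin (Real.pi / m) := by
    intro p hp u hu hup
    obtain ⟨q, hq, m, hm, h1, h2, -⟩ := hC.exists_side_end hCc hCa hp hu hup
    exact ⟨q, hq, m, hm, h1, h2⟩
  have hform : ∀ {p q : Euc 2 × ℝ} {u : Euc 2} {a b : ℝ}, p ∈ s → ‖u‖ = 1 → ⟪u, p.1⟫ = 0 →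
      ⟪p.1, q.1⟫ = -a → ⟪q.1, u⟫ = b → q.1 = -a • p.1 + b • u := by
    intro p q u a b hp hu hup h1 h2
    rw [eq_frame_sum hu (hC.norm_eq_one p hp) hup q.1, real_inner_comm p.1 q.1, h1, h2, add_comm]
  have hns : s.Nonempty := by
    rw [Finset.nonempty_iff_ne_empty]
    rintro rfl
    have h1 : C = Set.univ := by
      rw [hC.eq_polyhedron]
      simp [polyhedron]
    rw [h1] at hCc
    exact noncompact_univ (Euc 2) hCc
  -- Either all corners are right angles, or some corner at a side p is not; then the sides at the
  -- two ends of p leave no room for a fourth side.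
  by_cases hright : ∀ p ∈ s, ∀ u : Euc 2, ‖u‖ = 1 → ⟪u, p.1⟫ = 0 → ∃ q ∈ s, q.1 = u
  · left
    obtain ⟨p, hp⟩ := hns
    have hpn := hC.norm_eq_one p hp
    obtain ⟨u, hu, hup⟩ := exists_unit_perp hpn
    obtain ⟨q, hq, hqu⟩ := hright p hp u hu hup
    obtain ⟨q', hq', hqu'⟩ := hright p hp (-u) (by rw [norm_neg, hu])
      (by rw [inner_neg_left, hup, neg_zero])
    obtain ⟨r, hr, hrp⟩ := hright q hq (-p.1) (by rw [norm_neg, hpn])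
      (by rw [inner_neg_left, hqu, real_inner_comm, hup, neg_zero])
    refine ⟨p, q, q', r, fun t => ⟨fun ht => ?_, ?_⟩, by rw [hqu, real_inner_comm, hup],
      by rw [hqu', hqu], hrp⟩
    · by_contra! hne
      obtain ⟨h1, h2, h3, h4⟩ := hne
      have e1 := hobt hp ht h1.symm
      have e2 := hobt hq ht h2.symm
      have e3 := hobt hq' ht h3.symm
      have e4 := hobt hr ht h4.symm
      rw [hqu] at e2
      rw [hqu', inner_neg_left] at e3
      rw [hrp, inner_neg_left] at e4
      have h := eq_frame_sum hu hpn hup t.1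
      rw [real_inner_comm u, real_inner_comm p.1, show ⟪u, t.1⟫ = 0 by linarith,
        show ⟪p.1, t.1⟫ = 0 by linarith, zero_smul, zero_smul, add_zero] at h
      have := hC.norm_eq_one t ht
      rw [h, norm_zero] at this
      exact zero_ne_one this
    · rintro (rfl | rfl | rfl | rfl) <;> assumption
  · right
    push Not at hright
    obtain ⟨p, hp, u, hu, hup, hno⟩ := hright
    have hpn := hC.norm_eq_one p hp
    obtain ⟨q, hq, m, hm, hpq, hqu⟩ := hend hp hu hup
    obtain ⟨q', hq', m', hm', hpq', hqu'⟩ := hend hp (u := -u) (by rw [norm_neg, hu])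
      (by rw [inner_neg_left, hup, neg_zero])
    have hqf := hform hp hu hup hpq hqu
    have hqf' := hform hp hu hup hpq' (b := -Real.sin (Real.pi / m'))
      (by rw [inner_neg_right] at hqu'; linarith)
    have hc := cos_pi_div_nonneg hm
    have hc' := cos_pi_div_nonneg hm'
    have hs := sin_pi_div_pos hm
    have hs' := sin_pi_div_pos hm'
    have hcne : Real.cos (Real.pi / m) ≠ 0 := by
      intro h0
      apply hno q hq
      have h1 := Real.sin_sq_add_cos_sq (Real.pi / m)
      rw [h0] at h1
      have h2 : Real.sin (Real.pi / m) = 1 := by nlinarith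
      rw [hqf, h0, h2]
      simp
    have hqq' : q ≠ q' := by
      rintro rfl
      rw [inner_neg_right] at hqu'
      linarith
    have hmem : ∀ t, t ∈ s ↔ t = p ∨ t = q ∨ t = q' := by
      intro t
      refine ⟨fun ht => ?_, by rintro (rfl | rfl | rfl) <;> assumption⟩
      by_contra! hne
      obtain ⟨h1, h2, h3⟩ := hne
      exact hcne (hC.eq_of_inner_nonpos hp hu hup hqf hqf' hc hc' hs hs' ht (hobt hp ht h1.symm)
        (hobt hq ht h2.symm) (hobt hq' ht h3.symm)).2.1
    have hqn' := hC.norm_eq_one q' hq'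
    -- The two ends of q' carry different sides other than q', hence p and q.
    obtain ⟨k, hk, hqk⟩ : ∃ k : ℕ, 2 ≤ k ∧ ⟪q'.1, q.1⟫ = -Real.cos (Real.pi / k) := by
      obtain ⟨v, hv, hvq⟩ := exists_unit_perp hqn'
      obtain ⟨t, ht, k, hk, htk, htv⟩ := hend hq' hv hvq
      obtain ⟨t', ht', k', hk', htk', htv'⟩ := hend hq' (u := -v) (by rw [norm_neg, hv])
        (by rw [inner_neg_left, hvq, neg_zero])
      have hsk := sin_pi_div_pos hk
      have hsk' := sin_pi_div_pos hk'
      rw [inner_neg_right] at htv'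
      have hne1 : t ≠ q' := by
        rintro rfl
        rw [real_inner_comm, hvq] at htv
        linarith
      have hne2 : t' ≠ q' := by
        rintro rfl
        rw [real_inner_comm, hvq] at htv'
        linarith
      have hne3 : t ≠ t' := by
        rintro rfl
        linarith
      rcases (hmem t).mp ht with rfl | rfl | rfl
      · rcases (hmem t').mp ht' with rfl | rfl | rfl
        · exact absurd rfl hne3
        · exact ⟨k', hk', htk'⟩
        · exact absurd rfl hne2
      · exact ⟨k, hk, htk⟩
      · exact absurd rfl hne1
    -- The angle sum of the triangle: both sides lie in [0, π] and have equal cosines, computed from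
    -- the normals in the frame u, p.
    have hsum : Real.pi / m + Real.pi / m' = Real.pi - Real.pi / k := by
      have hle : ∀ {j : ℕ}, 2 ≤ j → Real.pi / j ≤ Real.pi / 2 := fun hj =>
        div_le_div_of_nonneg_left Real.pi_pos.le two_pos (by exact_mod_cast hj)
      have h0 : ∀ j : ℕ, 0 ≤ Real.pi / j := fun j => by positivity
      have h1 := hle hm
      have h2 := hle hm'
      have h3 := hle hk
      refine Real.injOn_cos ⟨add_nonneg (h0 m) (h0 m'), by linarith⟩
        ⟨by linarith [Real.pi_pos], by linarith [h0 k]⟩ ?_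
      rw [Real.cos_pi_sub, ← hqk, Real.cos_add, hqf', hqf]
      simp only [inner_add_left, inner_add_right, real_inner_smul_left, real_inner_smul_right,
        inner_self_of_norm_eq_one hpn, inner_self_of_norm_eq_one hu, hup, real_inner_comm u p.1]
      ring
    have hnat : m' * k + m * k + m * m' = m * m' * k := by
      have hm0 : (m : ℝ) ≠ 0 := by positivity
      have hm0' : (m' : ℝ) ≠ 0 := by positivity
      have hk0 : (k : ℝ) ≠ 0 := by positivity
      have hpi := Real.pi_ne_zero
      field_simp at hsum
      have : ((m' * k + m * k + m * m' : ℕ) : ℝ) = ((m * m' * k : ℕ) : ℝ) := by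
        push_cast
        linarith
      exact_mod_cast this
    have c2 : -Real.cos (Real.pi / (2 : ℕ)) = 0 := by simp
    have c3 : -Real.cos (Real.pi / (3 : ℕ)) = -(1 / 2) := by simp
    have c4 : -Real.cos (Real.pi / (4 : ℕ)) = -(√2 / 2) := by simp
    have c6 : -Real.cos (Real.pi / (6 : ℕ)) = -(√3 / 2) := by simp
    have hqk' : ⟪q.1, q'.1⟫ = -Real.cos (Real.pi / k) := by rw [real_inner_comm]; exact hqk
    have hqp : ⟪q.1, p.1⟫ = -Real.cos (Real.pi / m) := by rw [real_inner_comm]; exact hpq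
    have hqp' : ⟪q'.1, p.1⟫ = -Real.cos (Real.pi / m') := by rw [real_inner_comm]; exact hpq'
    have hperm1 : ∀ t, t ∈ s ↔ t = q ∨ t = p ∨ t = q' := fun t => by rw [hmem]; tauto
    have hperm2 : ∀ t, t ∈ s ↔ t = p ∨ t = q' ∨ t = q := fun t => by rw [hmem]; tauto
    have hperm3 : ∀ t, t ∈ s ↔ t = q' ∨ t = p ∨ t = q := fun t => by rw [hmem]; tauto
    have hperm4 : ∀ t, t ∈ s ↔ t = q' ∨ t = q ∨ t = p := fun t => by rw [hmem]; tauto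
    have hperm5 : ∀ t, t ∈ s ↔ t = q ∨ t = q' ∨ t = p := fun t => by rw [hmem]; tauto
    rcases sum_inv_eq_one_cases hm hm' hk hnat with
      ⟨rfl, rfl, rfl⟩ | ⟨rfl, rfl, rfl⟩ | ⟨rfl, rfl, rfl⟩ | ⟨rfl, rfl, rfl⟩ | ⟨rfl, rfl, rfl⟩ |
      ⟨rfl, rfl, rfl⟩ | ⟨rfl, rfl, rfl⟩ | ⟨rfl, rfl, rfl⟩ | ⟨rfl, rfl, rfl⟩ | ⟨rfl, rfl, rfl⟩ <;>
    simp only [c2, c3, c4, c6] at hpq hpq' hqk hqk' hqp hqp'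
    · exact ⟨p, q, q', hmem, Or.inl ⟨hpq, hqk', hpq'⟩⟩
    · exact ⟨p, q', q, hperm2, Or.inr (Or.inl ⟨hpq', hqk, hpq⟩)⟩
    · exact ⟨p, q, q', hmem, Or.inr (Or.inl ⟨hpq, hqk', hpq'⟩)⟩
    · exact ⟨q, p, q', hperm1, Or.inr (Or.inl ⟨hqp, hpq', hqk'⟩)⟩
    · exact ⟨p, q', q, hperm2, Or.inr (Or.inr ⟨hpq', hqk, hpq⟩)⟩
    · exact ⟨q, q', p, hperm5, Or.inr (Or.inr ⟨hqk', hqp', hqp⟩)⟩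
    · exact ⟨p, q, q', hmem, Or.inr (Or.inr ⟨hpq, hqk', hpq'⟩)⟩
    · exact ⟨q', q, p, hperm4, Or.inr (Or.inr ⟨hqk, hqp, hqp'⟩)⟩
    · exact ⟨q, p, q', hperm1, Or.inr (Or.inr ⟨hqp, hpq', hqk'⟩)⟩
    · exact ⟨q', p, q, hperm3, Or.inr (Or.inr ⟨hqp', hpq, hqk⟩)⟩

end Classification

/-! ### Groups generated by the reflections in the sides of a polygon -/

section ReflectionGroup

variable {s : Finset (Euc 2 × ℝ)} {C : Set (Euc 2)}

lemma affReflection_apply_of_norm_eq_one {p : Euc 2 × ℝ} (hp : ‖p.1‖ = 1) (y : Euc 2) :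
    affReflection p.1 p.2 y = y - (2 * (⟪y, p.1⟫ - p.2)) • p.1 := by
  change affReflectionFun p.1 p.2 y = _
  rw [affReflectionFun, inner_self_of_norm_eq_one hp, div_one]

lemma affReflection_inv (r : Euc 2) (k : ℝ) : (affReflection r k)⁻¹ = affReflection r k :=
  inv_eq_of_mul_eq_one_left (IsometryEquiv.ext (affReflectionFun_involutive r k))

/-- Bounding hyperplanes come from facets and facets from constraints, and a reflection depends only
on its line, not on the scaling of its equation. -/
lemma IsPolygon.affineWeylGroup_eq (hC : IsPolygon s C) (hCi : (interior C).Nonempty) :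
    affineWeylGroup C =
      Subgroup.closure ((fun p => affReflection p.1 p.2) '' (s : Set (Euc 2 × ℝ))) := by
  rw [affineWeylGroup]
  congr 1
  ext g
  constructor
  · rintro ⟨r, k, h, rfl⟩
    obtain ⟨ν, x, hf, hl⟩ := h.exists_isFacet
    obtain ⟨p, hp, h1, h2⟩ := hC.exists_of_isFacet hCi hf
    refine ⟨p, hp, IsometryEquiv.ext fun y => ?_⟩
    have h3 : IsLineAt p ν x := ⟨by rw [h1, h2], 1, one_ne_zero, by rw [h1, one_smul]⟩
    exact (affReflection_apply_of_isLineAt hf.1 h3 y).trans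
      (affReflection_apply_of_isLineAt (p := (r, k)) hf.1 hl y).symm
  · rintro ⟨p, hp, rfl⟩
    obtain ⟨x, hx, hxp, -⟩ := hC.exists_mem_active hp
    exact ⟨p.1, p.2, (hC.isFacet hp hx hxp).isBoundingHyperplane ⟨hxp, 1, one_ne_zero, by rw [one_smul]⟩, rfl⟩

/-- An integral affine map of the plane: its linear part and its translation vector. -/
abbrev IntAff : Type := (ℤ × ℤ × ℤ × ℤ) × ℤ × ℤ

/-- Composition of integral linear maps. -/
def linMul (M N : ℤ × ℤ × ℤ × ℤ) : ℤ × ℤ × ℤ × ℤ :=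
  (M.1 * N.1 + M.2.1 * N.2.2.1, M.1 * N.2.1 + M.2.1 * N.2.2.2,
    M.2.2.1 * N.1 + M.2.2.2 * N.2.2.1, M.2.2.1 * N.2.1 + M.2.2.2 * N.2.2.2)

/-- Composition of integral affine maps. -/
def affMul (σ τ : IntAff) : IntAff :=
  (linMul σ.1 τ.1, σ.1.1 * τ.2.1 + σ.1.2.1 * τ.2.2 + σ.2.1,
    σ.1.2.2.1 * τ.2.1 + σ.1.2.2.2 * τ.2.2 + σ.2.2)

/-- The action of integral affine maps on the plane. -/
def affAct (τ : IntAff) (z : ℝ × ℝ) : ℝ × ℝ :=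
  (τ.1.1 * z.1 + τ.1.2.1 * z.2 + τ.2.1, τ.1.2.2.1 * z.1 + τ.1.2.2.2 * z.2 + τ.2.2)

lemma affAct_affMul (σ τ : IntAff) (z : ℝ × ℝ) : affAct (affMul σ τ) z = affAct σ (affAct τ z) := by
  simp only [affAct, affMul, linMul]
  push_cast
  ext <;> ring

/-- In the coordinates `Φ` the isometry `g` is the integral affine map `τ`. -/
def HasType (Φ : Euc 2 → ℝ × ℝ) (g : Euc 2 ≃ᵢ Euc 2) (τ : IntAff) : Prop :=
  ∀ y, Φ (g y) = affAct τ (Φ y)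

lemma HasType.mul {Φ : Euc 2 → ℝ × ℝ} {g h : Euc 2 ≃ᵢ Euc 2} {σ τ : IntAff}
    (hg : HasType Φ g σ) (hh : HasType Φ h τ) : HasType Φ (g * h) (affMul σ τ) := fun y => by
  rw [affAct_affMul, ← hh y, ← hg (h y)]
  rfl

/-- Affine coordinates in which the reflections in the sides of a polygon are integral. -/
structure IntegralCoordinates (s : Finset (Euc 2 × ℝ)) (L : Euc 2 ≃ₗ[ℝ] ℝ × ℝ) (w : ℝ × ℝ)
    (T : Set IntAff) (R : Set (ℝ × ℝ)) (t u : ℤ × ℤ) : Prop where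
  -- T collects the possible types of group elements, being stable under the generators; R is a
  -- region containing the image of the open polygon and moved off itself by every type but the
  -- identity; t and u generate the translations.
  one_mem : ((1, 0, 0, 1), 0, 0) ∈ T
  finite : (Prod.fst '' T).Finite
  hasType : ∀ p ∈ s, ∃ σ, HasType (fun y => L y + w) (affReflection p.1 p.2) σ ∧
    ∀ τ ∈ T, affMul σ τ ∈ T
  mem_region : ∀ y, (∀ p ∈ s, ⟪y, p.1⟫ < p.2) → L y + w ∈ R
  eq_one : ∀ τ ∈ T, ∀ z ∈ R, affAct τ z ∈ R → τ = ((1, 0, 0, 1), 0, 0)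
  det_ne_zero : t.1 * u.2 - t.2 * u.1 ≠ 0
  exists_eq : ∀ v, ((1, 0, 0, 1), v) ∈ T → ∃ i j : ℤ, v = i • t + j • u
  exists_fst : ∃ g ∈ Subgroup.closure ((fun p => affReflection p.1 p.2) '' (s : Set (Euc 2 × ℝ))),
    HasType (fun y => L y + w) g ((1, 0, 0, 1), t)
  exists_snd : ∃ g ∈ Subgroup.closure ((fun p => affReflection p.1 p.2) '' (s : Set (Euc 2 × ℝ))),
    HasType (fun y => L y + w) g ((1, 0, 0, 1), u)

/-! ### Types of isometries and of translations -/

section Types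

variable {L : Euc 2 ≃ₗ[ℝ] ℝ × ℝ} {w : ℝ × ℝ}

/-- The vector with the given integral coordinates. -/
def intVec (L : Euc 2 ≃ₗ[ℝ] ℝ × ℝ) (t : ℤ × ℤ) : Euc 2 := L.symm ((t.1 : ℝ), (t.2 : ℝ))

lemma hasType_one_iff {g : Euc 2 ≃ᵢ Euc 2} {t : ℤ × ℤ} :
    HasType (fun y => L y + w) g ((1, 0, 0, 1), t) ↔ g = transl (intVec L t) := by
  have h : ∀ y, affAct ((1, 0, 0, 1), t) (L y + w) = L (transl (intVec L t) y) + w := fun y => by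
    rw [transl_apply, map_add, intVec, LinearEquiv.apply_symm_apply]
    ext <;> simp [affAct] <;> ring
  constructor
  · intro hg
    refine IsometryEquiv.ext fun y => L.injective ?_
    exact add_right_cancel ((hg y).trans (h y))
  · rintro rfl y
    exact (h y).symm

lemma hasType_transl_iff {v : Euc 2} {τ : IntAff} :
    HasType (fun y => L y + w) (transl v) τ ↔ τ.1 = (1, 0, 0, 1) ∧ v = intVec L τ.2 := by
  constructor
  · intro h
    have h1 : ∀ z, z + L v = affAct τ z := fun z => by
      have := h (L.symm (z - w))
      simp only [transl_apply, map_add, LinearEquiv.apply_symm_apply] at this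
      rw [sub_add_cancel] at this
      rw [← this]
      abel
    have h0 := h1 (0, 0)
    have hx := h1 (1, 0)
    have hy := h1 (0, 1)
    obtain ⟨⟨a, b, c, d⟩, e, f⟩ := τ
    simp only [affAct, Prod.ext_iff, Prod.fst_add, Prod.snd_add] at h0 hx hy
    obtain ⟨h01, h02⟩ := h0
    obtain ⟨hx1, hx2⟩ := hx
    obtain ⟨hy1, hy2⟩ := hy
    have e1 : (a : ℝ) = 1 := by linarith
    have e2 : (b : ℝ) = 0 := by linarith
    have e3 : (c : ℝ) = 0 := by linarith
    have e4 : (d : ℝ) = 1 := by linarith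
    norm_cast at e1 e2 e3 e4
    subst e1 e2 e3 e4
    refine ⟨rfl, L.injective ?_⟩
    rw [intVec, LinearEquiv.apply_symm_apply]
    ext
    · simpa using h01
    · simpa using h02
  · obtain ⟨M, t⟩ := τ
    rintro ⟨rfl, rfl⟩
    exact hasType_one_iff.mpr rfl

variable {T : Set IntAff} {R : Set (ℝ × ℝ)} {t u : ℤ × ℤ}

/-- Induction on words from the left; the generators are involutions, so inverses add nothing. -/
lemma IntegralCoordinates.exists_hasType (h : IntegralCoordinates s L w T R t u)
    {g : Euc 2 ≃ᵢ Euc 2}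
    (hg : g ∈ Subgroup.closure ((fun p => affReflection p.1 p.2) '' (s : Set (Euc 2 × ℝ)))) :
    ∃ τ ∈ T, HasType (fun y => L y + w) g τ := by
  induction hg using Subgroup.closure_induction_left with
  | one =>
    refine ⟨_, h.one_mem, hasType_one_iff.mpr ?_⟩
    have : intVec L (0, 0) = 0 := by simp [intVec, ← Prod.zero_eq_mk]
    rw [this, transl_zero]
  | mul_left x hx y hy ih =>
    obtain ⟨p, hp, rfl⟩ := hx
    obtain ⟨σ, hσ, hσT⟩ := h.hasType p hp
    obtain ⟨τ, hτ, hyτ⟩ := ih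
    exact ⟨_, hσT τ hτ, hσ.mul hyτ⟩
  | inv_mul_cancel x hx y hy ih =>
    obtain ⟨p, hp, rfl⟩ := hx
    obtain ⟨σ, hσ, hσT⟩ := h.hasType p hp
    obtain ⟨τ, hτ, hyτ⟩ := ih
    refine ⟨_, hσT τ hτ, ?_⟩
    simp only [affReflection_inv]
    exact hσ.mul hyτ

lemma intVec_add (t u : ℤ × ℤ) (i j : ℤ) :
    intVec L (i • t + j • u) = i • intVec L t + j • intVec L u := by
  simp only [intVec, ← map_zsmul, ← map_add]
  congr 1
  ext <;> simp

lemma linearIndependent_intVec (h : t.1 * u.2 - t.2 * u.1 ≠ 0) :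
    LinearIndependent ℝ ![intVec L t, intVec L u] := by
  rw [LinearIndependent.pair_iff]
  intro a b hab
  have h1 := congrArg L hab
  simp only [intVec, map_add, map_smul, LinearEquiv.apply_symm_apply, map_zero, Prod.ext_iff,
    Prod.fst_add, Prod.snd_add, Prod.smul_fst, Prod.smul_snd, smul_eq_mul, Prod.fst_zero,
    Prod.snd_zero] at h1
  obtain ⟨h1, h2⟩ := h1
  have hd : ((t.1 : ℝ) * u.2 - t.2 * u.1) ≠ 0 := by exact_mod_cast h
  constructor
  · refine (mul_eq_zero.mp (?_ : a * ((t.1 : ℝ) * u.2 - t.2 * u.1) = 0)).resolve_right hd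
    linear_combination (u.2 : ℝ) * h1 - (u.1 : ℝ) * h2
  · refine (mul_eq_zero.mp (?_ : b * ((t.1 : ℝ) * u.2 - t.2 * u.1) = 0)).resolve_right hd
    linear_combination (t.1 : ℝ) * h2 - (t.2 : ℝ) * h1

end Types

/-- The line of p is the perpendicular bisector of c and its mirror image. -/
lemma inner_le_of_dist_le_affReflection {p : Euc 2 × ℝ} (hp : ‖p.1‖ = 1) {c y : Euc 2}
    (hc : ⟪c, p.1⟫ < p.2) (h : dist y c ≤ dist y (affReflection p.1 p.2 c)) : ⟪y, p.1⟫ ≤ p.2 := by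
  rw [affReflection_apply_of_norm_eq_one hp, dist_eq_norm, dist_eq_norm,
    ← sq_le_sq₀ (norm_nonneg _) (norm_nonneg _), ← real_inner_self_eq_norm_sq,
    ← real_inner_self_eq_norm_sq] at h
  have h1 := inner_self_of_norm_eq_one hp
  simp only [inner_sub_left, inner_sub_right, real_inner_smul_left, real_inner_smul_right,
    real_inner_comm y p.1, real_inner_comm c p.1, h1, real_inner_comm y c] at h
  by_contra! hcon
  nlinarith

/-- In integral coordinates the group generated by the reflections is seen to be a
crystallographic group with the polygon as a fundamental domain. -/
theorem IsPolygon.exists_isCrystal (hC : IsPolygon s C) (hCi : (interior C).Nonempty)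
    {L : Euc 2 ≃ₗ[ℝ] ℝ × ℝ} {w : ℝ × ℝ} {T : Set IntAff} {R : Set (ℝ × ℝ)} {t u : ℤ × ℤ}
    (h : IntegralCoordinates s L w T R t u) :
    ∃ b : Module.Basis (Fin 2) ℝ (Euc 2),
      IsCrystal (Submodule.span ℤ (Set.range b)) (affineWeylGroup C) ∧
      (∀ g ∈ affineWeylGroup C, ∀ v ∈ Submodule.span ℤ (Set.range b),
        linPart g v ∈ Submodule.span ℤ (Set.range b)) ∧
      EssTile (isoHom (affineWeylGroup C)) C := by
  have hW := hC.affineWeylGroup_eq hCi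
  set V := affineWeylGroup C with hVdef
  obtain ⟨b, hb⟩ : ∃ b : Module.Basis (Fin 2) ℝ (Euc 2), (b : Fin 2 → Euc 2)
      = ![intVec L t, intVec L u] :=
    ⟨basisOfLinearIndependentOfCardEqFinrank (linearIndependent_intVec h.det_ne_zero) (by simp),
      coe_basisOfLinearIndependentOfCardEqFinrank _ _⟩
  have htyp : ∀ g ∈ V, ∃ τ ∈ T, HasType (fun y => L y + w) g τ := fun g hg => by
    rw [hW] at hg
    exact h.exists_hasType hg
  have hspan : ∀ v, v ∈ Submodule.span ℤ (Set.range b) ↔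
      ∃ i j : ℤ, i • intVec L t + j • intVec L u = v := fun v => by
    rw [hb, Matrix.range_cons, Matrix.range_cons, Matrix.range_empty, Set.union_empty,
      Set.singleton_union]
    exact Submodule.mem_span_pair
  have hmem : ∀ v, v ∈ Submodule.span ℤ (Set.range b) ↔ transl v ∈ V := by
    intro v
    constructor
    · have h1 : intVec L t ∈ {v | transl v ∈ V} := by
        obtain ⟨g, hg, hgt⟩ := h.exists_fst
        rw [hasType_one_iff] at hgt
        rw [← hW, hgt] at hg
        exact hg
      have h2 : intVec L u ∈ {v | transl v ∈ V} := by
        obtain ⟨g, hg, hgt⟩ := h.exists_snd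
        rw [hasType_one_iff] at hgt
        rw [← hW, hgt] at hg
        exact hg
      have hsub : Submodule.span ℤ (Set.range b) ≤
          { carrier := {v | transl v ∈ V}
            zero_mem' := by rw [Set.mem_ofPred_eq, transl_zero]; exact V.one_mem
            add_mem' := fun {v w} hv hw => by
              rw [Set.mem_ofPred_eq, ← transl_mul]
              exact V.mul_mem hv hw
            neg_mem' := fun {v} hv => by
              rw [Set.mem_ofPred_eq, ← transl_inv]
              exact V.inv_mem hv : AddSubgroup (Euc 2) }.toIntSubmodule := by
        rw [Submodule.span_le, hb, Matrix.range_cons, Matrix.range_cons, Matrix.range_empty]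
        rintro x (rfl | rfl | hx)
        · exact h1
        · exact h2
        · exact hx.elim
      exact fun hv => hsub hv
    · intro hv
      obtain ⟨⟨M, v'⟩, hτ, hτv⟩ := htyp _ hv
      rw [hasType_transl_iff] at hτv
      obtain ⟨rfl, rfl⟩ := hτv
      obtain ⟨i, j, hij⟩ := h.exists_eq v' hτ
      exact (hspan _).mpr ⟨i, j, by rw [hij, intVec_add]⟩
  have hcr : IsCrystal (Submodule.span ℤ (Set.range b)) V := by
    constructor
    · rintro _ ⟨v, hv, rfl⟩
      exact (hmem v).mp hv
    · classical
      choose! τ hτT hτ using htyp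
      have hfin : ((fun g => (τ g).1) '' (V : Set (Euc 2 ≃ᵢ Euc 2))).Finite := by
        refine h.finite.subset ?_
        rintro _ ⟨g, hg, rfl⟩
        exact ⟨_, hτT g hg, rfl⟩
      -- One element is kept for each of the finitely many linear parts; two elements with the same
      -- linear part differ by a translation in the group.
      obtain ⟨S, hSV, hS⟩ := Set.exists_subset_bijOn (V : Set (Euc 2 ≃ᵢ Euc 2))
        (fun g => (τ g).1)
      refine relIndex_ne_zero_of_finite (hS.finite_iff_finite.mpr hfin) fun x hx => ?_
      obtain ⟨g, hg, hgx⟩ := hS.surjOn ⟨x, hx, rfl⟩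
      have hgV := hSV hg
      have hgx' : (τ g).1 = (τ x).1 := hgx
      have hv : ∃ v, x = transl v * g := by
        refine ⟨intVec L ((τ x).2 - (τ g).2), IsometryEquiv.ext fun y => ?_⟩
        refine L.injective (add_right_cancel (b := w) ((hτ x hx y).trans ?_))
        have h1 : L (g y) + w = affAct (τ g) (L y + w) := hτ g hgV y
        change affAct (τ x) (L y + w) = L (g y + intVec L ((τ x).2 - (τ g).2)) + w
        rw [map_add, intVec, LinearEquiv.apply_symm_apply, add_right_comm, h1, affAct, affAct, hgx']
        ext <;> simp
      obtain ⟨v, rfl⟩ := hv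
      refine ⟨g, hg, mem_transSub.mpr ⟨linPart g⁻¹ v, ?_, ?_⟩⟩
      · rw [hmem]
        have : transl (linPart g⁻¹ v) = g⁻¹ * (transl v * g) := by
          rw [← mul_assoc, mul_transl, inv_mul_cancel_right]
        rw [this]
        exact V.mul_mem (V.inv_mem hgV) hx
      · rw [← mul_assoc, mul_transl, inv_mul_cancel_right]
  refine ⟨b, hcr, fun g hg v hv => ?_, ?_⟩
  · rw [hmem] at hv ⊢
    have : transl (linPart g v) = g * transl v * g⁻¹ := by
      rw [mul_transl, mul_inv_cancel_right]
    rw [this]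
    exact V.mul_mem (V.mul_mem hg hv) (V.inv_mem hg)
  · have := hcr.countable
    obtain ⟨c, hc⟩ := hCi
    have hcs : ∀ p ∈ s, ⟪c, p.1⟫ < p.2 := fun p hp => by
      rw [hC.eq_polyhedron] at hc
      exact inner_lt_of_mem_interior hc hp (norm_ne_zero_iff.mp (by
        rw [hC.norm_eq_one p hp]; exact one_ne_zero))
    have hae : ∀ᵐ x : Euc 2, ∀ g : V, ∀ p ∈ s, ⟪(g : Euc 2 ≃ᵢ Euc 2) x, p.1⟫ ≠ p.2 := by
      rw [ae_all_iff]
      intro g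
      rw [Filter.eventually_all_finset]
      intro p hp
      have hp0 : p.1 ≠ 0 := norm_ne_zero_iff.mp (by rw [hC.norm_eq_one p hp]; exact one_ne_zero)
      exact (measurePreserving_isometryEquiv (g : Euc 2 ≃ᵢ Euc 2)).quasiMeasurePreserving.ae
        (measure_eq_zero_iff_ae_notMem.mp (volume_setOf_inner_eq hp0 p.2))
    filter_upwards [hae] with x hx
    have hlt : ∀ g : V, isoHom V g x ∈ C → ∀ p ∈ s, ⟪(g : Euc 2 ≃ᵢ Euc 2) x, p.1⟫ < p.2 :=
      fun g hg p hp => lt_of_le_of_ne (hC.mem_iff.mp hg p hp) (hx g p hp)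
    -- If g c is the orbit point of c nearest to x, then pulling x back by g gives a point no
    -- farther from c than from the mirror images of c in the sides, hence a point of C.
    obtain ⟨g, hg, hmin⟩ := hcr.exists_nearest c x
    have hgC : isoHom V ⟨g, hg⟩⁻¹ x ∈ C := by
      refine hC.mem_iff.mpr fun p hp => inner_le_of_dist_le_affReflection (hC.norm_eq_one p hp)
        (hcs p hp) ?_
      have hR : affReflection p.1 p.2 ∈ V := by
        rw [hW]
        exact Subgroup.subset_closure ⟨p, hp, rfl⟩
      have h1 := hmin _ (V.mul_mem hg hR)
      have h2 : ∀ y, dist (isoHom V ⟨g, hg⟩⁻¹ x) y = dist x (g y) := fun y => by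
        change dist (g.symm x) y = _
        rw [← g.isometry.dist_eq, g.apply_symm_apply]
      rw [h2, h2]
      exact h1
    -- Two elements bringing the generic point x into C bring it into the open polygon; the type of
    -- their quotient maps a point of R into R and so is the identity.
    refine ⟨⟨g, hg⟩⁻¹, hgC, fun k hkC => ?_⟩
    generalize (⟨g, hg⟩ : V)⁻¹ = k₀ at hgC ⊢
    obtain ⟨g, hg⟩ := k₀
    obtain ⟨τ, hτ, hty⟩ := htyp _ (V.mul_mem k.2 (V.inv_mem hg))
    have h1 := hty (g x)
    have h2 : ((k : Euc 2 ≃ᵢ Euc 2) * g⁻¹) (g x) = (k : Euc 2 ≃ᵢ Euc 2) x := by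
      change (k : Euc 2 ≃ᵢ Euc 2) (g.symm _) = _
      rw [IsometryEquiv.symm_apply_apply]
    rw [h2] at h1
    have h3 := h.eq_one τ hτ _ (h.mem_region _ (hlt ⟨g, hg⟩ hgC))
      (by rw [← h1]; exact h.mem_region _ (hlt k hkC))
    rw [h3, hasType_one_iff] at hty
    have h4 : intVec L (0, 0) = 0 := by simp [intVec, ← Prod.zero_eq_mk]
    rw [h4, transl_zero, mul_inv_eq_one] at hty
    exact Subtype.ext hty

end ReflectionGroup

/-! ### Integral coordinates for the four types of polygons -/

section Coordinates

variable {s : Finset (Euc 2 × ℝ)} {C : Set (Euc 2)} {p q r : Euc 2 × ℝ} {c₁ c₂ : ℝ}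

/-- Multiples of the distances to two lines, as coordinates. -/
def sideCoord (c₁ c₂ : ℝ) (p q : Euc 2 × ℝ) (y : Euc 2) : ℝ × ℝ :=
  (c₁ * (p.2 - ⟪y, p.1⟫), c₂ * (q.2 - ⟪y, q.1⟫))

/-- The two lines are not parallel, so the distances to them are affine coordinates. -/
lemma exists_linearEquiv_sideCoord (hp : ‖p.1‖ = 1) (hq : ‖q.1‖ = 1) (hpq : ⟪p.1, q.1⟫ ^ 2 ≠ 1)
    (h₁ : c₁ ≠ 0) (h₂ : c₂ ≠ 0) :
    ∃ (L : Euc 2 ≃ₗ[ℝ] ℝ × ℝ) (w : ℝ × ℝ), (fun y => L y + w) = sideCoord c₁ c₂ p q := by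
  let f : Euc 2 →ₗ[ℝ] ℝ × ℝ := ((-c₁) • (innerₗ (Euc 2)) p.1).prod ((-c₂) • (innerₗ (Euc 2)) q.1)
  have hf : ∀ y, f y = (-c₁ * ⟪y, p.1⟫, -c₂ * ⟪y, q.1⟫) := fun y => by
    simp [f, real_inner_comm]
  have hinj : Function.Injective f := by
    rw [← LinearMap.ker_eq_bot, LinearMap.ker_eq_bot']
    intro v hv
    rw [hf, Prod.mk_eq_zero] at hv
    have hvp : ⟪v, p.1⟫ = 0 := (mul_eq_zero.mp hv.1).resolve_left (neg_ne_zero.mpr h₁)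
    have hvq : ⟪v, q.1⟫ = 0 := (mul_eq_zero.mp hv.2).resolve_left (neg_ne_zero.mpr h₂)
    obtain ⟨e, he, hep⟩ := exists_unit_perp hp
    have hv' := eq_frame_sum he hp hep v
    rw [hvp, zero_smul, add_zero] at hv'
    have hq' := eq_frame_sum he hp hep q.1
    have hqq := inner_self_of_norm_eq_one hq
    rw [hv', real_inner_smul_left] at hvq
    rcases mul_eq_zero.mp hvq with h | h
    · rw [hv', h, zero_smul]
    · rw [real_inner_comm, h, zero_smul, zero_add] at hq'
      rw [hq', real_inner_smul_left, real_inner_smul_right, inner_self_of_norm_eq_one hp,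
        real_inner_comm] at hqq
      exact absurd (by rw [sq]; linarith) hpq
  refine ⟨f.linearEquivOfInjective hinj (by simp), (c₁ * p.2, c₂ * q.2), funext fun y => ?_⟩
  rw [LinearMap.linearEquivOfInjective_apply, hf, sideCoord]
  ext <;> simp <;> ring

/-- Reflections act on the distances to the sides through the Gram matrix of the normals; for the
polygons of the classification suitable scalings make these coefficients integral. -/
lemma sub_inner_affReflection (hr : ‖r.1‖ = 1) (p : Euc 2 × ℝ) (y : Euc 2) :
    p.2 - ⟪affReflection r.1 r.2 y, p.1⟫
      = (p.2 - ⟪y, p.1⟫) - 2 * ⟪r.1, p.1⟫ * (r.2 - ⟪y, r.1⟫) := by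
  rw [affReflection_apply_of_norm_eq_one hr, inner_sub_left, real_inner_smul_left]
  ring

/-- The hypothesis says that the combination of the normals with weights 1, b, c has length 0. The
weighted sum of the distances is therefore constant, and it is positive at z, so it can be scaled to
1; one distance can then be expressed by the others. -/
lemma exists_sum_dist_eq {p₀ p₁ p₂ : Euc 2 × ℝ} (h0 : ‖p₀.1‖ = 1) (h1 : ‖p₁.1‖ = 1)
    (h2 : ‖p₂.1‖ = 1) {b c : ℝ} (hb : 0 ≤ b) (hc : 0 ≤ c)
    (h : 1 + b ^ 2 + c ^ 2 + 2 * b * ⟪p₀.1, p₁.1⟫ + 2 * c * ⟪p₀.1, p₂.1⟫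
      + 2 * b * c * ⟪p₁.1, p₂.1⟫ = 0) {z : Euc 2} (hz0 : ⟪z, p₀.1⟫ < p₀.2) (hz1 : ⟪z, p₁.1⟫ < p₁.2)
    (hz2 : ⟪z, p₂.1⟫ < p₂.2) :
    ∃ k, 0 < k ∧ ∀ y, k * ((p₀.2 - ⟪y, p₀.1⟫) + b * (p₁.2 - ⟪y, p₁.1⟫)
      + c * (p₂.2 - ⟪y, p₂.1⟫)) = 1 := by
  have hv : p₀.1 + b • p₁.1 + c • p₂.1 = 0 := by
    rw [← inner_self_eq_zero (𝕜 := ℝ)]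
    simp only [inner_add_left, inner_add_right, real_inner_smul_left, real_inner_smul_right,
      inner_self_of_norm_eq_one h0, inner_self_of_norm_eq_one h1, inner_self_of_norm_eq_one h2,
      real_inner_comm p₀.1 p₁.1, real_inner_comm p₀.1 p₂.1, real_inner_comm p₁.1 p₂.1]
    linarith
  have hy : ∀ y, ⟪y, p₀.1⟫ + b * ⟪y, p₁.1⟫ + c * ⟪y, p₂.1⟫ = 0 := fun y => by
    have := congrArg (fun v => ⟪y, v⟫) hv
    simpa only [inner_add_right, real_inner_smul_right, inner_zero_right] using this
  have hpos : 0 < p₀.2 + b * p₁.2 + c * p₂.2 := by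
    have := hy z
    nlinarith [mul_nonneg hb (sub_pos.mpr hz1).le, mul_nonneg hc (sub_pos.mpr hz2).le]
  refine ⟨(p₀.2 + b * p₁.2 + c * p₂.2)⁻¹, inv_pos.mpr hpos, fun y => ?_⟩
  rw [inv_mul_eq_one₀ hpos.ne']
  linarith [hy y]

lemma affReflection_mem_closure (hp : p ∈ s) : affReflection p.1 p.2 ∈
    Subgroup.closure ((fun p => affReflection p.1 p.2) '' (s : Set (Euc 2 × ℝ))) :=
  Subgroup.subset_closure ⟨p, hp, rfl⟩

/-- The integral affine maps with linear part in a given set and translation vector in a given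
set. -/
def affSet (M : Finset (ℤ × ℤ × ℤ × ℤ)) (P : ℤ → ℤ → Prop) : Set IntAff :=
  {τ | τ.1 ∈ M ∧ P τ.2.1 τ.2.2}

lemma finite_fst_image_affSet (M : Finset (ℤ × ℤ × ℤ × ℤ)) (P : ℤ → ℤ → Prop) :
    (Prod.fst '' affSet M P).Finite :=
  M.finite_toSet.subset (by rintro _ ⟨τ, hτ, rfl⟩; exact hτ.1)

lemma affMul_mem_affSet {M : Finset (ℤ × ℤ × ℤ × ℤ)} {P : ℤ → ℤ → Prop} {σ : IntAff}
    (hM : ∀ N ∈ M, linMul σ.1 N ∈ M)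
    (hP : ∀ a b, P a b → P (σ.1.1 * a + σ.1.2.1 * b + σ.2.1) (σ.1.2.2.1 * a + σ.1.2.2.2 * b + σ.2.2)) :
    ∀ τ ∈ affSet M P, affMul σ τ ∈ affSet M P := fun _ hτ =>
  ⟨hM _ hτ.1, hP _ _ hτ.2⟩

/-- The linear group of an equilateral triangle, in coordinates. -/
def linA : Finset (ℤ × ℤ × ℤ × ℤ) :=
  {(1, 0, 0, 1), (-1, -1, 1, 0), (-1, 0, 1, 1), (0, -1, -1, 0), (0, 1, -1, -1), (1, 1, 0, -1)}

/-- The linear group of an isosceles right triangle, in coordinates. -/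
def linC : Finset (ℤ × ℤ × ℤ × ℤ) :=
  {(1, 0, 0, 1), (-1, -1, 0, 1), (-1, -1, 2, 1), (-1, 0, 0, -1), (-1, 0, 2, 1), (1, 0, -2, -1),
    (1, 1, -2, -1), (1, 1, 0, -1)}

/-- The linear group of half an equilateral triangle, in coordinates. -/
def linG : Finset (ℤ × ℤ × ℤ × ℤ) :=
  {(1, 0, 0, 1), (-2, -3, 1, 1), (-2, -3, 1, 2), (-1, -3, 0, 1), (-1, -3, 1, 2), (-1, 0, 0, -1),
    (-1, 0, 1, 1), (1, 0, -1, -1), (1, 3, -1, -2), (1, 3, 0, -1), (2, 3, -1, -2), (2, 3, -1, -1)}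

/-- The linear group of a rectangle, in coordinates. -/
def linR : Finset (ℤ × ℤ × ℤ × ℤ) :=
  {(1, 0, 0, 1), (-1, 0, 0, 1), (1, 0, 0, -1), (-1, 0, 0, -1)}

lemma HasType.of_eq {Φ : Euc 2 → ℝ × ℝ} {g : Euc 2 ≃ᵢ Euc 2} {σ τ : IntAff} (h : HasType Φ g σ)
    (e : σ = τ) : HasType Φ g τ := e ▸ h

lemma int_eq_zero_or_one {a : ℤ} (h : (-1 : ℝ) < a) (h' : (a : ℝ) < 2) : a = 0 ∨ a = 1 := by
  have h1 : -1 < a := by exact_mod_cast h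
  have h2 : a < 2 := by exact_mod_cast h'
  omega

/-- The triangle and its image both have coordinates between 0 and 1, which leaves only 0 and 1 for
the translation entries. The nontrivial rotations of the triangle about its centre survive the
inequalities and are excluded by the congruence. -/
lemma affSet_linA_eq_one : ∀ τ ∈ affSet linA (fun a b => 3 ∣ a - b),
    ∀ z ∈ {z : ℝ × ℝ | 0 < z.1 ∧ 0 < z.2 ∧ z.1 + z.2 < 1},
      affAct τ z ∈ {z : ℝ × ℝ | 0 < z.1 ∧ 0 < z.2 ∧ z.1 + z.2 < 1} →
        τ = ((1, 0, 0, 1), 0, 0) := by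
  rintro ⟨M, a, b⟩ ⟨hM, hP⟩ ⟨x, y⟩ ⟨hx, hy, hxy⟩ ⟨hx', hy', hxy'⟩
  simp only [linA, Finset.mem_insert, Finset.mem_singleton] at hM
  rcases hM with rfl | rfl | rfl | rfl | rfl | rfl <;>
    simp only [affAct] at hx hy hxy hx' hy' hxy' hP <;>
    push_cast at hx' hy' hxy' <;>
    rcases int_eq_zero_or_one (a := a) (by linarith) (by linarith) with rfl | rfl <;>
    rcases int_eq_zero_or_one (a := b) (by linarith) (by linarith) with rfl | rfl <;>
    first
    | rfl
    | (exfalso; push_cast at hx' hy' hxy'; linarith)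
    | (exfalso; omega)

/-- Here the parity condition is needed against the mirror symmetry of the triangle, which has the
odd translation entry 1. -/
lemma affSet_linC_eq_one : ∀ τ ∈ affSet linC (fun _ b => 2 ∣ b),
    ∀ z ∈ {z : ℝ × ℝ | 0 < z.1 ∧ 0 < z.2 ∧ 2 * z.1 + z.2 < 1},
      affAct τ z ∈ {z : ℝ × ℝ | 0 < z.1 ∧ 0 < z.2 ∧ 2 * z.1 + z.2 < 1} →
        τ = ((1, 0, 0, 1), 0, 0) := by
  rintro ⟨M, a, b⟩ ⟨hM, hP⟩ ⟨x, y⟩ ⟨hx, hy, hxy⟩ ⟨hx', hy', hxy'⟩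
  simp only [linC, Finset.mem_insert, Finset.mem_singleton] at hM
  rcases hM with rfl | rfl | rfl | rfl | rfl | rfl | rfl | rfl <;>
    simp only [affAct] at hx hy hxy hx' hy' hxy' hP <;>
    push_cast at hx' hy' hxy' <;>
    rcases int_eq_zero_or_one (a := a) (by linarith) (by linarith) with rfl | rfl <;>
    rcases int_eq_zero_or_one (a := b) (by linarith) (by linarith) with rfl | rfl <;>
    first
    | rfl
    | (exfalso; push_cast at hx' hy' hxy'; linarith)
    | (exfalso; omega)

lemma affSet_linG_eq_one : ∀ τ ∈ affSet linG (fun _ _ => True),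
    ∀ z ∈ {z : ℝ × ℝ | 0 < z.1 ∧ 0 < z.2 ∧ 2 * z.1 + 3 * z.2 < 1},
      affAct τ z ∈ {z : ℝ × ℝ | 0 < z.1 ∧ 0 < z.2 ∧ 2 * z.1 + 3 * z.2 < 1} →
        τ = ((1, 0, 0, 1), 0, 0) := by
  rintro ⟨M, a, b⟩ ⟨hM, hP⟩ ⟨x, y⟩ ⟨hx, hy, hxy⟩ ⟨hx', hy', hxy'⟩
  simp only [linG, Finset.mem_insert, Finset.mem_singleton] at hM
  rcases hM with rfl | rfl | rfl | rfl | rfl | rfl | rfl | rfl | rfl | rfl | rfl | rfl <;>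
    simp only [affAct] at hx hy hxy hx' hy' hxy' hP <;>
    push_cast at hx' hy' hxy' <;>
    rcases int_eq_zero_or_one (a := a) (by linarith) (by linarith) with rfl | rfl <;>
    rcases int_eq_zero_or_one (a := b) (by linarith) (by linarith) with rfl | rfl <;>
    first
    | rfl
    | (exfalso; push_cast at hx' hy' hxy'; linarith)

lemma affSet_linR_eq_one : ∀ τ ∈ affSet linR (fun _ _ => True),
    ∀ z ∈ {z : ℝ × ℝ | (0 < z.1 ∧ 0 < z.2) ∧ z.1 < 1 / 2 ∧ z.2 < 1 / 2},
      affAct τ z ∈ {z : ℝ × ℝ | (0 < z.1 ∧ 0 < z.2) ∧ z.1 < 1 / 2 ∧ z.2 < 1 / 2} →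
        τ = ((1, 0, 0, 1), 0, 0) := by
  rintro ⟨M, a, b⟩ ⟨hM, hP⟩ ⟨x, y⟩ ⟨⟨hx, hy⟩, hxy, h⟩ ⟨⟨hx', hy'⟩, hxy', h'⟩
  simp only [linR, Finset.mem_insert, Finset.mem_singleton] at hM
  rcases hM with rfl | rfl | rfl | rfl <;>
    simp only [affAct] at hx hy hxy h hx' hy' hxy' h' hP <;>
    push_cast at hx' hy' hxy' h' <;>
    rcases int_eq_zero_or_one (a := a) (by linarith) (by linarith) with rfl | rfl <;>
    rcases int_eq_zero_or_one (a := b) (by linarith) (by linarith) with rfl | rfl <;>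
    first
    | rfl
    | (exfalso; push_cast at hx' hy' hxy' h'; linarith)

/-- The coordinates are the distances to two sides, scaled so that the three distances add up to 1.
With sᵢ the reflection in side i, s₁s₂s₁ reflects in the line parallel to side 0 through the
opposite corner, so s₀s₁s₂s₁ is a translation; conjugating by s₁ gives an independent one. They span
a sublattice of index 3 in ℤ², whence the congruence. -/
lemma IsPolygon.integralCoordinates_equilateral (hC : IsPolygon s C) {z : Euc 2}
    (hz : ∀ p ∈ s, ⟪z, p.1⟫ < p.2) {p₀ p₁ p₂ : Euc 2 × ℝ}
    (hs : ∀ t, t ∈ s ↔ t = p₀ ∨ t = p₁ ∨ t = p₂) (h01 : ⟪p₀.1, p₁.1⟫ = -(1 / 2))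
    (h12 : ⟪p₁.1, p₂.1⟫ = -(1 / 2)) (h02 : ⟪p₀.1, p₂.1⟫ = -(1 / 2)) :
    ∃ L w T R t u, IntegralCoordinates s L w T R t u := by
  have hp₀ : p₀ ∈ s := (hs _).mpr (Or.inl rfl)
  have hp₁ : p₁ ∈ s := (hs _).mpr (Or.inr (Or.inl rfl))
  have hp₂ : p₂ ∈ s := (hs _).mpr (Or.inr (Or.inr rfl))
  have n0 := hC.norm_eq_one _ hp₀
  have n1 := hC.norm_eq_one _ hp₁
  have n2 := hC.norm_eq_one _ hp₂
  have h21 : ⟪p₂.1, p₁.1⟫ = -(1 / 2) := by rw [real_inner_comm, h12]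
  have h11 := inner_self_of_norm_eq_one n1
  have h22 := inner_self_of_norm_eq_one n2
  obtain ⟨k, hk, hsum⟩ := exists_sum_dist_eq n0 n1 n2 (b := 1) (c := 1) (by positivity)
    (by positivity) (by rw [h01, h02, h12]; linarith) (hz _ hp₀) (hz _ hp₁) (hz _ hp₂)
  obtain ⟨L, w, hLw⟩ := exists_linearEquiv_sideCoord (c₁ := k) (c₂ := k) n1 n2
    (by rw [h12]; intro h; linarith) (by positivity) (by positivity)
  have h0 : HasType (fun y => L y + w) (affReflection p₀.1 p₀.2) ((0, -1, -1, 0), 1, 1) := by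
    rw [hLw]
    intro y
    have := hsum y
    simp only [sideCoord, affAct, sub_inner_affReflection n0, h01, h02]
    ext <;> push_cast
    · linear_combination this
    · linear_combination this
  have h1 : HasType (fun y => L y + w) (affReflection p₁.1 p₁.2) ((-1, 0, 1, 1), 0, 0) := by
    rw [hLw]
    intro y
    simp only [sideCoord, affAct, sub_inner_affReflection n1, h11, h12]
    ext <;> push_cast
    · ring
    · ring
  have h2 : HasType (fun y => L y + w) (affReflection p₂.1 p₂.2) ((1, 1, 0, -1), 0, 0) := by
    rw [hLw]
    intro y
    simp only [sideCoord, affAct, sub_inner_affReflection n2, h21, h22]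
    ext <;> push_cast
    · ring
    · ring
  have m0 := affReflection_mem_closure hp₀
  have m1 := affReflection_mem_closure hp₁
  have m2 := affReflection_mem_closure hp₂
  have htr := h0.mul (h1.mul (h2.mul h1))
  have mtr := Subgroup.mul_mem _ m0 (Subgroup.mul_mem _ m1 (Subgroup.mul_mem _ m2 m1))
  refine ⟨L, w, affSet linA (fun a b => 3 ∣ a - b),
    {z | 0 < z.1 ∧ 0 < z.2 ∧ z.1 + z.2 < 1}, (1, 1), (-1, 2),
    ⟨by decide, by simp⟩, finite_fst_image_affSet _ _, fun p hp => ?_, fun y hy => ?_,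
    affSet_linA_eq_one, by decide, ?_, ⟨_, mtr, htr.of_eq (by decide)⟩,
    ⟨_, Subgroup.mul_mem _ m1 (Subgroup.mul_mem _ mtr m1), (h1.mul (htr.mul h1)).of_eq (by decide)⟩⟩
  · rcases (hs p).mp hp with rfl | rfl | rfl
    · exact ⟨_, h0, affMul_mem_affSet (by decide) (fun a b h => by dsimp only at h ⊢; omega)⟩
    · exact ⟨_, h1, affMul_mem_affSet (by decide) (fun a b h => by dsimp only at h ⊢; omega)⟩
    · exact ⟨_, h2, affMul_mem_affSet (by decide) (fun a b h => by dsimp only at h ⊢; omega)⟩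
  · have y0 := sub_pos.mpr (hy _ hp₀)
    have y1 := sub_pos.mpr (hy _ hp₁)
    have y2 := sub_pos.mpr (hy _ hp₂)
    have hL : L y + w = _ := congrFun hLw y
    rw [hL]
    refine ⟨by simp only [sideCoord]; positivity, by simp only [sideCoord]; positivity, ?_⟩
    simp only [sideCoord]
    linarith [hsum y, mul_pos hk y0]
  · rintro ⟨a, b⟩ ⟨-, hP⟩
    dsimp only at hP
    refine ⟨(2 * a + b) / 3, (b - a) / 3, Prod.ext ?_ ?_⟩ <;> simp <;> omega

/-- Again s₁s₂s₁ reflects in a line parallel to the side p₀; s₀s₁s₂s₁ and its conjugate by s₁ span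
the translations, now of index 2 in ℤ², whence the parity condition. -/
lemma IsPolygon.integralCoordinates_isosceles (hC : IsPolygon s C) {z : Euc 2}
    (hz : ∀ p ∈ s, ⟪z, p.1⟫ < p.2) {p₀ p₁ p₂ : Euc 2 × ℝ}
    (hs : ∀ t, t ∈ s ↔ t = p₀ ∨ t = p₁ ∨ t = p₂) (h01 : ⟪p₀.1, p₁.1⟫ = -(√2 / 2))
    (h12 : ⟪p₁.1, p₂.1⟫ = -(√2 / 2)) (h02 : ⟪p₀.1, p₂.1⟫ = 0) :
    ∃ L w T R t u, IntegralCoordinates s L w T R t u := by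
  have hp₀ : p₀ ∈ s := (hs _).mpr (Or.inl rfl)
  have hp₁ : p₁ ∈ s := (hs _).mpr (Or.inr (Or.inl rfl))
  have hp₂ : p₂ ∈ s := (hs _).mpr (Or.inr (Or.inr rfl))
  have n0 := hC.norm_eq_one _ hp₀
  have n1 := hC.norm_eq_one _ hp₁
  have n2 := hC.norm_eq_one _ hp₂
  have h21 : ⟪p₂.1, p₁.1⟫ = -(√2 / 2) := by rw [real_inner_comm, h12]
  have h11 := inner_self_of_norm_eq_one n1
  have h22 := inner_self_of_norm_eq_one n2
  have e2 : √2 * √2 = (2 : ℝ) := Real.mul_self_sqrt (by norm_num)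
  have q2 : 0 < √2 := Real.sqrt_pos.mpr two_pos
  obtain ⟨k, hk, hsum⟩ := exists_sum_dist_eq n0 n1 n2 (b := √2) (c := 1) (by positivity)
    (by positivity) (by rw [h01, h02, h12]; linarith) (hz _ hp₀) (hz _ hp₁) (hz _ hp₂)
  -- The factor √2/2 turns the two off-diagonal coefficients √2 of the reflections into 2 and 1.
  obtain ⟨L, w, hLw⟩ := exists_linearEquiv_sideCoord (c₁ := (k * (√2 / 2))) (c₂ := k) n1 n2
    (by rw [h12]; intro h; linarith) (by positivity) (by positivity)
  have h0 : HasType (fun y => L y + w) (affReflection p₀.1 p₀.2) ((-1, -1, 0, 1), 1, 0) := by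
    rw [hLw]
    intro y
    have := hsum y
    simp only [sideCoord, affAct, sub_inner_affReflection n0, h01, h02]
    ext <;> push_cast
    · linear_combination this + (k * (p₀.2 - ⟪y, p₀.1⟫) / 2) * e2
    · ring
  have h1 : HasType (fun y => L y + w) (affReflection p₁.1 p₁.2) ((-1, 0, 2, 1), 0, 0) := by
    rw [hLw]
    intro y
    simp only [sideCoord, affAct, sub_inner_affReflection n1, h11, h12]
    ext <;> push_cast
    · ring
    · ring
  have h2 : HasType (fun y => L y + w) (affReflection p₂.1 p₂.2) ((1, 1, 0, -1), 0, 0) := by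
    rw [hLw]
    intro y
    simp only [sideCoord, affAct, sub_inner_affReflection n2, h21, h22]
    ext <;> push_cast
    · linear_combination (k * (p₂.2 - ⟪y, p₂.1⟫) / 2) * e2
    · ring
  have m0 := affReflection_mem_closure hp₀
  have m1 := affReflection_mem_closure hp₁
  have m2 := affReflection_mem_closure hp₂
  have htr := h0.mul (h1.mul (h2.mul h1))
  have mtr := Subgroup.mul_mem _ m0 (Subgroup.mul_mem _ m1 (Subgroup.mul_mem _ m2 m1))
  refine ⟨L, w, affSet linC (fun _ b => 2 ∣ b),
    {z | 0 < z.1 ∧ 0 < z.2 ∧ 2 * z.1 + z.2 < 1}, (1, 0), (-1, 2),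
    ⟨by decide, by simp⟩, finite_fst_image_affSet _ _, fun p hp => ?_, fun y hy => ?_,
    affSet_linC_eq_one, by decide, ?_, ⟨_, mtr, htr.of_eq (by decide)⟩,
    ⟨_, Subgroup.mul_mem _ m1 (Subgroup.mul_mem _ mtr m1), (h1.mul (htr.mul h1)).of_eq (by decide)⟩⟩
  · rcases (hs p).mp hp with rfl | rfl | rfl
    · exact ⟨_, h0, affMul_mem_affSet (by decide) (fun a b h => by dsimp only at h ⊢; omega)⟩
    · exact ⟨_, h1, affMul_mem_affSet (by decide) (fun a b h => by dsimp only at h ⊢; omega)⟩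
    · exact ⟨_, h2, affMul_mem_affSet (by decide) (fun a b h => by dsimp only at h ⊢; omega)⟩
  · have y0 := sub_pos.mpr (hy _ hp₀)
    have y1 := sub_pos.mpr (hy _ hp₁)
    have y2 := sub_pos.mpr (hy _ hp₂)
    have hL : L y + w = _ := congrFun hLw y
    rw [hL]
    refine ⟨by simp only [sideCoord]; positivity, by simp only [sideCoord]; positivity, ?_⟩
    simp only [sideCoord]
    linarith [hsum y, mul_pos hk y0]
  · rintro ⟨a, b⟩ ⟨-, hP⟩
    dsimp only at hP
    exact ⟨a + b / 2, b / 2, Prod.ext (by simp) (by simp; omega)⟩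

/-- Here the longer word s₁s₂s₁s₂s₁ is the reflection in a line parallel to the side p₀. The
resulting translations fill ℤ², so no congruence is needed. -/
lemma IsPolygon.integralCoordinates_half_equilateral (hC : IsPolygon s C) {z : Euc 2}
    (hz : ∀ p ∈ s, ⟪z, p.1⟫ < p.2) {p₀ p₁ p₂ : Euc 2 × ℝ}
    (hs : ∀ t, t ∈ s ↔ t = p₀ ∨ t = p₁ ∨ t = p₂) (h01 : ⟪p₀.1, p₁.1⟫ = -(1 / 2))
    (h12 : ⟪p₁.1, p₂.1⟫ = -(√3 / 2)) (h02 : ⟪p₀.1, p₂.1⟫ = 0) :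
    ∃ L w T R t u, IntegralCoordinates s L w T R t u := by
  have hp₀ : p₀ ∈ s := (hs _).mpr (Or.inl rfl)
  have hp₁ : p₁ ∈ s := (hs _).mpr (Or.inr (Or.inl rfl))
  have hp₂ : p₂ ∈ s := (hs _).mpr (Or.inr (Or.inr rfl))
  have n0 := hC.norm_eq_one _ hp₀
  have n1 := hC.norm_eq_one _ hp₁
  have n2 := hC.norm_eq_one _ hp₂
  have h21 : ⟪p₂.1, p₁.1⟫ = -(√3 / 2) := by rw [real_inner_comm, h12]
  have h11 := inner_self_of_norm_eq_one n1
  have h22 := inner_self_of_norm_eq_one n2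
  have e3 : √3 * √3 = (3 : ℝ) := Real.mul_self_sqrt (by norm_num)
  have q3 : 0 < √3 := Real.sqrt_pos.mpr three_pos
  obtain ⟨k, hk, hsum⟩ := exists_sum_dist_eq n0 n1 n2 (b := 2) (c := √3) (by positivity)
    (by positivity) (by rw [h01, h02, h12]; linarith) (hz _ hp₀) (hz _ hp₁) (hz _ hp₂)
  -- The factor √3/3 turns the two off-diagonal coefficients √3 of the reflections into 1 and 3.
  obtain ⟨L, w, hLw⟩ := exists_linearEquiv_sideCoord (c₁ := k) (c₂ := (k * (√3 / 3))) n1 n2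
    (by rw [h12]; intro h; linarith) (by positivity) (by positivity)
  have h0 : HasType (fun y => L y + w) (affReflection p₀.1 p₀.2) ((-1, -3, 0, 1), 1, 0) := by
    rw [hLw]
    intro y
    have := hsum y
    simp only [sideCoord, affAct, sub_inner_affReflection n0, h01, h02]
    ext <;> push_cast
    · linear_combination this
    · ring
  have h1 : HasType (fun y => L y + w) (affReflection p₁.1 p₁.2) ((-1, 0, 1, 1), 0, 0) := by
    rw [hLw]
    intro y
    simp only [sideCoord, affAct, sub_inner_affReflection n1, h11, h12]
    ext <;> push_cast
    · ring
    · linear_combination (k * (p₁.2 - ⟪y, p₁.1⟫) / 3) * e3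
  have h2 : HasType (fun y => L y + w) (affReflection p₂.1 p₂.2) ((1, 3, 0, -1), 0, 0) := by
    rw [hLw]
    intro y
    simp only [sideCoord, affAct, sub_inner_affReflection n2, h21, h22]
    ext <;> push_cast
    · ring
    · ring
  have m0 := affReflection_mem_closure hp₀
  have m1 := affReflection_mem_closure hp₁
  have m2 := affReflection_mem_closure hp₂
  have htr := h0.mul (h1.mul (h2.mul (h1.mul (h2.mul h1))))
  have mtr := Subgroup.mul_mem _ m0 (Subgroup.mul_mem _ m1 (Subgroup.mul_mem _ m2
    (Subgroup.mul_mem _ m1 (Subgroup.mul_mem _ m2 m1))))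
  refine ⟨L, w, affSet linG (fun _ _ => True),
    {z | 0 < z.1 ∧ 0 < z.2 ∧ 2 * z.1 + 3 * z.2 < 1}, (1, 0), (-1, 1),
    ⟨by decide, by simp⟩, finite_fst_image_affSet _ _, fun p hp => ?_, fun y hy => ?_,
    affSet_linG_eq_one, by decide, ?_, ⟨_, mtr, htr.of_eq (by decide)⟩,
    ⟨_, Subgroup.mul_mem _ m1 (Subgroup.mul_mem _ mtr m1), (h1.mul (htr.mul h1)).of_eq (by decide)⟩⟩
  · rcases (hs p).mp hp with rfl | rfl | rfl
    · exact ⟨_, h0, affMul_mem_affSet (by decide) (fun _ _ _ => trivial)⟩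
    · exact ⟨_, h1, affMul_mem_affSet (by decide) (fun _ _ _ => trivial)⟩
    · exact ⟨_, h2, affMul_mem_affSet (by decide) (fun _ _ _ => trivial)⟩
  · have y0 := sub_pos.mpr (hy _ hp₀)
    have y1 := sub_pos.mpr (hy _ hp₁)
    have y2 := sub_pos.mpr (hy _ hp₂)
    have hL : L y + w = _ := congrFun hLw y
    rw [hL]
    refine ⟨by simp only [sideCoord]; positivity, by simp only [sideCoord]; positivity, ?_⟩
    simp only [sideCoord]
    linarith [hsum y, mul_pos hk y0]
  · rintro ⟨a, b⟩ -
    exact ⟨a + b, b, Prod.ext (by simp) (by simp)⟩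

/-- The reflections in opposite sides compose to a translation by twice the width; with both widths
scaled to 1/2 the translations are ℤ². -/
lemma IsPolygon.integralCoordinates_rectangle (hC : IsPolygon s C) {z : Euc 2}
    (hz : ∀ p ∈ s, ⟪z, p.1⟫ < p.2) {p q q' r : Euc 2 × ℝ}
    (hs : ∀ t, t ∈ s ↔ t = p ∨ t = q ∨ t = q' ∨ t = r) (hpq : ⟪p.1, q.1⟫ = 0) (hq' : q'.1 = -q.1)
    (hr : r.1 = -p.1) : ∃ L w T R t u, IntegralCoordinates s L w T R t u := by
  have hsp : p ∈ s := (hs _).mpr (Or.inl rfl)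
  have hsq : q ∈ s := (hs _).mpr (Or.inr (Or.inl rfl))
  have hsq' : q' ∈ s := (hs _).mpr (Or.inr (Or.inr (Or.inl rfl)))
  have hsr : r ∈ s := (hs _).mpr (Or.inr (Or.inr (Or.inr rfl)))
  have np := hC.norm_eq_one _ hsp
  have nq := hC.norm_eq_one _ hsq
  have nq' := hC.norm_eq_one _ hsq'
  have nr := hC.norm_eq_one _ hsr
  have ipp := inner_self_of_norm_eq_one np
  have iqq := inner_self_of_norm_eq_one nq
  have hqp : ⟪q.1, p.1⟫ = 0 := by rw [real_inner_comm, hpq]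
  have width : ∀ {p r : Euc 2 × ℝ}, p ∈ s → r ∈ s → r.1 = -p.1 →
      ∃ k, 0 < k ∧ ∀ y, k * ((p.2 - ⟪y, p.1⟫) + (r.2 - ⟪y, r.1⟫)) = 1 / 2 := by
    intro p r hp hr hpr
    have h1 := hz p hp
    have h2 := hz r hr
    simp only [hpr, inner_neg_right] at h2 ⊢
    have hpos : 0 < p.2 + r.2 := by linarith
    refine ⟨(2 * (p.2 + r.2))⁻¹, by positivity, fun y => ?_⟩
    field_simp
    ring
  obtain ⟨k, hk, hpr⟩ := width hsp hsr hr
  obtain ⟨l, hl, hqq⟩ := width hsq hsq' hq'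
  obtain ⟨L, w, hLw⟩ := exists_linearEquiv_sideCoord (c₁ := k) (c₂ := l) np nq
    (by rw [hpq]; norm_num) hk.ne' hl.ne'
  have h1 : HasType (fun y => L y + w) (affReflection p.1 p.2) ((-1, 0, 0, 1), 0, 0) := by
    rw [hLw]
    intro y
    simp only [sideCoord, affAct, sub_inner_affReflection np, ipp, hpq]
    ext <;> push_cast <;> ring
  have h2 : HasType (fun y => L y + w) (affReflection q.1 q.2) ((1, 0, 0, -1), 0, 0) := by
    rw [hLw]
    intro y
    simp only [sideCoord, affAct, sub_inner_affReflection nq, iqq, hqp]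
    ext <;> push_cast <;> ring
  have h3 : HasType (fun y => L y + w) (affReflection r.1 r.2) ((-1, 0, 0, 1), 1, 0) := by
    rw [hLw]
    intro y
    have := hpr y
    simp only [sideCoord, affAct, sub_inner_affReflection nr]
    simp only [hr, inner_neg_left, inner_neg_right, ipp, hpq] at this ⊢
    ext <;> push_cast
    · linear_combination 2 * this
    · ring
  have h4 : HasType (fun y => L y + w) (affReflection q'.1 q'.2) ((1, 0, 0, -1), 0, 1) := by
    rw [hLw]
    intro y
    have := hqq y
    simp only [sideCoord, affAct, sub_inner_affReflection nq']
    simp only [hq', inner_neg_left, inner_neg_right, iqq, hqp] at this ⊢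
    ext <;> push_cast
    · ring
    · linear_combination 2 * this
  refine ⟨L, w, affSet linR (fun _ _ => True),
    {z | (0 < z.1 ∧ 0 < z.2) ∧ z.1 < 1 / 2 ∧ z.2 < 1 / 2}, (1, 0), (0, 1),
    ⟨by decide, by simp⟩, finite_fst_image_affSet _ _, fun t ht => ?_, fun y hy => ?_,
    affSet_linR_eq_one, by decide, ?_,
    ⟨_, Subgroup.mul_mem _ (affReflection_mem_closure hsr) (affReflection_mem_closure hsp),
      (h3.mul h1).of_eq (by decide)⟩,
    ⟨_, Subgroup.mul_mem _ (affReflection_mem_closure hsq') (affReflection_mem_closure hsq),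
      (h4.mul h2).of_eq (by decide)⟩⟩
  · rcases (hs t).mp ht with rfl | rfl | rfl | rfl
    · exact ⟨_, h1, affMul_mem_affSet (by decide) (fun _ _ _ => trivial)⟩
    · exact ⟨_, h2, affMul_mem_affSet (by decide) (fun _ _ _ => trivial)⟩
    · exact ⟨_, h4, affMul_mem_affSet (by decide) (fun _ _ _ => trivial)⟩
    · exact ⟨_, h3, affMul_mem_affSet (by decide) (fun _ _ _ => trivial)⟩
  · have y1 := mul_pos hk (sub_pos.mpr (hy _ hsp))
    have y2 := mul_pos hl (sub_pos.mpr (hy _ hsq))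
    have y3 := mul_pos hk (sub_pos.mpr (hy _ hsr))
    have y4 := mul_pos hl (sub_pos.mpr (hy _ hsq'))
    have hL : L y + w = _ := congrFun hLw y
    rw [hL]
    refine ⟨⟨y1, y2⟩, ?_, ?_⟩ <;> simp only [sideCoord]
    · linarith [hpr y]
    · linarith [hqq y]
  · rintro ⟨a, b⟩ -
    exact ⟨a, b, by simp⟩

theorem IsPolygon.exists_integralCoordinates (hC : IsPolygon s C) (hCc : IsCompact C)
    (hCi : (interior C).Nonempty) (hCa : HasReflectionAngles C) :
    ∃ L w T R t u, IntegralCoordinates s L w T R t u := by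
  obtain ⟨z, hz⟩ := hCi
  have hzs : ∀ p ∈ s, ⟪z, p.1⟫ < p.2 := fun p hp => by
    rw [hC.eq_polyhedron] at hz
    exact inner_lt_of_mem_interior hz hp (norm_ne_zero_iff.mp (by
      rw [hC.norm_eq_one p hp]; exact one_ne_zero))
  rcases hC.classification hCc hCa with ⟨p, q, q', r, hs, h1, h2, h3⟩ | ⟨p₀, p₁, p₂, hs, h⟩
  · exact hC.integralCoordinates_rectangle hzs hs h1 h2 h3
  · rcases h with ⟨h1, h2, h3⟩ | ⟨h1, h2, h3⟩ | ⟨h1, h2, h3⟩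
    · exact hC.integralCoordinates_equilateral hzs hs h1 (by assumption) (by assumption)
    · exact hC.integralCoordinates_isosceles hzs hs h1 h2 h3
    · exact hC.integralCoordinates_half_equilateral hzs hs h1 h2 h3

end Coordinates

/-! ### The affine Weyl group of a planar foldable figure -/

section Main

lemma essTile_fundamentalDomain {n : ℕ} (b : Module.Basis (Fin n) ℝ (Euc n)) :
    EssTile (isoHom (transSub (Submodule.span ℤ (Set.range b)))) (ZSpan.fundamentalDomain b) := by
  refine Filter.Eventually.of_forall fun x => ?_
  obtain ⟨v, hv, huniq⟩ := ZSpan.exist_unique_vadd_mem_fundamentalDomain b x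
  have hact : ∀ v, isoHom (transSub (Submodule.span ℤ (Set.range b))) (transEquiv _ v) x = v +ᵥ x :=
    fun v => add_comm x (v : Euc n)
  refine ⟨transEquiv _ v, ?_, fun g hg => ?_⟩
  · change isoHom _ (transEquiv _ v) x ∈ _
    rw [hact]
    exact hv
  · obtain ⟨v', rfl⟩ := (transEquiv _).surjective g
    change isoHom _ (transEquiv _ v') x ∈ _ at hg
    rw [hact] at hg
    rw [huniq v' hg]

lemma isFullRankLattice_span {n : ℕ} (b : Module.Basis (Fin n) ℝ (Euc n)) :
    IsFullRankLattice (Submodule.span ℤ (Set.range b)) :=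
  ⟨inferInstance, ZSpan.span_top b⟩

lemma countable_transSub {n : ℕ} (b : Module.Basis (Fin n) ℝ (Euc n)) :
    Countable (transSub (Submodule.span ℤ (Set.range b))) := by
  have : Countable (Submodule.span ℤ (Set.range b)) := inferInstance
  exact (transEquiv _).symm.injective.countable

/-- The affine Weyl group of a planar foldable figure is a crystallographic group with the figure
as a fundamental domain. -/
theorem IsFoldableFigure.exists_isCrystal {C : Set (Euc 2)} (hC : IsFoldableFigure C) :
    ∃ b : Module.Basis (Fin 2) ℝ (Euc 2),
      IsCrystal (Submodule.span ℤ (Set.range b)) (affineWeylGroup C) ∧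
      (∀ g ∈ affineWeylGroup C, ∀ v ∈ Submodule.span ℤ (Set.range b),
        linPart g v ∈ Submodule.span ℤ (Set.range b)) ∧
      EssTile (isoHom (affineWeylGroup C)) C := by
  obtain ⟨t, ht⟩ := hC.exists_polyhedron
  obtain ⟨s, hs⟩ := exists_isPolygon ht hC.nonempty_interior
  obtain ⟨S, hS, hnt, hcong, hsim, hrefl⟩ := hC.exists_cut
  have hF : IsFolding S C := ⟨hC.isCompact, by rw [ht]; exact convex_polyhedron t,
    hC.nonempty_interior, hS, hnt, hcong, hsim, hrefl⟩
  obtain ⟨L, w, T, R, t, u, h⟩ := hs.exists_integralCoordinates hC.isCompact hC.nonempty_interior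
    fun x ν ν' h h' hne => hF.exists_corner_angle hs h h' hne
  exact hs.exists_isCrystal hC.nonempty_interior h

end Main

end

theorem mainTheorem2 (C : Set (Euc 2)) (hC : IsFoldableFigure C) :
    ∃ Γ : Submodule ℤ (Euc 2), IsFullRankLattice Γ ∧
      ∀ A : Matrix (Fin 2) (Fin 2) ℝ, IsExpansive A →
        (∃ W : Set (Euc 2),
          IsTile (translationAct Γ) W ∧
          IsTile (weylAct C) W ∧
          IsTile (dilationAct A 0) W ∧
          IsDilationTranslationWaveletSet A Γ W ∧
          IsDilationReflectionWaveletSet C 0 A W) ∧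
        IsAllowableTriple C Γ A := by
  obtain ⟨b, hcr, hnorm, hCtile⟩ := hC.exists_isCrystal
  obtain ⟨b', hb'⟩ := hcr.exists_common_tile hnorm
  refine ⟨Submodule.span ℤ (Set.range b'), isFullRankLattice_span b', fun A hA => ?_⟩
  obtain ⟨W, hWm, hWb, hWV, hWΓ, hWD⟩ := hb' A hA
  have := hcr.countable
  have := countable_transSub b'
  have tΓ : IsTile (translationAct (Submodule.span ℤ (Set.range b'))) W :=
    (isTile_iff_essTile (quasiInvariant_isoHom _) (transEquiv _) (translationAct_eq _)).mpr
      ⟨hWm, hWΓ⟩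
  have tV : IsTile (weylAct C) W :=
    (isTile_iff_essTile (quasiInvariant_isoHom _) (Equiv.refl _) fun _ _ => rfl).mpr ⟨hWm, hWV⟩
  have tD : IsTile (dilationAct A 0) W :=
    (isTile_iff_essTile (quasiInvariant_dilHom hA.isUnit_det) Multiplicative.ofAdd fun m x => by
      rw [dilHom_apply, dilationAct, sub_zero, add_zero, dil]).mpr ⟨hWm, hWD⟩
  -- Congruence comes from tiling: W and C are tiles of the same affine Weyl group, and likewise W
  -- and the fundamental cell for the lattice.
  have cV : IsCongruentUnder (weylAct C) W C :=
    isCongruentUnder_of_essTile (quasiInvariant_isoHom _) (Equiv.refl _) (fun _ _ => rfl) hWm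
      hC.isCompact.isClosed.measurableSet hWV hCtile
  have cΓ : IsCongruentUnder (translationAct (Submodule.span ℤ (Set.range b'))) W
      (ZSpan.fundamentalDomain b') :=
    isCongruentUnder_of_essTile (quasiInvariant_isoHom _) (transEquiv _) (translationAct_eq _) hWm
      (ZSpan.fundamentalDomain_measurableSet b') hWΓ (essTile_fundamentalDomain b')
  exact ⟨⟨W, tΓ, tV, tD, isDilationTranslationWaveletSet_of_essTile b' hA.isUnit_det hWm
    hWb.measure_lt_top.ne hWΓ hWD, hWm, cV, tD⟩, W, hWm, cV, tD, b', rfl, cΓ⟩
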